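/- **Setting.** Fix the number of columns $d\ge 1$. An infinite stream of updates is given. Each update names an entry of a matrix $A$ with $d$ columns (a row index $i$ and a column $j\in[d]$) or an entry $i$ of a target vector $b$, and it carries a number that is added to that entry; initially all entries are $0$. Let $A_n$ and $b_n$ be the matrix and the vector obtained from the first $n$ updates (with as many rows as have been reached so far). The stream has *unique updates* if every entry of $A$ and of $b$ is updated at most once; the order of the updates is arbitrary, not necessarily row by row. As usual, indices and entries can be stored with logarithmically many bits: for some constants $c,\Delta$, the row index of the $n$-th update is at most $c\,n^{\Delta}$, and its number is a binary fraction $a/2^{s}$ with $a\in\mathbb Z$, $s\in\mathbb N$, $|a|\le c\,n^{\Delta}$ and $2^{s}\le c\,n^{\Delta}$. Let $\sigma_d(A_n)$ be the smallest (the $d$-th) singular value of $A_n$. A *streaming algorithm* reads the updates once, in order. On each update it tosses finitely many fair coins and replaces its memory content by a computable function of the old memory content, the update and the coins; its memory (in bits) is the length of what it keeps between updates, including random bits that are used again later. At every time $n$ a vector $x_n\in\mathbb Q^d$ is computed from the memory content. The stream is fixed independently of the coins. **Statement.** There is an absolute constant $k$ such that for every $d\ge 1$ and every $\delta\in(0,1)$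 there is a streaming algorithm with the following property. For all $c,\Delta$ there is a constant $K$ such that, for every stream as above with unique updates, with constants $c,\Delta$, and with $\sigma_d(A_n)\to\infty$ as $n\to\infty$: 1. the algorithm uses at most $K\log^{k}(n+2)$ bits of memory after $n$ updates, for every $n$ and every outcome of the coins; 2. there is a sequence $\varepsilon_n\to 0$ (which may depend on the stream, and for which no rate is claimed) such that, with probability at least $1-\delta$, for all $n$ the vector $x_n$ is a $(1+\varepsilon_n)$-approximate solution of the least squares regression problem: $$\|A_nx_n-b_n\|\le(1+\varepsilon_n)\min_{x\in\mathbb R^d}\|A_nx-b_n\| .$$ In other words, there is an asymptotically exact streaming algorithm for $(1+\varepsilon)$-approximate least squares regression under unique updates whenever the smallest singular value of the input matrix diverges. -/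

import Mathlib

open MeasureTheory Filter Topology

namespace StreamRegression

/-- One item of the stream: a position `(i, c)` together with a binary number `(a, s)`.
The column `c = some j` is the `j`-th column of the matrix `A`, and `c = none` is the target
vector `b`; the number `(a, s)` stands for `a / 2 ^ s`. -/
abbrev Update (d : ℕ) : Type := (ℕ × Option (Fin d)) × (ℤ × ℕ)

/-- The row index of an update (rows are numbered from `0`). -/
def Update.row {d : ℕ} (u : Update d) : ℕ := u.1.1

/-- The real number `a / 2 ^ s` that an update carries. -/
noncomputable def Update.value {d : ℕ} (u : Update d) : ℝ := (u.2.1 : ℝ) / 2 ^ u.2.2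

/-- An infinite stream of updates. -/
abbrev Stream (d : ℕ) : Type := ℕ → Update d

/-- Unique updates: no position of `A` or `b` is updated more than once. The order in which the
positions are visited is arbitrary. -/
def UniqueUpdates {d : ℕ} (I : Stream d) : Prop :=
  Function.Injective fun t => (I t).1

/-- The data of the stream can be stored with logarithmically many bits: the row index, the
numerator and the denominator of the `(t + 1)`-st update are at most `c * (t + 1) ^ Δ`. -/
def LogBits {d : ℕ} (c Δ : ℕ) (I : Stream d) : Prop :=
  ∀ t : ℕ, (I t).row ≤ c * (t + 1) ^ Δ ∧
    (I t).2.1.natAbs ≤ c * (t + 1) ^ Δ ∧ 2 ^ (I t).2.2 ≤ c * (t + 1) ^ Δ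

/-- The number of rows of the input after the first `n` updates. -/
def rowCount {d : ℕ} (I : Stream d) (n : ℕ) : ℕ :=
  (Finset.range n).sup fun t => (I t).row + 1

/-- The entry at position `p` after the first `n` updates (all entries are `0` initially and
every update is added to the entry at its position). -/
noncomputable def entry {d : ℕ} (I : Stream d) (n : ℕ) (p : ℕ × Option (Fin d)) : ℝ :=
  ∑ t ∈ Finset.range n, if (I t).1 = p then (I t).value else 0

/-- The input matrix `A` after the first `n` updates. -/
noncomputable def dataMatrix {d : ℕ} (I : Stream d) (n : ℕ) :
    Matrix (Fin (rowCount I n)) (Fin d) ℝ :=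
  Matrix.of fun i j => entry I n ((i : ℕ), some j)

/-- The target vector `b` after the first `n` updates. -/
noncomputable def target {d : ℕ} (I : Stream d) (n : ℕ) :
    EuclideanSpace ℝ (Fin (rowCount I n)) :=
  WithLp.toLp 2 fun i => entry I n ((i : ℕ), none)

/-- The smallest singular value `σ_d` of a matrix with `d` columns, `0 < d`: the last one of the
`d` singular values in descending order (Mathlib numbers them from `0`). -/
noncomputable def smallestSingularValue {m d : ℕ} (A : Matrix (Fin m) (Fin d) ℝ) : ℝ :=
  (Matrix.toEuclideanLin A).singularValues (d - 1)

/-- The objective function `‖A x - b‖` of least squares regression, with the Euclidean norm. -/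
noncomputable def residual {m d : ℕ} (A : Matrix (Fin m) (Fin d) ℝ)
    (b : EuclideanSpace ℝ (Fin m)) (x : EuclideanSpace ℝ (Fin d)) : ℝ :=
  ‖Matrix.toEuclideanLin A x - b‖

/-- `x` is a `(1 + ε)`-approximate solution of the least squares regression problem: its objective
value is at most `1 + ε` times that of every vector, in particular of an optimal one. -/
def IsApproxSolution {m d : ℕ} (A : Matrix (Fin m) (Fin d) ℝ)
    (b : EuclideanSpace ℝ (Fin m)) (ε : ℝ) (x : EuclideanSpace ℝ (Fin d)) : Prop :=
  ∀ y : EuclideanSpace ℝ (Fin d), residual A b x ≤ (1 + ε) * residual A b y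

/-- The vector in `ℝ^d` with coordinates `p_j / q`. -/
noncomputable def ratVec {d : ℕ} (r : (Fin d → ℤ) × ℕ) : EuclideanSpace ℝ (Fin d) :=
  WithLp.toLp 2 fun j => (r.1 j : ℝ) / (r.2 : ℝ)

/-- A randomized one-pass streaming algorithm for regression with `d` columns. The contents of its
memory is the bit string `code s` that describes the current state `s`. When an update `u` arrives
in state `s`, the algorithm tosses `coins s u` fresh fair coins and replaces its state; nothing but
the state is kept (random bits that are needed later have to be part of it). At any time a
vector with rational coordinates can be computed from the current state. -/
structure StreamAlg (d : ℕ) where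
  State : Type
  [primcodable : Primcodable State]
  code : State → List Bool
  code_injective : Function.Injective code
  code_computable : Computable code
  init : State
  coins : State → Update d → ℕ
  coins_computable : Computable₂ coins
  step : State → Update d × List Bool → State
  step_computable : Computable₂ step
  output : State → (Fin d → ℤ) × ℕ
  output_computable : Computable output

/-- Outcomes of the coins: `ω (t, j)` is the `j`-th coin available at the `t`-th update. -/
abbrev Coins : Type := ℕ × ℕ → Bool

/-- All the coins are fair and independent. -/
noncomputable def coinMeasure : Measure Coins :=
  Measure.infinitePi fun _ => (PMF.uniformOfFintype Bool).toMeasure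

namespace StreamAlg

variable {d : ℕ}

/-- The state after the first `n` updates of the stream `I`, for the coins `ω`. -/
def run (alg : StreamAlg d) (I : Stream d) (ω : Coins) : ℕ → alg.State
  | 0 => alg.init
  | n + 1 =>
    let s := run alg I ω n
    alg.step s (I n, (List.range (alg.coins s (I n))).map fun j => ω (n, j))

/-- The number of bits in memory after the first `n` updates. -/
def memory (alg : StreamAlg d) (I : Stream d) (ω : Coins) (n : ℕ) : ℕ :=
  (alg.code (alg.run I ω n)).length

/-- The solution that the algorithm holds after the first `n` updates. -/
noncomputable def solution (alg : StreamAlg d) (I : Stream d) (ω : Coins) (n : ℕ) :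
    EuclideanSpace ℝ (Fin d) :=
  ratVec (alg.output (alg.run I ω n))

end StreamAlg

end StreamRegression

/-! Sort the rows of the input into blocks, block `r` holding the rows whose index has `r` binary
digits. Each block gets its own random sign sketch, with a number of sketch rows polynomial in `r +
C`, and the output solves the sketched least squares problem exactly over the rationals. Only
logarithmically many blocks are ever touched, so the memory is polylogarithmic.

Accuracy of the sketches. A high moment bound shows that a sketch of block `r` preserves one fixed
norm up to the factor `1 ± 1 / (r + C)`, except with probability `16 ^ (-(r + C))`. A union bound
over pairs of vectors of an orthonormal basis extends this to all combinations of the `d + 1`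
columns of `[b A]`. Under unique updates block `r` has at most `(d + 1) * 2 ^ r + 1` different
contents over all time, so a second union bound covers all times and then all blocks
(`exists_bad_set_stream`). Block `r` is then always accurate up to a relative error `3 * (d + 1) /
(r + C)`. This is at most `1 / 2` everywhere and tends to `0` as `r` grows.

Limited independence. The moments only need signs that are independent up to about `4 * (r + C)` at
a time. The sign of row `i` is a product of random bits, one for each small modulus `k`, selected by
`i` modulo `k`. Few indices below `2 ^ r` can always be separated from one of them by a small
modulus, since the least common multiple of `1, …, 2 n` grows exponentially (`exists_not_dvd`,
`isWiseSigns_blockSign`).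

Why the error vanishes. Late blocks have accurate sketches. Early blocks, those below a fixed `r₀`,
have only constant accuracy, but unique updates keep their entries bounded for ever. The sketched
minimizer `x` satisfies `‖A x - b‖² ≤ 3 ‖A y - b‖²` for every `y`, hence `‖x - y‖ ≤ 3 ‖A y - b‖ /
σ_d`. As `σ_d` diverges, `x` and `y` are so close that the early blocks hardly distinguish them, in
the true objective and in the sketched one. The early sketch errors therefore cancel in the
comparison (`almost_minimizer`, `GoodSeed.isApproxSolution`). -/

namespace StreamRegression

/-! ### Primitive recursive integer arithmetic and unbounded search -/

section Primrec

variable {α : Type*} [Primcodable α]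

/-- The encoding of the integers sends `n` to `2 * n` and `-(n + 1)` to `2 * n + 1`, so rounding
half of the code upwards gives the absolute value. -/
theorem primrec_int_natAbs : Primrec Int.natAbs := by
  refine ((Primrec.nat_div.comp (Primrec.succ.comp Primrec.encode) (Primrec.const 2)).of_eq ?_)
  rintro (n | n)
  · show (2 * n + 1) / 2 = n
    omega
  · show (2 * n + 1 + 1) / 2 = n + 1
    omega

theorem primrec_int_ofNat : Primrec (fun n : ℕ => (n : ℤ)) := by
  refine Primrec.encode_iff.1 ((Primrec.nat_mul.comp (Primrec.const 2) Primrec.id).of_eq ?_)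
  intro n
  rfl

theorem primrec_int_neg_ofNat : Primrec (fun n : ℕ => -(n : ℤ)) := by
  refine Primrec.encode_iff.1
    ((Primrec.pred.comp (Primrec.nat_mul.comp (Primrec.const 2) Primrec.id)).of_eq ?_)
  rintro (_ | n)
  · rfl
  · show 2 * (n + 1) - 1 = 2 * n + 1
    omega

theorem primrecPred_int_nonneg : PrimrecPred (fun x : ℤ => 0 ≤ x) := by
  refine (Primrec.eq.comp (primrec_int_ofNat.comp primrec_int_natAbs) Primrec.id).of_eq ?_
  intro x
  simp only [id]
  omega

theorem primrec_int_toNat : Primrec Int.toNat := by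
  refine (Primrec.ite primrecPred_int_nonneg primrec_int_natAbs (Primrec.const 0)).of_eq ?_
  intro x
  split_ifs <;> omega

theorem primrec_int_neg : Primrec (fun x : ℤ => -x) := by
  refine (Primrec.ite primrecPred_int_nonneg (primrec_int_neg_ofNat.comp primrec_int_natAbs)
    (primrec_int_ofNat.comp primrec_int_natAbs)).of_eq ?_
  intro x
  split_ifs <;> omega

theorem primrec_int_subNat : Primrec₂ (fun m n : ℕ => (m : ℤ) - n) := by
  refine (Primrec.ite (Primrec.nat_le.comp Primrec.snd Primrec.fst)
    (primrec_int_ofNat.comp (Primrec.nat_sub.comp Primrec.fst Primrec.snd))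
    (primrec_int_neg_ofNat.comp (Primrec.nat_sub.comp Primrec.snd Primrec.fst))).of_eq ?_
  rintro ⟨m, n⟩
  simp only
  split_ifs <;> omega

theorem primrec_int_add : Primrec₂ ((· + ·) : ℤ → ℤ → ℤ) := by
  have hp := primrec_int_toNat
  have hn := primrec_int_toNat.comp primrec_int_neg
  refine (primrec_int_subNat.comp
    (Primrec.nat_add.comp (hp.comp Primrec.fst) (hp.comp Primrec.snd))
    (Primrec.nat_add.comp (hn.comp Primrec.fst) (hn.comp Primrec.snd))).of_eq ?_
  rintro ⟨x, y⟩
  push_cast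
  show ((x.toNat : ℤ) + y.toNat) - ((-x).toNat + (-y).toNat) = x + y
  omega

theorem primrec_int_mul : Primrec₂ ((· * ·) : ℤ → ℤ → ℤ) := by
  have hp := primrec_int_toNat
  have hn := primrec_int_toNat.comp primrec_int_neg
  refine (primrec_int_subNat.comp
    (Primrec.nat_add.comp
      (Primrec.nat_mul.comp (hp.comp Primrec.fst) (hp.comp Primrec.snd))
      (Primrec.nat_mul.comp (hn.comp Primrec.fst) (hn.comp Primrec.snd)))
    (Primrec.nat_add.comp
      (Primrec.nat_mul.comp (hp.comp Primrec.fst) (hn.comp Primrec.snd))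
      (Primrec.nat_mul.comp (hn.comp Primrec.fst) (hp.comp Primrec.snd)))).of_eq ?_
  rintro ⟨x, y⟩
  have hx : x = (x.toNat : ℤ) - (-x).toNat := by omega
  have hy : y = (y.toNat : ℤ) - (-y).toNat := by omega
  push_cast
  show ((x.toNat : ℤ) * y.toNat + (-x).toNat * (-y).toNat) -
    (x.toNat * (-y).toNat + (-x).toNat * y.toNat) = x * y
  conv_rhs => rw [hx, hy]
  ring

theorem primrec_nat_pow : Primrec₂ ((· ^ ·) : ℕ → ℕ → ℕ) :=
  Primrec₂.unpaired'.1 Nat.Primrec.pow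

theorem primrec_nat_size : Primrec Nat.size := by
  have h : PrimrecRel fun n k : ℕ => 2 ^ k ≤ n ∨ k = 0 :=
    PrimrecPred.or
      (Primrec.nat_le.comp (primrec_nat_pow.comp (Primrec.const 2) Primrec.snd) Primrec.fst)
      (Primrec.eq.comp Primrec.snd (Primrec.const 0))
  refine (Primrec.ite (Primrec.eq.comp Primrec.id (Primrec.const 0)) (Primrec.const 0)
    (Primrec.succ.comp (Primrec.nat_findGreatest Primrec.id h))).of_eq ?_
  intro n
  rcases Nat.eq_zero_or_pos n with rfl | hn
  · simp
  · simp only [id, hn.ne', if_false]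
    set m := Nat.findGreatest (fun k => 2 ^ k ≤ n ∨ k = 0) n with hm
    have h1 : 2 ^ m ≤ n := by
      have := Nat.findGreatest_spec (P := fun k => 2 ^ k ≤ n ∨ k = 0) (Nat.zero_le n) (Or.inr rfl)
      rcases this with h | h
      · exact h
      · rw [← hm] at h
        rw [h, pow_zero]
        exact hn
    have h2 : m < n.size := Nat.lt_size.2 h1
    have h3 : n.size - 1 ≤ m := by
      have h4 : 2 ^ (n.size - 1) ≤ n := Nat.lt_size.1 (by omega)
      exact Nat.le_findGreatest (le_trans Nat.lt_two_pow_self.le h4) (Or.inl h4)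
    show m + 1 = n.size
    omega

theorem primrec_sum_range {M : Type} [Primcodable M] [AddCommMonoid M]
    (hadd : Primrec₂ ((· + ·) : M → M → M)) {g : α → ℕ} {f : α → ℕ → M}
    (hg : Primrec g) (hf : Primrec₂ f) :
    Primrec fun a => ∑ k ∈ Finset.range (g a), f a k := by
  have h : Primrec₂ fun (a : α) (p : ℕ × M) => p.2 + f a p.1 :=
    hadd.comp (Primrec.snd.comp Primrec.snd)
      (hf.comp Primrec.fst (Primrec.fst.comp Primrec.snd))
  refine (Primrec.nat_rec' hg (Primrec.const 0) h).of_eq fun a => ?_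
  induction g a with
  | zero => rfl
  | succ n ih => rw [Finset.sum_range_succ, ← ih]

theorem primrec_bool_toNat : Primrec Bool.toNat := Primrec.dom_bool _

theorem computable_find {p : α → ℕ → Bool} (hp : Primrec₂ p) (h : ∀ a, ∃ n, p a n = true) :
    Computable fun a => Nat.find (h a) := by
  have h1 : Partrec fun a => Nat.rfind (fun n => (Part.some (p a n) : Part Bool)) :=
    Partrec.rfind (p := fun a n => Part.some (p a n)) hp.to_comp.partrec₂
  refine h1.of_eq_tot fun a => Nat.mem_rfind.2 ⟨?_, fun {m} hm => ?_⟩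
  · simpa using (Nat.find_spec (h a)).symm
  · have := Nat.find_min (h a) hm
    simpa using this

end Primrec

/-! ### Encoding the memory as a bit string -/

/-- The binary digits of `n`. -/
def bits (n : ℕ) : List Bool :=
  (List.range n.size).map fun j => (n / 2 ^ j % 2 == 1)

theorem bits_length (n : ℕ) : (bits n).length = n.size := by simp [bits]

theorem bits_injective : Function.Injective bits := by
  intro m n h
  have hs : m.size = n.size := by rw [← bits_length, h, bits_length]
  refine Nat.eq_of_testBit_eq fun j => ?_
  by_cases hj : j < m.size
  · have hj' : j < n.size := hs ▸ hj
    have h1 : (bits m)[j]? = (bits n)[j]? := by rw [h]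
    simp [bits, hj, hj'] at h1
    rw [Nat.testBit_eq_decide_div_mod_eq, Nat.testBit_eq_decide_div_mod_eq]
    simpa using h1
  · rw [Nat.testBit_eq_false_of_lt, Nat.testBit_eq_false_of_lt]
    · exact Nat.size_le.1 (by omega)
    · exact Nat.size_le.1 (by omega)

theorem primrec_bits : Primrec bits := by
  refine Primrec.list_map (Primrec.list_range.comp primrec_nat_size) ?_
  exact Primrec.beq.comp (Primrec.nat_mod.comp (Primrec.nat_div.comp Primrec.fst
    (primrec_nat_pow.comp (Primrec.const 2) Primrec.snd)) (Primrec.const 2)) (Primrec.const 1)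

/-- The memory: random bits that have been kept, and a table of integers. -/
abbrev Memory : Type := List Bool × List ℤ

/-- A list of entries as a sequence of symbols, each entry preceded by the separator `none`. -/
def tokens (T : List ℤ) : List (Option Bool) :=
  T.flatMap fun x => none :: (bits (Encodable.encode x)).map some

/-- The content of the memory as a bit string; every symbol takes two bits. -/
def memoryCode (s : Memory) : List Bool :=
  (s.1.map some ++ tokens s.2).flatMap fun o => [o.isSome, o.getD false]

/-- The prefix contains no separator and the remainder is empty or starts with one, so the first
`none` marks where to cut. This makes the memory code uniquely parsable. -/
theorem map_some_append_inj {l l' : List Bool} {A A' : List (Option Bool)}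
    (hA : ∀ o ∈ A.head?, o = none) (hA' : ∀ o ∈ A'.head?, o = none)
    (h : l.map some ++ A = l'.map some ++ A') : l = l' ∧ A = A' := by
  induction l generalizing l' with
  | nil =>
    cases l' with
    | nil => exact ⟨rfl, by simpa using h⟩
    | cons b l' =>
      simp only [List.map_nil, List.nil_append, List.map_cons, List.cons_append] at h
      have := hA (some b) (by simp [h])
      simp at this
  | cons b l ih =>
    cases l' with
    | nil =>
      simp only [List.map_nil, List.nil_append, List.map_cons, List.cons_append] at h
      have := hA' (some b) (by simp [← h])
      simp at this
    | cons b' l' =>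
      simp only [List.map_cons, List.cons_append, List.cons.injEq, Option.some.injEq] at h
      obtain ⟨h1, h2⟩ := ih h.2
      exact ⟨by rw [h.1, h1], h2⟩

theorem tokens_head (T : List ℤ) : ∀ o ∈ (tokens T).head?, o = none := by
  cases T with
  | nil => simp [tokens]
  | cons x T => simp [tokens]

theorem tokens_injective : Function.Injective tokens := by
  intro T
  induction T with
  | nil =>
    intro T' h
    cases T' with
    | nil => rfl
    | cons x T' => simp [tokens] at h
  | cons x T ih =>
    intro T' h
    cases T' with
    | nil => simp [tokens] at h
    | cons x' T' =>
      have h' : (bits (Encodable.encode x)).map some ++ tokens T =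
          (bits (Encodable.encode x')).map some ++ tokens T' := by
        simpa [tokens] using h
      obtain ⟨h1, h2⟩ := map_some_append_inj (tokens_head T) (tokens_head T') h'
      rw [ih h2, Encodable.encode_injective (bits_injective h1)]

theorem flatMap_symbol_injective :
    Function.Injective fun l : List (Option Bool) =>
      l.flatMap fun o => [o.isSome, o.getD false] := by
  intro l
  induction l with
  | nil =>
    intro l' h
    cases l' with
    | nil => rfl
    | cons x l' => simp at h
  | cons x l ih =>
    intro l' h
    cases l' with
    | nil => simp at h
    | cons x' l' =>
      simp only [List.flatMap_cons, List.cons_append, List.nil_append, List.cons.injEq] at h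
      obtain ⟨h1, h2, h3⟩ := h
      rw [ih h3]
      cases x <;> cases x' <;> simp_all

theorem memoryCode_injective : Function.Injective memoryCode := by
  rintro ⟨s, T⟩ ⟨s', T'⟩ h
  have h1 := flatMap_symbol_injective h
  obtain ⟨h2, h3⟩ := map_some_append_inj (tokens_head T) (tokens_head T') h1
  exact Prod.ext h2 (tokens_injective h3)

theorem memoryCode_length (s : Memory) :
    (memoryCode s).length =
      2 * (s.1.length + (s.2.map fun x => 1 + (Encodable.encode x).size).sum) := by
  have h1 : ∀ l : List (Option Bool),
      (l.flatMap fun o => [o.isSome, o.getD false]).length = 2 * l.length := by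
    intro l
    induction l with
    | nil => rfl
    | cons x l ih => simp [ih]; ring
  rw [memoryCode, h1]
  simp [tokens, List.length_flatMap, bits_length, add_comm]

theorem primrec_memoryCode : Primrec memoryCode := by
  have h1 : Primrec tokens := by
    refine Primrec.list_flatMap Primrec.id ?_
    refine Primrec.list_cons.comp (Primrec.const none) ?_
    refine Primrec.list_map (primrec_bits.comp (Primrec.encode.comp Primrec.snd)) ?_
    exact Primrec.option_some.comp Primrec.snd
  refine Primrec.list_flatMap (Primrec.list_append.comp
    (Primrec.list_map Primrec.fst (Primrec.option_some.comp Primrec.snd))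
    (h1.comp Primrec.snd)) ?_
  exact Primrec.list_cons.comp (Primrec.option_isSome.comp Primrec.snd)
    (Primrec.list_cons.comp (Primrec.option_getD.comp Primrec.snd (Primrec.const false))
      (Primrec.const []))

/-! ### The sketch, its update rule and the sketched normal equations -/

/-- The rows of the input with `r` binary digits form the block `r`. The sketch of this block
consists of `2 ^ (2 * scaleExp C r)` signed sums of rows. -/
def scaleExp (C r : ℕ) : ℕ := 8 + 4 * (r + C).size

/-- A power of four, so that the normalization by the square root of the number of sketch rows is
division by `2 ^ scaleExp C r` and all sketch entries stay binary fractions. -/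
def sketchRows (C r : ℕ) : ℕ := 4 ^ scaleExp C r

/-- The hash function of block `r` uses the residues modulo `1, …, modBound C r`. -/
def modBound (C r : ℕ) : ℕ := 8 * (r + C) ^ 2 + 8

/-- The random bit for sketch row `l` and the residue class `a` modulo `k`. All blocks share these
bits; independence between blocks is never needed because blocks are combined by a union bound. -/
def bitIndex (l k a : ℕ) : ℕ := Nat.pair l (Nat.pair k a)

/-- The number of random bits that are `1` among those selected by sketch row `l` and the
residues of `i`. -/
def hashCount (β : ℕ → Bool) (Q l i : ℕ) : ℕ :=
  ∑ k ∈ Finset.range Q, (β (bitIndex l (k + 1) (i % (k + 1)))).toNat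

def hashSign (β : ℕ → Bool) (Q l i : ℕ) : ℤ :=
  if hashCount β Q l i % 2 = 0 then 1 else -1

/-- A bound for the indices of the random bits that the rows of block `r` need. -/
def seedLength (C r : ℕ) : ℕ := (sketchRows C r + (modBound C r + 1) ^ 2 + 1) ^ 2

/-- A bound for the indices of the table entries that the update `u` changes. -/
def keyBound {d : ℕ} (C : ℕ) (u : Update d) : ℕ :=
  ((u.row.size + sketchRows C u.row.size + 1) ^ 2 +
    (d + (u.2.2 + scaleExp C u.row.size) + 2) ^ 2 + 1) ^ 2

/-- The number that the update `u` adds to the table entry `κ`. -/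
def increment {d : ℕ} (C : ℕ) (β : ℕ → Bool) (κ : ℕ) (u : Update d) : ℤ :=
  if (κ.unpair.1.unpair.1 = u.row.size ∧ κ.unpair.1.unpair.2 < sketchRows C u.row.size) ∧
      κ.unpair.2 = Nat.pair (Encodable.encode u.1.2) (u.2.2 + scaleExp C u.row.size) then
    hashSign β (modBound C u.row.size) κ.unpair.1.unpair.2 u.row * u.2.1
  else 0

/-- Only coins beyond the stored seed are appended, so a random bit never changes once it is in
memory. -/
def newSeed (seed bits : List Bool) : List Bool := seed ++ bits.drop seed.length

def newTable {d : ℕ} (C : ℕ) (seed : List Bool) (T : List ℤ) (u : Update d) : List ℤ :=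
  (List.range (max T.length (keyBound C u))).map fun κ =>
    T.getD κ 0 + increment C (fun b => seed.getD b false) κ u

def sketchStep {d : ℕ} (C : ℕ) (s : Memory) (p : Update d × List Bool) : Memory :=
  (newSeed s.1 p.2, newTable C (newSeed s.1 p.2) s.2 p.1)

/-- The entry in row `ρ` and column `c` of the sketch, multiplied by `2 ^ T.length`. -/
def sketchEntry (T : List ℤ) (ρ c : ℕ) : ℤ :=
  ∑ κ ∈ Finset.range T.length,
    if κ.unpair.1 = ρ ∧ κ.unpair.2.unpair.1 = c then
      T.getD κ 0 * (2 ^ (T.length - κ.unpair.2.unpair.2) : ℕ) else 0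

/-- The coefficients `-q, p_1, …, p_d` of the columns of `[b A]`. -/
def coeff {d : ℕ} (x : (Fin d → ℤ) × ℕ) (c : ℕ) : ℤ :=
  (-(x.2 : ℤ) :: List.ofFn x.1).getD c 0

/-- The left-hand side of the `j`-th normal equation of the sketched regression problem. -/
def normalEq {d : ℕ} (T : List ℤ) (x : (Fin d → ℤ) × ℕ) (j : ℕ) : ℤ :=
  ∑ ρ ∈ Finset.range T.length, sketchEntry T ρ (j + 1) *
    ∑ c ∈ Finset.range (d + 1), sketchEntry T ρ c * coeff x c

def IsSketchSolution {d : ℕ} (T : List ℤ) (x : (Fin d → ℤ) × ℕ) : Prop :=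
  0 < x.2 ∧ ∀ j < d, normalEq T x j = 0

instance {d : ℕ} (T : List ℤ) (x : (Fin d → ℤ) × ℕ) : Decidable (IsSketchSolution T x) :=
  inferInstanceAs (Decidable (_ ∧ _))

/-! ### Computability of the algorithm -/

theorem primrec_scaleExp (C : ℕ) : Primrec (scaleExp C) :=
  Primrec.nat_add.comp (Primrec.const 8) (Primrec.nat_mul.comp (Primrec.const 4)
    (primrec_nat_size.comp (Primrec.nat_add.comp Primrec.id (Primrec.const C))))

theorem primrec_sketchRows (C : ℕ) : Primrec (sketchRows C) :=
  primrec_nat_pow.comp (Primrec.const 4) (primrec_scaleExp C)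

theorem primrec_modBound (C : ℕ) : Primrec (modBound C) :=
  Primrec.nat_add.comp (Primrec.nat_mul.comp (Primrec.const 8)
    (primrec_nat_pow.comp (Primrec.nat_add.comp Primrec.id (Primrec.const C)) (Primrec.const 2)))
    (Primrec.const 8)

theorem primrec_seedLength (C : ℕ) : Primrec (seedLength C) :=
  primrec_nat_pow.comp (Primrec.succ.comp (Primrec.nat_add.comp (primrec_sketchRows C)
    (primrec_nat_pow.comp (Primrec.succ.comp (primrec_modBound C)) (Primrec.const 2))))
    (Primrec.const 2)

theorem primrec_row (d : ℕ) : Primrec (Update.row (d := d)) := Primrec.fst.comp Primrec.fst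

theorem primrec_rowSize (d : ℕ) : Primrec fun u : Update d => u.row.size :=
  primrec_nat_size.comp (primrec_row d)

theorem primrec_keyBound (d C : ℕ) : Primrec (keyBound (d := d) C) := by
  have h1 := primrec_rowSize d
  refine primrec_nat_pow.comp (Primrec.succ.comp (Primrec.nat_add.comp
    (primrec_nat_pow.comp (Primrec.succ.comp (Primrec.nat_add.comp h1
      ((primrec_sketchRows C).comp h1))) (Primrec.const 2))
    (primrec_nat_pow.comp (Primrec.nat_add.comp (Primrec.nat_add.comp (Primrec.const d)
      (Primrec.nat_add.comp (Primrec.snd.comp Primrec.snd) ((primrec_scaleExp C).comp h1)))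
      (Primrec.const 2)) (Primrec.const 2)))) (Primrec.const 2)

theorem primrec_hashSign :
    Primrec fun p : List Bool × ℕ × ℕ × ℕ =>
      hashSign (fun b => p.1.getD b false) p.2.1 p.2.2.1 p.2.2.2 := by
  have h : Primrec fun p : List Bool × ℕ × ℕ × ℕ =>
      hashCount (fun b => p.1.getD b false) p.2.1 p.2.2.1 p.2.2.2 := by
    refine primrec_sum_range Primrec.nat_add (Primrec.fst.comp Primrec.snd) ?_
    refine primrec_bool_toNat.comp ((Primrec.list_getD false).comp
      (Primrec.fst.comp Primrec.fst) ?_)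
    have h1 : Primrec fun x : (List Bool × ℕ × ℕ × ℕ) × ℕ => x.1.2.2 :=
      Primrec.snd.comp (Primrec.snd.comp Primrec.fst)
    have hk : Primrec fun x : (List Bool × ℕ × ℕ × ℕ) × ℕ => x.2 + 1 :=
      Primrec.succ.comp Primrec.snd
    exact Primrec₂.natPair.comp (Primrec.fst.comp h1)
      (Primrec₂.natPair.comp hk (Primrec.nat_mod.comp (Primrec.snd.comp h1) hk))
  exact Primrec.ite (Primrec.eq.comp (Primrec.nat_mod.comp h (Primrec.const 2))
    (Primrec.const 0)) (Primrec.const 1) (Primrec.const (-1))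

theorem primrec_hashSign_comp {α : Type*} [Primcodable α] {s : α → List Bool} {Q l i : α → ℕ}
    (hs : Primrec s) (hQ : Primrec Q) (hl : Primrec l) (hi : Primrec i) :
    Primrec fun a => hashSign (fun b => (s a).getD b false) (Q a) (l a) (i a) :=
  Primrec.comp (g := fun a => (s a, Q a, l a, i a)) primrec_hashSign
    (Primrec.pair hs (Primrec.pair hQ (Primrec.pair hl hi)))

theorem primrecPred_increment (d C : ℕ) :
    PrimrecPred fun p : ℕ × Update d =>
      (p.1.unpair.1.unpair.1 = p.2.row.size ∧
        p.1.unpair.1.unpair.2 < sketchRows C p.2.row.size) ∧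
      p.1.unpair.2 = Nat.pair (Encodable.encode p.2.1.2) (p.2.2.2 + scaleExp C p.2.row.size) := by
  have hr : Primrec fun p : ℕ × Update d => p.2.row.size := (primrec_rowSize d).comp Primrec.snd
  have hk : Primrec fun p : ℕ × Update d => p.1.unpair := Primrec.unpair.comp Primrec.fst
  have hk1 : Primrec fun p : ℕ × Update d => p.1.unpair.1.unpair :=
    Primrec.unpair.comp (Primrec.fst.comp hk)
  have hm : Primrec fun p : ℕ × Update d => sketchRows C p.2.row.size :=
    (primrec_sketchRows C).comp hr
  have he : Primrec fun p : ℕ × Update d => scaleExp C p.2.row.size :=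
    (primrec_scaleExp C).comp hr
  have hc : Primrec fun p : ℕ × Update d => Encodable.encode p.2.1.2 :=
    Primrec.encode.comp (Primrec.snd.comp (Primrec.fst.comp Primrec.snd))
  have hs : Primrec fun p : ℕ × Update d => p.2.2.2 :=
    Primrec.snd.comp (Primrec.snd.comp Primrec.snd)
  have h1 := Primrec.eq.comp (Primrec.fst.comp hk1) hr
  have h2 := Primrec.nat_lt.comp (Primrec.snd.comp hk1) hm
  have h3 := Primrec.eq.comp (Primrec.snd.comp hk)
    (Primrec₂.natPair.comp hc (Primrec.nat_add.comp hs he))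
  exact PrimrecPred.and (PrimrecPred.and h1 h2) h3

theorem primrec_increment (d C : ℕ) :
    Primrec fun p : (List Bool × Update d) × ℕ =>
      increment C (fun b => p.1.1.getD b false) p.2 p.1.2 := by
  have hu : Primrec fun p : (List Bool × Update d) × ℕ => p.1.2 := Primrec.snd.comp Primrec.fst
  have hr : Primrec fun p : (List Bool × Update d) × ℕ => p.1.2.row.size :=
    (primrec_rowSize d).comp hu
  have hQ : Primrec fun p : (List Bool × Update d) × ℕ => modBound C p.1.2.row.size :=
    (primrec_modBound C).comp hr
  have hi : Primrec fun p : (List Bool × Update d) × ℕ => p.1.2.row := (primrec_row d).comp hu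
  have hl : Primrec fun p : (List Bool × Update d) × ℕ => p.2.unpair.1.unpair.2 :=
    Primrec.snd.comp (Primrec.unpair.comp (Primrec.fst.comp (Primrec.unpair.comp Primrec.snd)))
  have ha : Primrec fun p : (List Bool × Update d) × ℕ => p.1.2.2.1 :=
    Primrec.fst.comp (Primrec.snd.comp hu)
  have hs : Primrec fun p : (List Bool × Update d) × ℕ => p.1.1 := Primrec.fst.comp Primrec.fst
  have hS : Primrec fun p : (List Bool × Update d) × ℕ =>
      hashSign (fun b => p.1.1.getD b false) (modBound C p.1.2.row.size)
        p.2.unpair.1.unpair.2 p.1.2.row :=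
    primrec_hashSign_comp hs hQ hl hi
  have hP := (primrecPred_increment d C).comp (Primrec.pair Primrec.snd hu)
  exact Primrec.ite hP (primrec_int_mul.comp hS ha) (Primrec.const 0)

theorem primrec_newSeed : Primrec₂ newSeed :=
  Primrec.list_append.comp Primrec.fst (Primrec.list_drop.comp
    (Primrec.list_length.comp Primrec.fst) Primrec.snd)

theorem primrec_newTable (d C : ℕ) :
    Primrec fun x : (List Bool × Update d) × List ℤ => newTable C x.1.1 x.2 x.1.2 := by
  have hl : Primrec fun x : (List Bool × Update d) × List ℤ =>
      List.range (max x.2.length (keyBound C x.1.2)) :=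
    Primrec.list_range.comp (Primrec.nat_max.comp (Primrec.list_length.comp Primrec.snd)
      ((primrec_keyBound d C).comp (Primrec.snd.comp Primrec.fst)))
  have hT : Primrec fun y : ((List Bool × Update d) × List ℤ) × ℕ => y.1.2.getD y.2 0 :=
    (Primrec.list_getD 0).comp (Primrec.snd.comp Primrec.fst) Primrec.snd
  have hI : Primrec fun y : ((List Bool × Update d) × List ℤ) × ℕ =>
      increment C (fun b => y.1.1.1.getD b false) y.2 y.1.1.2 :=
    Primrec.comp (g := fun y : ((List Bool × Update d) × List ℤ) × ℕ => (y.1.1, y.2))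
      (primrec_increment d C) (Primrec.pair (Primrec.fst.comp Primrec.fst) Primrec.snd)
  have h : Primrec₂ fun (x : (List Bool × Update d) × List ℤ) (κ : ℕ) =>
      x.2.getD κ 0 + increment C (fun b => x.1.1.getD b false) κ x.1.2 :=
    primrec_int_add.comp hT hI
  exact Primrec.list_map hl h

theorem primrec_sketchStep (d C : ℕ) : Primrec₂ (sketchStep (d := d) C) := by
  have h1 : Primrec fun x : Memory × (Update d × List Bool) => newSeed x.1.1 x.2.2 :=
    primrec_newSeed.comp (Primrec.fst.comp Primrec.fst) (Primrec.snd.comp Primrec.snd)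
  have h2 : Primrec fun x : Memory × (Update d × List Bool) =>
      newTable C (newSeed x.1.1 x.2.2) x.1.2 x.2.1 :=
    Primrec.comp (g := fun x : Memory × (Update d × List Bool) =>
      ((newSeed x.1.1 x.2.2, x.2.1), x.1.2)) (primrec_newTable d C)
      (Primrec.pair (Primrec.pair h1 (Primrec.fst.comp Primrec.snd))
        (Primrec.snd.comp Primrec.fst))
  exact Primrec.pair h1 h2

theorem primrec_sketchEntry : Primrec fun p : List ℤ × ℕ × ℕ => sketchEntry p.1 p.2.1 p.2.2 := by
  have hk : Primrec fun x : (List ℤ × ℕ × ℕ) × ℕ => x.2.unpair := Primrec.unpair.comp Primrec.snd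
  have hk2 : Primrec fun x : (List ℤ × ℕ × ℕ) × ℕ => x.2.unpair.2.unpair :=
    Primrec.unpair.comp (Primrec.snd.comp hk)
  have hT : Primrec fun x : (List ℤ × ℕ × ℕ) × ℕ => x.1.1 := Primrec.fst.comp Primrec.fst
  have hρ : Primrec fun x : (List ℤ × ℕ × ℕ) × ℕ => x.1.2 := Primrec.snd.comp Primrec.fst
  have hE : Primrec fun x : (List ℤ × ℕ × ℕ) × ℕ => x.1.1.length - x.2.unpair.2.unpair.2 :=
    Primrec.nat_sub.comp (Primrec.list_length.comp hT) (Primrec.snd.comp hk2)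
  have hW : Primrec fun x : (List ℤ × ℕ × ℕ) × ℕ =>
      ((2 ^ (x.1.1.length - x.2.unpair.2.unpair.2) : ℕ) : ℤ) :=
    primrec_int_ofNat.comp (primrec_nat_pow.comp (Primrec.const 2) hE)
  have hG : Primrec fun x : (List ℤ × ℕ × ℕ) × ℕ => x.1.1.getD x.2 0 :=
    (Primrec.list_getD 0).comp hT Primrec.snd
  have h1 := Primrec.eq.comp (Primrec.fst.comp hk) (Primrec.fst.comp hρ)
  have h2 := Primrec.eq.comp (Primrec.fst.comp hk2) (Primrec.snd.comp hρ)
  have h : Primrec₂ fun (p : List ℤ × ℕ × ℕ) (κ : ℕ) =>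
      if κ.unpair.1 = p.2.1 ∧ κ.unpair.2.unpair.1 = p.2.2 then
        p.1.getD κ 0 * (2 ^ (p.1.length - κ.unpair.2.unpair.2) : ℕ) else 0 :=
    Primrec.ite (PrimrecPred.and h1 h2) (primrec_int_mul.comp hG hW) (Primrec.const 0)
  exact primrec_sum_range primrec_int_add (Primrec.list_length.comp Primrec.fst) h

theorem primrec_sketchEntry_comp {α : Type*} [Primcodable α] {T : α → List ℤ} {ρ c : α → ℕ}
    (hT : Primrec T) (hρ : Primrec ρ) (hc : Primrec c) :
    Primrec fun a => sketchEntry (T a) (ρ a) (c a) :=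
  Primrec.comp (g := fun a => (T a, ρ a, c a)) primrec_sketchEntry
    (Primrec.pair hT (Primrec.pair hρ hc))

theorem primrec_coeff (d : ℕ) : Primrec₂ (coeff (d := d)) := by
  refine (Primrec.list_getD 0).comp (Primrec.list_cons.comp
    (primrec_int_neg_ofNat.comp (Primrec.snd.comp Primrec.fst)) ?_) Primrec.snd
  refine Primrec.list_ofFn fun i => ?_
  exact Primrec.fin_app.comp (Primrec.fst.comp Primrec.fst) (Primrec.const i)

theorem primrec_normalEq (d : ℕ) :
    Primrec fun p : (List ℤ × ((Fin d → ℤ) × ℕ)) × ℕ => normalEq p.1.1 p.1.2 p.2 := by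
  have hT : Primrec fun x : ((List ℤ × ((Fin d → ℤ) × ℕ)) × ℕ) × ℕ => x.1.1.1 :=
    Primrec.fst.comp (Primrec.fst.comp Primrec.fst)
  have hE : Primrec fun x : ((List ℤ × ((Fin d → ℤ) × ℕ)) × ℕ) × ℕ =>
      sketchEntry x.1.1.1 x.2 (x.1.2 + 1) :=
    primrec_sketchEntry_comp hT Primrec.snd (Primrec.succ.comp (Primrec.snd.comp Primrec.fst))
  have hT2 : Primrec fun y : (((List ℤ × ((Fin d → ℤ) × ℕ)) × ℕ) × ℕ) × ℕ => y.1.1.1.1 :=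
    hT.comp Primrec.fst
  have hx2 : Primrec fun y : (((List ℤ × ((Fin d → ℤ) × ℕ)) × ℕ) × ℕ) × ℕ => y.1.1.1.2 :=
    Primrec.snd.comp (Primrec.fst.comp (Primrec.fst.comp Primrec.fst))
  have hE2 : Primrec fun y : (((List ℤ × ((Fin d → ℤ) × ℕ)) × ℕ) × ℕ) × ℕ =>
      sketchEntry y.1.1.1.1 y.1.2 y.2 :=
    primrec_sketchEntry_comp hT2 (Primrec.snd.comp Primrec.fst) Primrec.snd
  have hc : Primrec fun y : (((List ℤ × ((Fin d → ℤ) × ℕ)) × ℕ) × ℕ) × ℕ =>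
      coeff y.1.1.1.2 y.2 := (primrec_coeff d).comp hx2 Primrec.snd
  have h1 : Primrec₂ fun (x : ((List ℤ × ((Fin d → ℤ) × ℕ)) × ℕ) × ℕ) (c : ℕ) =>
      sketchEntry x.1.1.1 x.2 c * coeff x.1.1.2 c := primrec_int_mul.comp hE2 hc
  have h2 : Primrec fun x : ((List ℤ × ((Fin d → ℤ) × ℕ)) × ℕ) × ℕ =>
      ∑ c ∈ Finset.range (d + 1), sketchEntry x.1.1.1 x.2 c * coeff x.1.1.2 c :=
    primrec_sum_range primrec_int_add (Primrec.const (d + 1)) h1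
  have h3 : Primrec₂ fun (p : (List ℤ × ((Fin d → ℤ) × ℕ)) × ℕ) (ρ : ℕ) =>
      sketchEntry p.1.1 ρ (p.2 + 1) *
        ∑ c ∈ Finset.range (d + 1), sketchEntry p.1.1 ρ c * coeff p.1.2 c :=
    primrec_int_mul.comp hE h2
  exact primrec_sum_range primrec_int_add
    (Primrec.list_length.comp (Primrec.fst.comp Primrec.fst)) h3

theorem primrecPred_isSketchSolution (d : ℕ) :
    PrimrecPred fun p : List ℤ × ((Fin d → ℤ) × ℕ) => IsSketchSolution p.1 p.2 := by
  have h : PrimrecPred fun p : List ℤ × ((Fin d → ℤ) × ℕ) =>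
      (List.range d).map (fun j => normalEq p.1 p.2 j) = (List.range d).map fun _ => (0 : ℤ) :=
    Primrec.eq.comp (Primrec.list_map (Primrec.const _) (primrec_normalEq d))
      (Primrec.const _)
  refine (PrimrecPred.and (Primrec.nat_lt.comp (Primrec.const 0)
    (Primrec.snd.comp Primrec.snd)) h).of_eq fun p => ?_
  simp only [IsSketchSolution, List.map_inj_left, List.mem_range]

/-- The test whether the code `n` belongs to a solution of the sketched problem. -/
def codesSolution (d : ℕ) (T : List ℤ) (n : ℕ) : Bool :=
  ((@Encodable.decode ((Fin d → ℤ) × ℕ) Primcodable.toEncodable n).map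
    fun x => decide (IsSketchSolution T x)).getD false

theorem primrec_codesSolution (d : ℕ) : Primrec₂ (codesSolution d) := by
  refine Primrec.option_getD.comp (Primrec.option_map (Primrec.decode.comp Primrec.snd) ?_)
    (Primrec.const false)
  exact (primrecPred_isSketchSolution d).decide.comp
    (Primrec.pair (Primrec.fst.comp Primrec.fst) Primrec.snd)

/-! ### Moments of Rademacher sums -/

section Rademacher

variable {ι : Type*} [Fintype ι]

def boolSign (b : Bool) : ℝ := if b then 1 else -1

theorem boolSign_sq (b : Bool) : boolSign b ^ 2 = 1 := by
  cases b <;> simp [boolSign]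

theorem boolSign_not (b : Bool) : boolSign (!b) = -boolSign b := by
  cases b <;> simp [boolSign]

/-- The left-hand side factors into hyperbolic cosines, and `cosh a ≤ exp (a ^ 2 / 2)`. -/
theorem sum_exp_boolSign_le [DecidableEq ι] (v : ι → ℝ) :
    ∑ ε : ι → Bool, Real.exp (∑ i, boolSign (ε i) * v i) ≤
      2 ^ Fintype.card ι * Real.exp ((∑ i, v i ^ 2) / 2) := by
  have h1 : ∑ ε : ι → Bool, Real.exp (∑ i, boolSign (ε i) * v i) =
      ∏ i, ∑ b : Bool, Real.exp (boolSign b * v i) := by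
    rw [Finset.prod_univ_sum, Fintype.piFinset_univ]
    exact Finset.sum_congr rfl fun ε _ => Real.exp_sum _ _
  have h2 : ∀ i, ∑ b : Bool, Real.exp (boolSign b * v i) ≤ 2 * Real.exp (v i ^ 2 / 2) := by
    intro i
    have := Real.cosh_le_exp_half_sq (v i)
    rw [Real.cosh_eq] at this
    simp only [Fintype.sum_bool, boolSign, if_true]
    simp only [Bool.false_eq_true, if_false, one_mul, neg_mul]
    linarith
  rw [h1]
  calc ∏ i, ∑ b : Bool, Real.exp (boolSign b * v i)
      ≤ ∏ i, 2 * Real.exp (v i ^ 2 / 2) :=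
        Finset.prod_le_prod (fun i _ => Finset.sum_nonneg fun b _ => (Real.exp_pos _).le)
          fun i _ => h2 i
    _ = 2 ^ Fintype.card ι * Real.exp ((∑ i, v i ^ 2) / 2) := by
        rw [Finset.prod_mul_distrib, ← Real.exp_sum, Finset.sum_div]
        simp

/-- After scaling to `∑ i, v i ^ 2 = 1`, bound `y ^ (2 * k) / (2 * k)!` by `exp y + exp (-y)` and
apply the exponential moment bound to `v` and `-v`. -/
theorem sum_boolSign_pow_le [DecidableEq ι] (v : ι → ℝ) (k : ℕ) :
    ∑ ε : ι → Bool, (∑ i, boolSign (ε i) * v i) ^ (2 * k) ≤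
      2 ^ Fintype.card ι * (4 * (2 * k).factorial * (∑ i, v i ^ 2) ^ k) := by
  have hexp : Real.exp (1 / 2) ≤ 2 := by
    have h1 := Real.exp_one_lt_d9
    have h2 : Real.exp (1 / 2) ^ 2 = Real.exp 1 := by rw [← Real.exp_nat_mul]; norm_num
    nlinarith [Real.exp_pos (1 / 2)]
  have hunit : ∀ u : ι → ℝ, ∑ i, u i ^ 2 = 1 →
      ∑ ε : ι → Bool, (∑ i, boolSign (ε i) * u i) ^ (2 * k) ≤
        2 ^ Fintype.card ι * (4 * (2 * k).factorial) := by
    intro u hu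
    have hpt : ∀ y : ℝ, y ^ (2 * k) ≤ (2 * k).factorial * (Real.exp y + Real.exp (-y)) := by
      intro y
      have h1 := Real.pow_div_factorial_le_exp |y| (abs_nonneg y) (2 * k)
      have h2 : |y| ^ (2 * k) = y ^ (2 * k) := by rw [pow_mul, sq_abs, ← pow_mul]
      have hf : (0 : ℝ) < (2 * k).factorial := by exact_mod_cast Nat.factorial_pos _
      rw [h2, div_le_iff₀ hf] at h1
      have h3 : Real.exp |y| ≤ Real.exp y + Real.exp (-y) := by
        rcases abs_cases y with h | h <;> rw [h.1]
        · linarith [Real.exp_pos (-y)]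
        · linarith [Real.exp_pos y]
      nlinarith
    have hneg : ∀ ε : ι → Bool, -∑ i, boolSign (ε i) * u i = ∑ i, boolSign (ε i) * (-u i) := by
      intro ε
      simp
    calc ∑ ε : ι → Bool, (∑ i, boolSign (ε i) * u i) ^ (2 * k)
        ≤ ∑ ε : ι → Bool, ((2 * k).factorial : ℝ) * (Real.exp (∑ i, boolSign (ε i) * u i) +
            Real.exp (∑ i, boolSign (ε i) * (-u i))) :=
          Finset.sum_le_sum fun ε _ => by rw [← hneg]; exact hpt _
      _ ≤ (2 * k).factorial * (2 ^ Fintype.card ι * 2 + 2 ^ Fintype.card ι * 2) := by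
          rw [← Finset.mul_sum, Finset.sum_add_distrib]
          have h1 := sum_exp_boolSign_le u
          have h2 := sum_exp_boolSign_le (fun i => -u i)
          simp only [neg_sq, hu] at h1 h2
          have h3 : (2 : ℝ) ^ Fintype.card ι * Real.exp (1 / 2) ≤ 2 ^ Fintype.card ι * 2 := by
            gcongr
          gcongr <;> linarith
      _ = 2 ^ Fintype.card ι * (4 * (2 * k).factorial) := by ring
  set V := ∑ i, v i ^ 2 with hV
  have hV0 : 0 ≤ V := Finset.sum_nonneg fun i _ => sq_nonneg _
  rcases hV0.eq_or_lt with h0 | hpos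
  · have hv : ∀ i, v i = 0 := by
      intro i
      have := (Finset.sum_eq_zero_iff_of_nonneg (fun i _ => sq_nonneg (v i))).1 h0.symm i
        (Finset.mem_univ i)
      simpa using this
    rcases Nat.eq_zero_or_pos k with rfl | hk
    · simp
    · simp [hv, ← h0, hk.ne']
  · have hs : 0 < √V := Real.sqrt_pos.2 hpos
    have h1 := hunit (fun i => v i / √V) (by
      simp_rw [div_pow, Real.sq_sqrt hV0]
      rw [← Finset.sum_div, ← hV, div_self hpos.ne'])
    have h2 : ∀ ε : ι → Bool, (∑ i, boolSign (ε i) * v i) ^ (2 * k) =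
        V ^ k * (∑ i, boolSign (ε i) * (v i / √V)) ^ (2 * k) := by
      intro ε
      have : ∑ i, boolSign (ε i) * v i = √V * ∑ i, boolSign (ε i) * (v i / √V) := by
        rw [Finset.mul_sum]
        refine Finset.sum_congr rfl fun i _ => ?_
        field_simp
      rw [this, mul_pow, pow_mul (√V), Real.sq_sqrt hV0]
    simp_rw [h2]
    rw [← Finset.mul_sum]
    calc _ ≤ V ^ k * (2 ^ Fintype.card ι * (4 * (2 * k).factorial)) := by gcongr
      _ = _ := by ring

/-- Turning over the sign `i` is an involution that negates every summand. -/
theorem sum_prod_boolSign_eq_zero [DecidableEq ι] {J : Type*} [Fintype J] (x : J → ι) (i : ι)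
    (h : Odd (Finset.univ.filter fun j => x j = i).card) :
    ∑ ε : ι → Bool, ∏ j, boolSign (ε (x j)) = 0 := by
  have hflip : ∀ ε : ι → Bool, ∏ j, boolSign (Function.update ε i (!ε i) (x j)) =
      -∏ j, boolSign (ε (x j)) := by
    intro ε
    have h1 : ∀ j, boolSign (Function.update ε i (!ε i) (x j)) =
        (if x j = i then -1 else 1) * boolSign (ε (x j)) := by
      intro j
      by_cases hj : x j = i
      · simp [hj, boolSign_not]
      · simp [hj]
    simp_rw [h1, Finset.prod_mul_distrib, Finset.prod_ite, Finset.prod_const, one_pow, mul_one,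
      h.neg_one_pow, neg_one_mul]
  have hinv : Function.Involutive fun ε : ι → Bool => Function.update ε i (!ε i) := by
    intro ε
    ext j
    by_cases hj : j = i
    · subst hj; simp
    · simp [hj]
  have := (Equiv.sum_comp hinv.toPerm fun ε : ι → Bool => ∏ j, boolSign (ε (x j)))
  simp only [Function.Involutive.coe_toPerm, hflip, Finset.sum_neg_distrib] at this
  linarith

theorem prod_sign_eq_one {ι J : Type*} [DecidableEq ι] [Fintype J] (x : J → ι)
    (f : ι → ℝ) (hf : ∀ i, f i ^ 2 = 1)
    (h : ∀ i, ¬ Odd (Finset.univ.filter fun j => x j = i).card) : ∏ j, f (x j) = 1 := by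
  rw [Finset.prod_comp]
  refine Finset.prod_eq_one fun i _ => ?_
  obtain ⟨k, hk⟩ := even_iff_two_dvd.1 (Nat.not_odd_iff_even.1 (h i))
  rw [hk, pow_mul, hf, one_pow]

end Rademacher

/-! ### High moments of the sketch error under limited independence -/

section Moments

set_option linter.unusedSectionVars false

variable {Ω : Type*} [MeasurableSpace Ω] {μ : Measure Ω} [IsProbabilityMeasure μ]

/-- Random signs such that the expectation of the product of at most `N` of them vanishes unless
each of them occurs an even number of times. -/
structure IsWiseSigns {σ : Type} [DecidableEq σ] (μ : Measure Ω) (s : σ → Ω → ℝ) (N : ℕ) :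
    Prop where
  measurable : ∀ a, Measurable (s a)
  sq_eq_one : ∀ a ω, s a ω ^ 2 = 1
  integral_prod : ∀ (J : Type) [Fintype J] (x : J → σ) (a : σ), Fintype.card J ≤ N →
    Odd (Finset.univ.filter fun j => x j = a).card → ∫ ω, ∏ j, s (x j) ω ∂μ = 0

theorem integrable_of_abs_le {f : Ω → ℝ} (hf : Measurable f) (B : ℝ) (h : ∀ ω, |f ω| ≤ B) :
    Integrable f μ :=
  Integrable.of_bound hf.aestronglyMeasurable B (Eventually.of_forall h)

variable {κ ι : Type} [Fintype κ] [Fintype ι] [DecidableEq κ] [DecidableEq ι]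
  {s : κ × ι → Ω → ℝ} {N : ℕ}

theorem IsWiseSigns.abs_eq_one (hs : IsWiseSigns μ s N) (a : κ × ι) (ω : Ω) : |s a ω| = 1 := by
  have h := hs.sq_eq_one a ω
  rw [← sq_abs] at h
  nlinarith [abs_nonneg (s a ω)]

theorem IsWiseSigns.integrable_prod (hs : IsWiseSigns μ s N) {J : Type} [Fintype J]
    (x : J → κ × ι) : Integrable (fun ω => ∏ j, s (x j) ω) μ := by
  refine integrable_of_abs_le (Finset.measurable_fun_prod _ fun j _ => hs.measurable _) 1 fun ω => ?_
  rw [Finset.abs_prod]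
  simp [hs.abs_eq_one]

/-- In the expansion of the power each expectation of at most `N` signs is `0` or `1` according to
parities alone, exactly as for independent signs. The moment thus equals the Rademacher moment. -/
theorem IsWiseSigns.integral_pow_le (hs : IsWiseSigns μ s N) (l : κ) (v : ι → ℝ) {k : ℕ}
    (hk : 2 * k ≤ N) :
    ∫ ω, (∑ i, s (l, i) ω * v i) ^ (2 * k) ∂μ ≤
      4 * (2 * k).factorial * (∑ i, v i ^ 2) ^ k := by
  have hc : (0 : ℝ) < 2 ^ Fintype.card ι := by positivity
  have key : ∫ ω, (∑ i, s (l, i) ω * v i) ^ (2 * k) ∂μ =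
      (2 ^ Fintype.card ι)⁻¹ * ∑ ε : ι → Bool, (∑ i, boolSign (ε i) * v i) ^ (2 * k) := by
    simp_rw [Fintype.sum_pow, Finset.prod_mul_distrib]
    rw [integral_finsetSum _ fun x _ => (hs.integrable_prod fun j => (l, x j)).mul_const _,
      Finset.sum_comm, Finset.mul_sum]
    refine Finset.sum_congr rfl fun x _ => ?_
    rw [integral_mul_const, ← Finset.sum_mul, ← mul_assoc]
    congr 1
    by_cases h : ∃ i, Odd (Finset.univ.filter fun j => x j = i).card
    · obtain ⟨i, hi⟩ := h
      rw [sum_prod_boolSign_eq_zero x i hi, mul_zero]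
      refine hs.integral_prod (Fin (2 * k)) (fun j => (l, x j)) (l, i) (by simpa using hk) ?_
      simpa using hi
    · push Not at h
      have h' : ∀ i, ¬ Odd (Finset.univ.filter fun j => x j = i).card := by simpa using h
      have h1 : ∀ ω, ∏ j, s (l, x j) ω = 1 := fun ω =>
        prod_sign_eq_one x (fun i => s (l, i) ω) (fun i => hs.sq_eq_one _ _) h'
      have h2 : ∀ ε : ι → Bool, ∏ j, boolSign (ε (x j)) = 1 := fun ε =>
        prod_sign_eq_one x (fun i => boolSign (ε i)) (fun i => boolSign_sq _) h'
      simp [h1, h2]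
  rw [key, inv_mul_le_iff₀ hc]
  exact sum_boolSign_pow_le v k

/-- The error of the estimate of `∑ i, v i ^ 2` by the sketch row `l`. -/
def rowError (s : κ × ι → Ω → ℝ) (v : ι → ℝ) (l : κ) (ω : Ω) : ℝ :=
  (∑ i, s (l, i) ω * v i) ^ 2 - ∑ i, v i ^ 2

theorem IsWiseSigns.measurable_rowError (hs : IsWiseSigns μ s N) (v : ι → ℝ) (l : κ) :
    Measurable (rowError s v l) :=
  ((Finset.measurable_fun_sum _ fun i _ => (hs.measurable (l, i)).mul_const _).pow_const 2).sub_const _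

theorem IsWiseSigns.abs_rowError_le (hs : IsWiseSigns μ s N) (v : ι → ℝ) (l : κ) (ω : Ω) :
    |rowError s v l ω| ≤ (∑ i, |v i|) ^ 2 + ∑ i, v i ^ 2 := by
  have h1 : |∑ i, s (l, i) ω * v i| ≤ ∑ i, |v i| := by
    refine (Finset.abs_sum_le_sum_abs _ _).trans (Finset.sum_le_sum fun i _ => ?_)
    rw [abs_mul, hs.abs_eq_one, one_mul]
  have h2 : (∑ i, s (l, i) ω * v i) ^ 2 ≤ (∑ i, |v i|) ^ 2 := sq_le_sq' (by
    linarith [(abs_le.1 h1).1]) (abs_le.1 h1).2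
  have h3 : 0 ≤ ∑ i, v i ^ 2 := Finset.sum_nonneg fun i _ => sq_nonneg _
  rw [rowError, abs_le]
  constructor
  · nlinarith [sq_nonneg (∑ i, s (l, i) ω * v i), sq_nonneg (∑ i, |v i|)]
  · linarith

/-- The diagonal terms of the square add up to the true squared norm, so the error consists of
products of two distinct signs. -/
theorem IsWiseSigns.rowError_eq (hs : IsWiseSigns μ s N) (v : ι → ℝ) (l : κ) (ω : Ω) :
    rowError s v l ω = ∑ y : ι × ι, (if y.1 = y.2 then 0 else v y.1 * v y.2) *
      (s (l, y.1) ω * s (l, y.2) ω) := by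
  rw [rowError, sq, Finset.sum_mul_sum, Fintype.sum_prod_type, ← Finset.sum_sub_distrib]
  refine Finset.sum_congr rfl fun i _ => ?_
  have : v i ^ 2 = ∑ j, if i = j then s (l, i) ω * v i * (s (l, j) ω * v j) else 0 := by
    rw [Finset.sum_ite_eq]
    have := hs.sq_eq_one (l, i) ω
    simp only [Finset.mem_univ, if_true]
    linear_combination (-(v i) ^ 2) * this
  rw [this, ← Finset.sum_sub_distrib]
  refine Finset.sum_congr rfl fun j _ => ?_
  split_ifs <;> ring

/-- If the sketch row `l` occurs once, its factor contributes two distinct signs that occur nowhere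
else. Each has odd multiplicity, so every term of the expansion has expectation zero. -/
theorem IsWiseSigns.integral_prod_rowError_eq_zero (hs : IsWiseSigns μ s N) (v : ι → ℝ) {p : ℕ}
    (hp : 2 * p ≤ N) (x : Fin p → κ) (l : κ)
    (hl : (Finset.univ.filter fun j => x j = l).card = 1) :
    ∫ ω, ∏ j, rowError s v (x j) ω ∂μ = 0 := by
  obtain ⟨j₀, hj₀⟩ := Finset.card_eq_one.1 hl
  have hj : ∀ j, x j = l ↔ j = j₀ := fun j => by
    have : j ∈ (Finset.univ.filter fun j => x j = l) ↔ j ∈ ({j₀} : Finset (Fin p)) := by rw [hj₀]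
    simpa using this
  simp_rw [hs.rowError_eq]
  have hexp : ∀ ω, ∏ j, (∑ y : ι × ι, (if y.1 = y.2 then 0 else v y.1 * v y.2) *
      (s (x j, y.1) ω * s (x j, y.2) ω)) =
      ∑ y : Fin p → ι × ι, (∏ j, (if (y j).1 = (y j).2 then 0 else v (y j).1 * v (y j).2)) *
        ∏ t : Fin p ⊕ Fin p, s (Sum.elim (fun j => (x j, (y j).1)) (fun j => (x j, (y j).2)) t) ω := by
    intro ω
    rw [Finset.prod_univ_sum, Fintype.piFinset_univ]
    refine Finset.sum_congr rfl fun y _ => ?_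
    rw [Finset.prod_mul_distrib, Finset.prod_mul_distrib, Fintype.prod_sum_type]
    rfl
  simp_rw [hexp]
  rw [integral_finsetSum _ fun y _ => (hs.integrable_prod _).const_mul _]
  refine Finset.sum_eq_zero fun y _ => ?_
  rw [integral_const_mul]
  by_cases hy : (y j₀).1 = (y j₀).2
  · rw [Finset.prod_eq_zero (Finset.mem_univ j₀) (by simp [hy]), zero_mul]
  · rw [hs.integral_prod (Fin p ⊕ Fin p) _ (l, (y j₀).1), mul_zero]
    · simp; omega
    · have : (Finset.univ.filter fun t : Fin p ⊕ Fin p =>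
          Sum.elim (fun j => (x j, (y j).1)) (fun j => (x j, (y j).2)) t = (l, (y j₀).1)) =
          {Sum.inl j₀} := by
        ext t
        rcases t with j | j
        · simp only [Finset.mem_filter, Finset.mem_univ, true_and, Sum.elim_inl, Prod.mk.injEq, hj,
            Finset.mem_singleton, Sum.inl.injEq]
          exact ⟨fun h => h.1, fun h => ⟨h, by rw [h]⟩⟩
        · simp only [Finset.mem_filter, Finset.mem_univ, true_and, Sum.elim_inr, Prod.mk.injEq, hj,
            Finset.mem_singleton, reduceCtorEq, iff_false, not_and]
          rintro rfl h
          exact hy h.symm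
      rw [this]
      simp

/-- The error is a difference of two nonnegative numbers, hence its even power is at most the sum of
their powers. -/
theorem IsWiseSigns.integral_rowError_pow_le (hs : IsWiseSigns μ s N) (v : ι → ℝ) (l : κ) {q : ℕ}
    (hq : 4 * q ≤ N) :
    ∫ ω, rowError s v l ω ^ (2 * q) ∂μ ≤
      (1 + 4 * (4 * q).factorial) * (∑ i, v i ^ 2) ^ (2 * q) := by
  set V := ∑ i, v i ^ 2 with hV
  have hV0 : 0 ≤ V := Finset.sum_nonneg fun i _ => sq_nonneg _
  have h1 := hs.integral_pow_le l v (k := 2 * q) (by omega)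
  have hpt : ∀ ω, rowError s v l ω ^ (2 * q) ≤ (∑ i, s (l, i) ω * v i) ^ (2 * (2 * q)) +
      V ^ (2 * q) := by
    intro ω
    set a := (∑ i, s (l, i) ω * v i) ^ 2 with ha
    have ha0 : 0 ≤ a := sq_nonneg _
    rw [pow_mul (∑ i, s (l, i) ω * v i), ← ha]
    show (a - V) ^ (2 * q) ≤ _
    have e : (a - V) ^ (2 * q) = |a - V| ^ (2 * q) := by
      rw [pow_mul, pow_mul, sq_abs]
    rw [e]
    rcases le_total a V with h | h
    · have : |a - V| ≤ V := by rw [abs_le]; constructor <;> linarith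
      have := pow_le_pow_left₀ (abs_nonneg _) this (2 * q)
      linarith [pow_nonneg ha0 (2 * q)]
    · have : |a - V| ≤ a := by rw [abs_le]; constructor <;> linarith
      have := pow_le_pow_left₀ (abs_nonneg _) this (2 * q)
      linarith [pow_nonneg hV0 (2 * q)]
  have hint : Integrable (fun ω => (∑ i, s (l, i) ω * v i) ^ (2 * (2 * q))) μ := by
    simp_rw [Fintype.sum_pow, Finset.prod_mul_distrib]
    exact integrable_finsetSum _ fun x _ => (hs.integrable_prod fun j => (l, x j)).mul_const _
  calc ∫ ω, rowError s v l ω ^ (2 * q) ∂μ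
      ≤ ∫ ω, ((∑ i, s (l, i) ω * v i) ^ (2 * (2 * q)) + V ^ (2 * q)) ∂μ := by
        refine integral_mono_of_nonneg (Eventually.of_forall fun ω => ?_)
          (hint.add (integrable_const _)) (Eventually.of_forall hpt)
        exact (even_two_mul q).pow_nonneg _
    _ ≤ _ := by
        rw [integral_add hint (integrable_const _)]
        simp only [integral_const, probReal_univ, one_smul]
        have : 2 * (2 * q) = 4 * q := by ring
        rw [this] at h1
        rw [this]
        linarith

/-- A tuple of length `2 * q` that takes each of its values at least twice has at most `q` values,
so it factors through `Fin q`. -/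
theorem card_tuples_le {q : ℕ} (hq : 0 < q) :
    (Finset.univ.filter fun x : Fin (2 * q) → κ =>
      ∀ l, (Finset.univ.filter fun j => x j = l).card ≠ 1).card ≤
      Fintype.card κ ^ q * q ^ (2 * q) := by
  have h : (Finset.univ.filter fun x : Fin (2 * q) → κ =>
      ∀ l, (Finset.univ.filter fun j => x j = l).card ≠ 1) ⊆
      Finset.univ.image fun p : (Fin q → κ) × (Fin (2 * q) → Fin q) => p.1 ∘ p.2 := by
    intro x hx
    simp only [Finset.mem_filter, Finset.mem_univ, true_and] at hx
    simp only [Finset.mem_image, Finset.mem_univ, true_and, Prod.exists]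
    set S := Finset.univ.image x with hS
    have hcard : S.card ≤ q := by
      have h1 : 2 * S.card ≤ (Finset.univ : Finset (Fin (2 * q))).card := by
        refine Finset.mul_card_image_le_card _ 2 fun l hl => ?_
        obtain ⟨j, -, hj⟩ := Finset.mem_image.1 hl
        have h2 := hx l
        have h3 : 0 < (Finset.univ.filter fun j => x j = l).card :=
          Finset.card_pos.2 ⟨j, by simpa using hj⟩
        omega
      simp at h1
      omega
    have : Nonempty S := ⟨⟨x ⟨0, by omega⟩, by simp [hS]⟩⟩
    obtain ⟨f⟩ : Nonempty (S ↪ Fin q) :=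
      Function.Embedding.nonempty_of_card_le (by simpa using hcard)
    refine ⟨fun t => (Function.invFun (⇑f) t).1, fun j => f ⟨x j, by simp [hS]⟩, ?_⟩
    funext j
    simp [Function.leftInverse_invFun f.injective _]
  refine (Finset.card_le_card h).trans (Finset.card_image_le.trans ?_)
  simp

/-- Only tuples of sketch rows without a row that occurs exactly once survive in the expansion.
Their number is of order `m ^ q` instead of `m ^ (2 * q)` for `m` sketch rows; this is where
averaging over the rows pays off. -/
theorem IsWiseSigns.integral_sum_rowError_pow_le (hs : IsWiseSigns μ s N) (v : ι → ℝ) {q : ℕ}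
    (hq0 : 0 < q) (hq : 4 * q ≤ N) :
    ∫ ω, (∑ l, rowError s v l ω) ^ (2 * q) ∂μ ≤
      (Fintype.card κ : ℝ) ^ q * (q : ℝ) ^ (2 * q) * ((2 * q : ℕ) *
        ((1 + 4 * (4 * q).factorial) * (∑ i, v i ^ 2) ^ (2 * q))) := by
  set M := (1 + 4 * ((4 * q).factorial : ℝ)) * (∑ i, v i ^ 2) ^ (2 * q) with hM
  have hM0 : 0 ≤ M := by
    have : 0 ≤ ∑ i, v i ^ 2 := Finset.sum_nonneg fun i _ => sq_nonneg _
    positivity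
  set B := (∑ i, |v i|) ^ 2 + ∑ i, v i ^ 2 with hB
  have hint : ∀ x : Fin (2 * q) → κ, Integrable (fun ω => ∏ j, rowError s v (x j) ω) μ := by
    intro x
    refine integrable_of_abs_le (Finset.measurable_fun_prod _ fun j _ => hs.measurable_rowError v _)
      (B ^ (2 * q)) fun ω => ?_
    rw [Finset.abs_prod]
    refine (Finset.prod_le_prod (fun j _ => abs_nonneg _)
      fun j _ => hs.abs_rowError_le v (x j) ω).trans ?_
    simp [hB]
  have hintp : ∀ l, Integrable (fun ω => rowError s v l ω ^ (2 * q)) μ := by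
    intro l
    refine integrable_of_abs_le ((hs.measurable_rowError v l).pow_const _) (B ^ (2 * q)) fun ω => ?_
    rw [abs_pow]
    exact pow_le_pow_left₀ (abs_nonneg _) (hs.abs_rowError_le v l ω) _
  have hbound : ∀ x : Fin (2 * q) → κ, ∫ ω, ∏ j, rowError s v (x j) ω ∂μ ≤ (2 * q : ℕ) * M := by
    intro x
    have hpt : ∀ ω, ∏ j, rowError s v (x j) ω ≤ ∑ j, rowError s v (x j) ω ^ (2 * q) := by
      intro ω
      have hne : (Finset.univ : Finset (Fin (2 * q))).Nonempty := ⟨⟨0, by omega⟩, by simp⟩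
      obtain ⟨j₁, -, hj₁⟩ := Finset.exists_max_image Finset.univ
        (fun j => |rowError s v (x j) ω|) hne
      have hnn : ∀ j, 0 ≤ rowError s v (x j) ω ^ (2 * q) := fun j => (even_two_mul q).pow_nonneg _
      calc ∏ j, rowError s v (x j) ω ≤ |∏ j, rowError s v (x j) ω| := le_abs_self _
        _ = ∏ j, |rowError s v (x j) ω| := Finset.abs_prod _ _
        _ ≤ ∏ _j : Fin (2 * q), |rowError s v (x j₁) ω| :=
            Finset.prod_le_prod (fun j _ => abs_nonneg _) hj₁
        _ = rowError s v (x j₁) ω ^ (2 * q) := by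
            simp only [Finset.prod_const, Finset.card_univ, Fintype.card_fin]
            rw [pow_mul, sq_abs, ← pow_mul]
        _ ≤ ∑ j, rowError s v (x j) ω ^ (2 * q) :=
            Finset.single_le_sum (f := fun j => rowError s v (x j) ω ^ (2 * q))
              (fun j _ => hnn j) (Finset.mem_univ j₁)
    calc ∫ ω, ∏ j, rowError s v (x j) ω ∂μ
        ≤ ∫ ω, ∑ j, rowError s v (x j) ω ^ (2 * q) ∂μ :=
          integral_mono (hint x) (integrable_finsetSum _ fun j _ => hintp _) hpt
      _ = ∑ j, ∫ ω, rowError s v (x j) ω ^ (2 * q) ∂μ :=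
          integral_finsetSum _ fun j _ => hintp _
      _ ≤ ∑ _j : Fin (2 * q), M := Finset.sum_le_sum fun j _ =>
          hs.integral_rowError_pow_le v (x j) hq
      _ = (2 * q : ℕ) * M := by simp
  simp_rw [Fintype.sum_pow]
  rw [integral_finsetSum _ fun x _ => hint x]
  calc ∑ x : Fin (2 * q) → κ, ∫ ω, ∏ j, rowError s v (x j) ω ∂μ
      ≤ ∑ x ∈ (Finset.univ.filter fun x : Fin (2 * q) → κ =>
          ∀ l, (Finset.univ.filter fun j => x j = l).card ≠ 1), (2 * q : ℕ) * M := by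
        rw [Finset.sum_filter]
        refine Finset.sum_le_sum fun x _ => ?_
        split_ifs with h
        · exact hbound x
        · push Not at h
          obtain ⟨l, hl⟩ := h
          rw [hs.integral_prod_rowError_eq_zero v (by omega) x l hl]
    _ ≤ _ := by
        rw [Finset.sum_const, nsmul_eq_mul]
        have h := card_tuples_le (κ := κ) hq0
        have h' : ((Finset.univ.filter fun x : Fin (2 * q) → κ =>
          ∀ l, (Finset.univ.filter fun j => x j = l).card ≠ 1).card : ℝ) ≤
            (Fintype.card κ : ℝ) ^ q * (q : ℝ) ^ (2 * q) := by exact_mod_cast h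
        gcongr

/-- The base is `10 * 4 ^ 4 = 2560`, from `10 * q ≤ 10 ^ q` and `(4 * q)! ≤ (4 * q) ^ (4 * q)`. The
threshold `40960` used below is `16 * 2560`. -/
theorem moment_constant_le {q : ℕ} (hq0 : 0 < q) :
    (q : ℝ) ^ (2 * q) * (q : ℝ) ^ (2 * q) * ((2 * q : ℕ) * (1 + 4 * (4 * q).factorial)) ≤
      (2560 * (q : ℝ) ^ 8) ^ q := by
  have hf : ((4 * q).factorial : ℝ) ≤ (4 * q : ℝ) ^ (4 * q) := by
    exact_mod_cast Nat.factorial_le_pow (4 * q)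
  have hf1 : (1 : ℝ) ≤ (4 * q).factorial := by
    exact_mod_cast Nat.one_le_iff_ne_zero.2 (Nat.factorial_ne_zero _)
  have h10 : (10 * q : ℝ) ≤ 10 ^ q := by
    have : 10 * q ≤ 10 ^ q := by
      clear hf hf1
      induction q, hq0 using Nat.le_induction with
      | base => norm_num
      | succ n hn ih => rw [pow_succ]; omega
    exact_mod_cast this
  have h1 : ((2 * q : ℕ) : ℝ) * (1 + 4 * (4 * q).factorial) ≤ 10 ^ q * (4 * q : ℝ) ^ (4 * q) := by
    calc ((2 * q : ℕ) : ℝ) * (1 + 4 * (4 * q).factorial)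
        ≤ (2 * q : ℕ) * (5 * (4 * q).factorial) := by gcongr; linarith
      _ = (10 * q) * (4 * q).factorial := by push_cast; ring
      _ ≤ _ := by gcongr
  calc (q : ℝ) ^ (2 * q) * (q : ℝ) ^ (2 * q) * ((2 * q : ℕ) * (1 + 4 * (4 * q).factorial))
      ≤ (q : ℝ) ^ (2 * q) * (q : ℝ) ^ (2 * q) * (10 ^ q * (4 * q : ℝ) ^ (4 * q)) := by gcongr
    _ = (2560 * (q : ℝ) ^ 8) ^ q := by
        rw [pow_mul, pow_mul (4 * q : ℝ), ← mul_pow, ← mul_pow, ← mul_pow]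
        ring

/-- With probability at least `1 - 16 ^ (-q)` the mean of the squared sketch rows estimates the
squared norm of a fixed vector with relative accuracy `1 / q`. -/
theorem IsWiseSigns.measureReal_error_le (hs : IsWiseSigns μ s N) (v : ι → ℝ) {q : ℕ}
    (hq0 : 0 < q) (hq : 4 * q ≤ N) (hm : 40960 * q ^ 8 ≤ Fintype.card κ) :
    μ.real {ω | (∑ i, v i ^ 2) / q < |(∑ l, rowError s v l ω) / Fintype.card κ|} ≤
      (1 / 16) ^ q := by
  set V := ∑ i, v i ^ 2 with hV
  have hV0 : 0 ≤ V := Finset.sum_nonneg fun i _ => sq_nonneg _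
  have hqR : (0 : ℝ) < q := by exact_mod_cast hq0
  have hmR : (40960 : ℝ) * (q : ℝ) ^ 8 ≤ Fintype.card κ := by exact_mod_cast hm
  have hm0 : (0 : ℝ) < Fintype.card κ := lt_of_lt_of_le (by positivity) hmR
  rcases hV0.eq_or_lt with h0 | hpos
  · have hv : ∀ i, v i = 0 := by
      intro i
      have := (Finset.sum_eq_zero_iff_of_nonneg (fun i _ => sq_nonneg (v i))).1 h0.symm i
        (Finset.mem_univ i)
      simpa using this
    have : {ω | V / q < |(∑ l, rowError s v l ω) / Fintype.card κ|} = ∅ := by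
      simp [rowError, hv, ← h0]
    rw [this]
    simp
  · set m : ℝ := (Fintype.card κ : ℝ) with hm'
    have hint : Integrable (fun ω => (∑ l, rowError s v l ω) ^ (2 * q)) μ := by
      refine integrable_of_abs_le ((Finset.measurable_fun_sum _ fun l _ =>
        hs.measurable_rowError v l).pow_const _)
        ((∑ _l : κ, ((∑ i, |v i|) ^ 2 + ∑ i, v i ^ 2)) ^ (2 * q)) fun ω => ?_
      rw [abs_pow]
      exact pow_le_pow_left₀ (abs_nonneg _) ((Finset.abs_sum_le_sum_abs _ _).trans
        (Finset.sum_le_sum fun l _ => hs.abs_rowError_le v l ω)) _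
    -- Markov's inequality for the power `2 * q` of the total error, at the threshold that
    -- corresponds to relative accuracy `1 / q`.
    have hmarkov := mul_meas_ge_le_integral_of_nonneg (μ := μ)
      (Eventually.of_forall fun ω => (even_two_mul q).pow_nonneg (∑ l, rowError s v l ω)) hint
      ((V * m / q) ^ (2 * q))
    have hsub : {ω | V / q < |(∑ l, rowError s v l ω) / m|} ⊆
        {ω | (V * m / q) ^ (2 * q) ≤ (∑ l, rowError s v l ω) ^ (2 * q)} := by
      intro ω hω
      simp only [Set.mem_ofPred_eq] at hω ⊢
      rw [abs_div, abs_of_pos hm0, lt_div_iff₀ hm0] at hω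
      have h1 : V * m / q ≤ |∑ l, rowError s v l ω| := by
        rw [mul_div_right_comm]; exact hω.le
      have h2 := pow_le_pow_left₀ (by positivity) h1 (2 * q)
      rwa [pow_mul |∑ l, rowError s v l ω|, sq_abs, ← pow_mul] at h2
    have h1 := hs.integral_sum_rowError_pow_le v hq0 hq
    rw [← hV, ← hm'] at h1
    have h2 : (V * m / q) ^ (2 * q) *
        μ.real {ω | V / q < |(∑ l, rowError s v l ω) / m|} ≤
        m ^ q * (q : ℝ) ^ (2 * q) * ((2 * q : ℕ) *
          ((1 + 4 * (4 * q).factorial) * V ^ (2 * q))) := by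
      refine le_trans ?_ (hmarkov.trans h1)
      exact mul_le_mul_of_nonneg_left (measureReal_mono hsub) (by positivity)
    have h3 := moment_constant_le hq0
    have h4 : (2560 * (q : ℝ) ^ 8) ^ q ≤ (m / 16) ^ q :=
      pow_le_pow_left₀ (by positivity) (by linarith) _
    set P := μ.real {ω | V / q < |(∑ l, rowError s v l ω) / m|} with hP
    have hc : 0 < (V * m / q) ^ (2 * q) := by positivity
    rw [← mul_le_mul_iff_right₀ hc]
    refine h2.trans ?_
    have h5 : (V * m / q) ^ (2 * q) * (1 / 16) ^ q =
        m ^ q * V ^ (2 * q) / (q : ℝ) ^ (2 * q) * (m / 16) ^ q := by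
      rw [div_pow, mul_pow, pow_mul m, sq, mul_pow, div_pow, div_pow, one_pow]
      field_simp
    rw [h5]
    have h6 : m ^ q * (q : ℝ) ^ (2 * q) * ((2 * q : ℕ) *
          ((1 + 4 * (4 * q).factorial) * V ^ (2 * q))) =
        m ^ q * V ^ (2 * q) / (q : ℝ) ^ (2 * q) * ((q : ℝ) ^ (2 * q) * (q : ℝ) ^ (2 * q) *
          ((2 * q : ℕ) * (1 + 4 * (4 * q).factorial))) := by
      field_simp
    rw [h6]
    exact mul_le_mul_of_nonneg_left (h3.trans h4) (by positivity)

end Moments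

/-! ### Hash signs from residues and their limited independence -/

instance : IsProbabilityMeasure coinMeasure := by
  unfold coinMeasure
  infer_instance

/-- The outcome of the coins in which coin `a` has been turned over. -/
def flipCoin (a : ℕ × ℕ) (ω : Coins) : Coins := fun b => if b = a then !(ω b) else ω b

theorem measurePreserving_flipCoin (a : ℕ × ℕ) :
    MeasurePreserving (flipCoin a) coinMeasure coinMeasure := by
  have hm : ∀ b : ℕ × ℕ, Measurable fun x : Bool => if b = a then !x else x := fun b =>
    measurable_of_finite _
  have hn : Measure.map not (PMF.uniformOfFintype Bool).toMeasure =
      (PMF.uniformOfFintype Bool).toMeasure := by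
    refine Measure.ext_of_singleton fun x => ?_
    rw [Measure.map_apply (measurable_of_finite _) (measurableSet_singleton x)]
    have : not ⁻¹' {x} = {!x} := by
      ext y
      cases x <;> cases y <;> simp
    rw [this, PMF.toMeasure_apply_singleton _ _ (measurableSet_singleton _),
      PMF.toMeasure_apply_singleton _ _ (measurableSet_singleton _)]
    simp
  refine ⟨measurable_pi_lambda _ fun b => (hm b).comp (measurable_pi_apply b), ?_⟩
  have h := Measure.infinitePi_map_pi (μ := fun _ : ℕ × ℕ => (PMF.uniformOfFintype Bool).toMeasure)
    (f := fun b x => if b = a then !x else x) hm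
  unfold coinMeasure
  refine h.trans ?_
  congr 1
  funext b
  by_cases hb : b = a
  · simp only [hb, if_true]
    exact hn
  · simp only [hb, if_false]
    exact Measure.map_id

/-- Numbers that are divisible by all of `1, …, 2 n` are large. -/
theorem exists_not_dvd {n D : ℕ} (hn : 4 ≤ n) (hD : 0 < D) (h : 2 * n * D < 4 ^ n) :
    ∃ k < 2 * n, ¬ (k + 1) ∣ D := by
  by_contra! hall
  -- Every prime power dividing the central binomial coefficient is at most `2 * n`, so it is among
  -- the assumed divisors of `D`. This contradicts `4 ^ n < n * n.centralBinom`.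
  have hdvd : n.centralBinom ∣ D := by
    refine (Nat.dvd_iff_prime_pow_dvd_dvd D n.centralBinom).2 fun p k hp hpk => ?_
    rcases Nat.eq_zero_or_pos k with rfl | hk
    · simp
    · have hle : p ^ k ≤ 2 * n := by
        have h1 : k ≤ n.centralBinom.factorization p :=
          (hp.pow_dvd_iff_le_factorization (Nat.centralBinom_ne_zero n)).1 hpk
        exact (Nat.pow_le_pow_right hp.pos h1).trans
          (Nat.pow_factorization_choose_le (by omega))
      have h2 : 0 < p ^ k := pow_pos hp.pos k
      have := hall (p ^ k - 1) (by omega)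
      rwa [Nat.sub_add_cancel h2] at this
  have h1 := Nat.le_of_dvd hD hdvd
  have h2 := Nat.four_pow_lt_mul_centralBinom n hn
  have h3 : n * n.centralBinom ≤ 2 * n * D := by
    rw [mul_assoc, mul_comm 2, mul_assoc]
    exact Nat.mul_le_mul_left n (by omega)
  omega

theorem hashSign_eq (β : ℕ → Bool) (Q l i : ℕ) :
    hashSign β Q l i =
      ∏ k ∈ Finset.range Q, (-1 : ℤ) ^ (β (bitIndex l (k + 1) (i % (k + 1)))).toNat := by
  rw [Finset.prod_pow_eq_pow_sum]
  show hashSign β Q l i = (-1) ^ hashCount β Q l i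
  unfold hashSign
  split_ifs with h
  · rw [Even.neg_one_pow (Nat.even_iff.2 h)]
  · rw [Odd.neg_one_pow (Nat.odd_iff.2 (by omega))]

theorem bitIndex_inj {l k a l' k' a' : ℕ} :
    bitIndex l k a = bitIndex l' k' a' ↔ l = l' ∧ k = k' ∧ a = a' := by
  simp [bitIndex, Nat.pair_eq_pair]

/-- Changing one random bit changes the signs of those rows that it belongs to. -/
theorem hashSign_update (β : ℕ → Bool) {Q l₀ k₀ a₀ : ℕ} (hk : k₀ < Q) (l i : ℕ) :
    hashSign (Function.update β (bitIndex l₀ (k₀ + 1) a₀) (!β (bitIndex l₀ (k₀ + 1) a₀))) Q l i =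
      (if l = l₀ ∧ i % (k₀ + 1) = a₀ then -1 else 1) * hashSign β Q l i := by
  rw [hashSign_eq, hashSign_eq]
  have h1 : ∀ k ∈ Finset.range Q,
      (-1 : ℤ) ^ (Function.update β (bitIndex l₀ (k₀ + 1) a₀) (!β (bitIndex l₀ (k₀ + 1) a₀))
        (bitIndex l (k + 1) (i % (k + 1)))).toNat =
      (if k = k₀ then (if l = l₀ ∧ i % (k₀ + 1) = a₀ then -1 else 1) else 1) *
        (-1 : ℤ) ^ (β (bitIndex l (k + 1) (i % (k + 1)))).toNat := by
    intro k _
    by_cases hkk : k = k₀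
    · subst hkk
      by_cases hc : l = l₀ ∧ i % (k + 1) = a₀
      · obtain ⟨rfl, rfl⟩ := hc
        simp only [Function.update_self, and_self, if_true]
        cases β (bitIndex l (k + 1) (i % (k + 1))) <;> simp
      · have : bitIndex l (k + 1) (i % (k + 1)) ≠ bitIndex l₀ (k + 1) a₀ := by
          rw [Ne, bitIndex_inj]
          tauto
        simp [this, hc]
    · have : bitIndex l (k + 1) (i % (k + 1)) ≠ bitIndex l₀ (k₀ + 1) a₀ := by
        rw [Ne, bitIndex_inj]
        omega
      simp [this, hkk]
  rw [Finset.prod_congr rfl h1, Finset.prod_mul_distrib, Finset.prod_ite_eq']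
  simp [hk]

/-- The random bits, if bit `b` is taken from the coins of time `t b`. -/
def seedBits (t : ℕ → ℕ) (ω : Coins) (b : ℕ) : Bool := ω (t b, b)

theorem seedBits_flipCoin (t : ℕ → ℕ) (ω : Coins) (b : ℕ) :
    seedBits t (flipCoin (t b, b) ω) = Function.update (seedBits t ω) b (!seedBits t ω b) := by
  funext b'
  by_cases h : b' = b
  · subst h
    simp [seedBits, flipCoin]
  · simp [seedBits, flipCoin, h]

theorem measurable_hashSign (t : ℕ → ℕ) (Q l i : ℕ) :
    Measurable fun ω : Coins => (hashSign (seedBits t ω) Q l i : ℝ) := by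
  have h : ∀ ω, (hashSign (seedBits t ω) Q l i : ℝ) =
      ∏ k ∈ Finset.range Q, (-1 : ℝ) ^
        (ω (t (bitIndex l (k + 1) (i % (k + 1))), bitIndex l (k + 1) (i % (k + 1)))).toNat := by
    intro ω
    rw [hashSign_eq]
    push_cast
    rfl
  simp_rw [h]
  refine Finset.measurable_fun_prod _ fun k _ => ?_
  exact (measurable_of_finite fun b : Bool => (-1 : ℝ) ^ b.toNat).comp (measurable_pi_apply _)

/-- The rows with `r` binary digits. -/
def block (r : ℕ) : Finset ℕ := (Finset.range (2 ^ r)).filter fun i => i.size = r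

theorem mem_block {r i : ℕ} : i ∈ block r ↔ i.size = r := by
  simp only [block, Finset.mem_filter, Finset.mem_range, and_iff_right_iff_imp]
  intro h
  exact Nat.size_le.1 h.le

theorem card_block_le (r : ℕ) : (block r).card ≤ 2 ^ r := by
  exact (Finset.card_filter_le _ _).trans (Finset.card_range _).le

/-- The random signs of the sketch of block `r`. -/
noncomputable def blockSign (C r : ℕ) (t : ℕ → ℕ) (a : Fin (sketchRows C r) × block r)
    (ω : Coins) : ℝ :=
  hashSign (seedBits t ω) (modBound C r) a.1 a.2

/-- Choose a modulus that does not divide the product `D` of the distances from `i₀` to the other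
row indices. The random bit of row `l₀` for this modulus and the residue of `i₀` then affects the
sign at `(l₀, i₀)` and no other sign in the product. Turning this coin over preserves the measure
and negates a product in which that sign has odd multiplicity. -/
theorem isWiseSigns_blockSign (C r : ℕ) (t : ℕ → ℕ) :
    IsWiseSigns coinMeasure (blockSign C r t) (4 * (r + C)) := by
  refine ⟨fun a => measurable_hashSign _ _ _ _, fun a ω => ?_, ?_⟩
  · unfold blockSign hashSign
    split_ifs <;> norm_num
  · intro J _ x a hJ hodd
    obtain ⟨l₀, i₀⟩ := a
    set q := r + C with hq
    set D := ∏ j : J, if (x j).2 = i₀ then 1 else Nat.dist (x j).2 i₀ with hD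
    have hD0 : 0 < D := by
      refine Finset.prod_pos fun j _ => ?_
      split_ifs with h
      · exact one_pos
      · exact Nat.dist_pos_of_ne fun h' => h (Subtype.ext h')
    have hDle : D ≤ 2 ^ (4 * q ^ 2) := by
      have hi : ∀ i : block r, (i : ℕ) < 2 ^ r := fun i =>
        Finset.mem_range.1 (Finset.mem_filter.1 i.2).1
      have h1 : D ≤ ∏ _j : J, 2 ^ r := by
        refine Finset.prod_le_prod' fun j _ => ?_
        split_ifs with h
        · exact Nat.one_le_two_pow
        · have := hi (x j).2
          have := hi i₀
          unfold Nat.dist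
          omega
      refine h1.trans ?_
      rw [Finset.prod_const, ← pow_mul, Finset.card_univ]
      refine Nat.pow_le_pow_right two_pos ?_
      calc r * Fintype.card J ≤ q * (4 * q) := Nat.mul_le_mul (by omega) hJ
        _ = 4 * q ^ 2 := by ring
    -- With `n = 4 * q ^ 2 + 4`, `D ≤ 2 ^ n` and `2 * n < 2 ^ n`. The value `2 * n` is `modBound C
    -- r`.
    obtain ⟨k₀, hk₀, hk₀D⟩ : ∃ k < 2 * (4 * q ^ 2 + 4), ¬ (k + 1) ∣ D := by
      refine exists_not_dvd (by omega) hD0 ?_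
      set n := 4 * q ^ 2 + 4 with hn
      have h1 : 2 * n < 2 ^ n := by
        have : ∀ n, 4 ≤ n → 2 * n < 2 ^ n := by
          intro n hn
          induction n, hn using Nat.le_induction with
          | base => norm_num
          | succ m hm ih => rw [pow_succ]; omega
        exact this n (by omega)
      calc 2 * n * D ≤ 2 * n * 2 ^ n := by
            refine Nat.mul_le_mul_left _ (hDle.trans (Nat.pow_le_pow_right two_pos (by omega)))
        _ < 2 ^ n * 2 ^ n := Nat.mul_lt_mul_of_pos_right h1 (by positivity)
        _ = 4 ^ n := by rw [← mul_pow]; norm_num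
    have hQ : k₀ < modBound C r := by
      unfold modBound
      rw [← hq]
      omega
    have hres : ∀ j, ((x j).1 : ℕ) = l₀ ∧ ((x j).2 : ℕ) % (k₀ + 1) = (i₀ : ℕ) % (k₀ + 1) ↔
        x j = (l₀, i₀) := by
      intro j
      constructor
      · rintro ⟨h1, h2⟩
        refine Prod.ext (Fin.ext h1) ?_
        by_contra hne
        refine hk₀D (Dvd.dvd.trans ?_ (Finset.dvd_prod_of_mem _ (Finset.mem_univ j)))
        simp only at hne
        rw [if_neg hne]
        unfold Nat.dist
        rcases le_total ((x j).2 : ℕ) (i₀ : ℕ) with h | h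
        · rw [Nat.sub_eq_zero_of_le h, zero_add]
          exact (Nat.modEq_iff_dvd' h).1 h2
        · rw [Nat.sub_eq_zero_of_le h, add_zero]
          exact (Nat.modEq_iff_dvd' h).1 h2.symm
      · intro h
        rw [h]
        exact ⟨rfl, rfl⟩
    set b := bitIndex l₀ (k₀ + 1) (i₀ % (k₀ + 1)) with hb
    have hflip : ∀ ω, ∏ j, blockSign C r t (x j) (flipCoin (t b, b) ω) =
        -∏ j, blockSign C r t (x j) ω := by
      intro ω
      have h1 : ∀ j, blockSign C r t (x j) (flipCoin (t b, b) ω) =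
          (if x j = (l₀, i₀) then -1 else 1) * blockSign C r t (x j) ω := by
        intro j
        unfold blockSign
        rw [seedBits_flipCoin, hb, hashSign_update _ hQ]
        push_cast
        simp only [hres]
      simp_rw [h1, Finset.prod_mul_distrib, Finset.prod_ite, Finset.prod_const, one_pow, mul_one,
        hodd.neg_one_pow, neg_one_mul]
    have hmeas : Measurable fun ω => ∏ j, blockSign C r t (x j) ω :=
      Finset.measurable_fun_prod _ fun j _ => measurable_hashSign _ _ _ _
    have hmp := measurePreserving_flipCoin (t b, b)
    have h2 : ∫ ω, ∏ j, blockSign C r t (x j) ω ∂coinMeasure =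
        ∫ ω, ∏ j, blockSign C r t (x j) (flipCoin (t b, b) ω) ∂coinMeasure := by
      conv_lhs => rw [← hmp.map_eq]
      exact integral_map hmp.measurable.aemeasurable hmeas.aestronglyMeasurable
    simp_rw [hflip, integral_neg] at h2
    linarith

/-! ### From single vectors to subspaces -/

section Spectral

set_option linter.unusedSectionVars false

/-- A quadratic form that is small at the sums of two vectors of an orthonormal family is small
on its span. -/
theorem abs_bilin_le_of_orthonormal {E : Type*} [NormedAddCommGroup E] [InnerProductSpace ℝ E]
    (B : E →ₗ[ℝ] E →ₗ[ℝ] ℝ) (hB : ∀ x y, B x y = B y x) {D : ℕ} (u : Fin D → E)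
    (hu : Orthonormal ℝ u) {η : ℝ}
    (h : ∀ i j, |B (u i + u j) (u i + u j)| ≤ η * ‖u i + u j‖ ^ 2) (c : Fin D → ℝ) :
    |B (∑ i, c i • u i) (∑ i, c i • u i)| ≤ 3 * D * η * ∑ i, c i ^ 2 := by
  rcases Nat.eq_zero_or_pos D with rfl | hD
  · simp
  have hη : 0 ≤ η := by
    have h1 := h ⟨0, hD⟩ ⟨0, hD⟩
    have h2 : 0 < ‖u ⟨0, hD⟩ + u ⟨0, hD⟩‖ ^ 2 := by
      rw [← two_smul ℝ, norm_smul, hu.1]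
      norm_num
    by_contra! h3
    nlinarith [abs_nonneg (B (u ⟨0, hD⟩ + u ⟨0, hD⟩) (u ⟨0, hD⟩ + u ⟨0, hD⟩))]
  have hdiag : ∀ i, |B (u i) (u i)| ≤ η := by
    intro i
    have h1 := h i i
    rw [← two_smul ℝ, norm_smul, hu.1] at h1
    simp only [map_smul, LinearMap.smul_apply, smul_eq_mul, abs_mul, Real.norm_eq_abs, abs_two] at h1
    linarith
  -- Polarization: `2 * B (u i) (u j)` is at most `4 * η + η + η` in absolute value.
  have hoff : ∀ i j, |B (u i) (u j)| ≤ 3 * η := by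
    intro i j
    have h1 := h i j
    have hn : ‖u i + u j‖ ≤ 2 := (norm_add_le _ _).trans (by rw [hu.1, hu.1]; norm_num)
    have hn2 : ‖u i + u j‖ ^ 2 ≤ 4 := by nlinarith [norm_nonneg (u i + u j)]
    have h2 : |B (u i + u j) (u i + u j)| ≤ η * 4 := h1.trans (by gcongr)
    simp only [map_add, LinearMap.add_apply, hB (u j) (u i)] at h2
    have h3 := hdiag i
    have h4 := hdiag j
    rw [abs_le] at h2 h3 h4 ⊢
    constructor <;> linarith [h2.1, h2.2, h3.1, h3.2, h4.1, h4.2]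
  simp only [map_sum, LinearMap.sum_apply, map_smul, LinearMap.smul_apply, smul_eq_mul]
  calc |∑ i, c i * ∑ j, c j * B (u j) (u i)|
      ≤ ∑ i, ∑ j, |c i| * |c j| * (3 * η) := by
        refine (Finset.abs_sum_le_sum_abs _ _).trans (Finset.sum_le_sum fun i _ => ?_)
        rw [Finset.mul_sum]
        refine (Finset.abs_sum_le_sum_abs _ _).trans (Finset.sum_le_sum fun j _ => ?_)
        rw [abs_mul, abs_mul, ← mul_assoc]
        gcongr
        exact hoff j i
    _ = (∑ i, |c i|) ^ 2 * (3 * η) := by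
        rw [sq, Finset.sum_mul_sum, Finset.sum_mul]
        simp_rw [Finset.sum_mul]
    _ ≤ (D * ∑ i, c i ^ 2) * (3 * η) := by
        gcongr
        have := sq_sum_le_card_mul_sum_sq (s := (Finset.univ : Finset (Fin D))) (f := fun i => |c i|)
        simpa [sq_abs] using this
    _ = 3 * D * η * ∑ i, c i ^ 2 := by ring

variable {Ω : Type*} [MeasurableSpace Ω] {μ : Measure Ω} [IsProbabilityMeasure μ]
  {κ ι : Type} [Fintype κ] [Fintype ι] [DecidableEq κ] [DecidableEq ι]
  {s : κ × ι → Ω → ℝ} {N : ℕ}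

/-- The value of the sketch row `l`, as a linear form. -/
noncomputable def rowForm (s : κ × ι → Ω → ℝ) (ω : Ω) (l : κ) : EuclideanSpace ℝ ι →ₗ[ℝ] ℝ :=
  ∑ i, s (l, i) ω • (EuclideanSpace.proj i : EuclideanSpace ℝ ι →L[ℝ] ℝ).toLinearMap

/-- The error of the estimate of `∑ i, v i ^ 2`, as a bilinear form. -/
noncomputable def errorForm (s : κ × ι → Ω → ℝ) (ω : Ω) :
    EuclideanSpace ℝ ι →ₗ[ℝ] EuclideanSpace ℝ ι →ₗ[ℝ] ℝ :=
  (Fintype.card κ : ℝ)⁻¹ •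
    ∑ l, ((rowForm s ω l).smulRight (rowForm s ω l) - innerₗ (EuclideanSpace ℝ ι))

theorem errorForm_symm (s : κ × ι → Ω → ℝ) (ω : Ω) (v w : EuclideanSpace ℝ ι) :
    errorForm s ω v w = errorForm s ω w v := by
  simp only [errorForm, LinearMap.smul_apply, LinearMap.sum_apply, LinearMap.sub_apply,
    LinearMap.smulRight_apply, innerₗ_apply_apply, smul_eq_mul, real_inner_comm v w,
    mul_comm (rowForm s ω _ v)]

theorem errorForm_self (s : κ × ι → Ω → ℝ) (ω : Ω) (v : EuclideanSpace ℝ ι) :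
    errorForm s ω v v = (∑ l, rowError s v l ω) / Fintype.card κ := by
  have h1 : ∀ l, rowForm s ω l v = ∑ i, s (l, i) ω * v i := by
    intro l
    simp [rowForm]
  simp only [errorForm, LinearMap.smul_apply, LinearMap.sum_apply, LinearMap.sub_apply,
    LinearMap.smulRight_apply, innerₗ_apply_apply, smul_eq_mul, real_inner_self_eq_norm_sq,
    EuclideanSpace.real_norm_sq_eq, h1, rowError, ← sq]
  rw [inv_mul_eq_div]

/-- With high probability the mean of the squared sketch rows estimates all the squared norms in
a subspace of small dimension. -/
theorem IsWiseSigns.exists_bad_set (hs : IsWiseSigns μ s N) {Z : Type*} [AddCommGroup Z]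
    [Module ℝ Z] [FiniteDimensional ℝ Z] {D : ℕ} (hZ : Module.finrank ℝ Z ≤ D)
    (L : Z →ₗ[ℝ] EuclideanSpace ℝ ι) {q : ℕ} (hq0 : 0 < q) (hq : 4 * q ≤ N)
    (hm : 40960 * q ^ 8 ≤ Fintype.card κ) :
    ∃ bad : Set Ω, μ.real bad ≤ D ^ 2 * (1 / 16) ^ q ∧ ∀ ω ∉ bad, ∀ z,
      |(∑ l, rowError s (L z) l ω) / Fintype.card κ| ≤ 3 * D / q * ∑ i, L z i ^ 2 := by
  set W := LinearMap.range L with hW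
  have hD : Module.finrank ℝ W ≤ D := (LinearMap.finrank_range_le L).trans hZ
  set b := stdOrthonormalBasis ℝ W with hb
  set u : Fin (Module.finrank ℝ W) → EuclideanSpace ℝ ι := fun i => (b i : EuclideanSpace ℝ ι)
  have hu : Orthonormal ℝ u := b.orthonormal.comp_linearIsometry W.subtypeₗᵢ
  have hnorm : ∀ v : EuclideanSpace ℝ ι, ‖v‖ ^ 2 = ∑ i, v i ^ 2 := EuclideanSpace.real_norm_sq_eq
  -- Failure of the estimate at one of the sums of two basis vectors of the range of `L`; the equal
  -- pairs `u i + u i` supply the diagonal.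
  refine ⟨⋃ p : Fin (Module.finrank ℝ W) × Fin (Module.finrank ℝ W),
    {ω | (∑ i, (u p.1 + u p.2) i ^ 2) / q <
      |(∑ l, rowError s (u p.1 + u p.2 : EuclideanSpace ℝ ι) l ω) / Fintype.card κ|}, ?_, ?_⟩
  · refine (measureReal_iUnion_fintype_le _).trans ?_
    refine (Finset.sum_le_sum fun p _ => hs.measureReal_error_le _ hq0 hq hm).trans ?_
    rw [Finset.sum_const, nsmul_eq_mul]
    gcongr
    rw [Finset.card_univ, Fintype.card_prod, Fintype.card_fin, ← sq]
    exact_mod_cast Nat.pow_le_pow_left hD 2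
  · intro ω hω z
    simp only [Set.mem_iUnion, not_exists, Set.mem_ofPred_eq, not_lt] at hω
    have hc : ∃ c : Fin (Module.finrank ℝ W) → ℝ, L z = ∑ i, c i • u i := by
      refine ⟨fun i => b.repr ⟨L z, LinearMap.mem_range_self L z⟩ i, ?_⟩
      have := congrArg (Submodule.subtype W) (b.sum_repr ⟨L z, LinearMap.mem_range_self L z⟩)
      simpa [u] using this.symm
    obtain ⟨c, hc⟩ := hc
    have h1 := abs_bilin_le_of_orthonormal (errorForm s ω) (errorForm_symm s ω) u hu (η := 1 / q)
      (fun i j => by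
        rw [errorForm_self, hnorm, one_div_mul_eq_div]
        exact hω (i, j)) c
    rw [← hc, errorForm_self] at h1
    have h2 : ∑ i, c i ^ 2 = ∑ i, L z i ^ 2 := by
      rw [← hnorm, hc, ← real_inner_self_eq_norm_sq, hu.inner_sum]
      simp [sq]
    rw [h2] at h1
    refine h1.trans ?_
    have : (0 : ℝ) ≤ ∑ i, L z i ^ 2 := Finset.sum_nonneg fun i _ => sq_nonneg _
    have hD' : (Module.finrank ℝ W : ℝ) ≤ D := by exact_mod_cast hD
    rw [mul_one_div]
    gcongr

end Spectral

/-! ### Union bounds over times and blocks -/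

section Blocks

variable {d : ℕ}

/-- The value at row `i` of the linear combination of the columns of `[b A]` with coefficients
`z`. -/
noncomputable def rowValue (I : Stream d) (n : ℕ) (z : Option (Fin d) → ℝ) (i : ℕ) : ℝ :=
  ∑ c, entry I n (i, c) * z c

noncomputable def blockNormSq (I : Stream d) (n r : ℕ) (z : Option (Fin d) → ℝ) : ℝ :=
  ∑ i ∈ block r, rowValue I n z i ^ 2

/-- The value of the sketch row `(r, l)`. -/
noncomputable def sketchValue (C : ℕ) (β : ℕ → Bool) (I : Stream d) (n r l : ℕ)
    (z : Option (Fin d) → ℝ) : ℝ :=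
  (∑ i ∈ block r, (hashSign β (modBound C r) l i : ℝ) * rowValue I n z i) / 2 ^ scaleExp C r

noncomputable def blockSketchSq (C : ℕ) (β : ℕ → Bool) (I : Stream d) (n r : ℕ)
    (z : Option (Fin d) → ℝ) : ℝ :=
  ∑ l ∈ Finset.range (sketchRows C r), sketchValue C β I n r l z ^ 2

theorem sketchRows_large (C r : ℕ) : 40960 * (r + C) ^ 8 ≤ sketchRows C r := by
  have h1 : r + C ≤ 2 ^ (r + C).size := (Nat.lt_size_self _).le
  calc 40960 * (r + C) ^ 8 ≤ 4 ^ 8 * (2 ^ (r + C).size) ^ 8 := by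
        refine Nat.mul_le_mul (by norm_num) (Nat.pow_le_pow_left h1 8)
    _ = sketchRows C r := by
        rw [sketchRows, scaleExp, pow_add, pow_mul 4 4, ← pow_mul 2, mul_comm _ 8, pow_mul 2 8]
        norm_num

/-- The linear map that sends the coefficients `z` to the rows of the block `r`. -/
noncomputable def blockMap (I : Stream d) (n r : ℕ) :
    (Option (Fin d) → ℝ) →ₗ[ℝ] EuclideanSpace ℝ (block r) where
  toFun z := WithLp.toLp 2 fun i => rowValue I n z i
  map_add' z z' := by
    ext i
    simp [rowValue, mul_add, Finset.sum_add_distrib]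
  map_smul' a z := by
    ext i
    simp only [rowValue, Pi.smul_apply, smul_eq_mul, PiLp.smul_apply, RingHom.id_apply,
      Finset.mul_sum]
    exact Finset.sum_congr rfl fun c _ => mul_left_comm _ _ _

theorem sum_blockMap_sq (I : Stream d) (n r : ℕ) (z : Option (Fin d) → ℝ) :
    ∑ i, blockMap I n r z i ^ 2 = blockNormSq I n r z :=
  Finset.sum_coe_sort (block r) fun i => rowValue I n z i ^ 2

theorem blockSketchSq_sub (C : ℕ) (t : ℕ → ℕ) (ω : Coins) (I : Stream d) (n r : ℕ)
    (z : Option (Fin d) → ℝ) :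
    blockSketchSq C (seedBits t ω) I n r z - blockNormSq I n r z =
      (∑ l, rowError (blockSign C r t) (blockMap I n r z) l ω) /
        Fintype.card (Fin (sketchRows C r)) := by
  have hm : (0 : ℝ) < sketchRows C r := by
    have : 0 < sketchRows C r := by unfold sketchRows; positivity
    exact_mod_cast this
  have hm' : (sketchRows C r : ℝ) = (2 ^ scaleExp C r) ^ 2 := by
    rw [sketchRows, ← pow_mul, mul_comm, pow_mul]
    norm_num
  have h1 := sum_blockMap_sq I n r z
  have h2 : ∀ l : Fin (sketchRows C r), ∑ i, blockSign C r t (l, i) ω * blockMap I n r z i =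
      ∑ i ∈ block r, (hashSign (seedBits t ω) (modBound C r) l i : ℝ) * rowValue I n z i := by
    intro l
    exact Finset.sum_coe_sort (block r) fun i =>
      (hashSign (seedBits t ω) (modBound C r) l i : ℝ) * rowValue I n z i
  simp only [rowError, h1, h2, Finset.sum_sub_distrib, Fintype.card_fin, Finset.sum_const,
    Finset.card_univ, nsmul_eq_mul]
  rw [sub_div, mul_div_cancel_left₀ _ hm.ne']
  congr 1
  simp only [blockSketchSq, sketchValue, div_pow]
  rw [← hm', ← Finset.sum_div, ← Fin.sum_univ_eq_sum_range (fun l =>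
    (∑ i ∈ block r, (hashSign (seedBits t ω) (modBound C r) l i : ℝ) * rowValue I n z i) ^ 2)]

/-- If no update fell into block `r` between two times, the block is unchanged. Its content is thus
a function of the number of updates it has received. -/
theorem entry_eq_of_count_eq {I : Stream d} {r m n : ℕ} (hmn : m ≤ n)
    (h : ((Finset.range m).filter fun t => (I t).row.size = r).card =
      ((Finset.range n).filter fun t => (I t).row.size = r).card) {i : ℕ} (hi : i.size = r)
    (c : Option (Fin d)) : entry I m (i, c) = entry I n (i, c) := by
  have hsub : (Finset.range m).filter (fun t => (I t).row.size = r) =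
      (Finset.range n).filter fun t => (I t).row.size = r :=
    Finset.eq_of_subset_of_card_le
      (Finset.filter_subset_filter _ (Finset.range_mono hmn)) h.ge
  refine Finset.sum_subset (Finset.range_mono hmn) fun t ht htm => ?_
  rw [if_neg]
  intro heq
  have h1 : t ∈ (Finset.range m).filter fun t => (I t).row.size = r := by
    rw [hsub, Finset.mem_filter]
    exact ⟨ht, by simp [Update.row, heq, hi]⟩
  exact htm (Finset.mem_filter.1 h1).1

theorem blockMap_eq_of_count_eq {I : Stream d} {r m n : ℕ}
    (h : ((Finset.range m).filter fun t => (I t).row.size = r).card =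
      ((Finset.range n).filter fun t => (I t).row.size = r).card) :
    blockMap I m r = blockMap I n r := by
  have key : ∀ i ∈ block r, ∀ c, entry I m (i, c) = entry I n (i, c) := by
    intro i hi c
    rcases le_total m n with hmn | hmn
    · exact entry_eq_of_count_eq hmn h (mem_block.1 hi) c
    · exact (entry_eq_of_count_eq hmn h.symm (mem_block.1 hi) c).symm
  ext z i
  simp only [blockMap, LinearMap.coe_comp, Function.comp_apply, LinearMap.coe_mk,
    AddHom.coe_mk, rowValue, key i i.2]

theorem count_le {I : Stream d} (hI : UniqueUpdates I) (r n : ℕ) :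
    ((Finset.range n).filter fun t => (I t).row.size = r).card ≤ (d + 1) * 2 ^ r := by
  have h : ((Finset.range n).filter fun t => (I t).row.size = r).card ≤
      (block r ×ˢ (Finset.univ : Finset (Option (Fin d)))).card := by
    refine Finset.card_le_card_of_injOn (fun t => (I t).1) (fun t ht => ?_) hI.injOn
    simp only [Finset.coe_filter, Set.mem_ofPred_eq] at ht
    simp only [Finset.coe_product, Set.mem_prod, Finset.mem_coe, Finset.mem_univ, and_true]
    exact mem_block.2 ht.2
  refine h.trans ?_
  rw [Finset.card_product, Finset.card_univ, Fintype.card_option, Fintype.card_fin, mul_comm]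
  exact Nat.mul_le_mul_left _ (card_block_le r)

/-- The union runs over the number of updates received by the block instead of over all times. For
each possible number one representative time suffices, and `count_le` bounds how many numbers occur.
-/
theorem exists_bad_set_block (C : ℕ) (hC : 0 < C) {I : Stream d} (hI : UniqueUpdates I)
    (t : ℕ → ℕ) (r : ℕ) :
    ∃ bad : Set Coins,
      coinMeasure.real bad ≤ ((d + 1) * 2 ^ r + 1) * ((d + 1) ^ 2 * (1 / 16) ^ (r + C)) ∧
      ∀ ω ∉ bad, ∀ n z, |blockSketchSq C (seedBits t ω) I n r z - blockNormSq I n r z| ≤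
        3 * (d + 1) / (r + C) * blockNormSq I n r z := by
  have hZ : Module.finrank ℝ (Option (Fin d) → ℝ) ≤ d + 1 := by simp
  have hex := fun n => (isWiseSigns_blockSign C r t).exists_bad_set hZ (blockMap I n r)
    (by omega : 0 < r + C) le_rfl (by simpa using sketchRows_large C r)
  choose bad hbad hgood using hex
  set cnt : ℕ → ℕ := fun n => ((Finset.range n).filter fun t => (I t).row.size = r).card with hcnt
  set rep : ℕ → ℕ := Function.invFun cnt with hrep
  refine ⟨⋃ k ∈ Finset.range ((d + 1) * 2 ^ r + 1), bad (rep k), ?_, ?_⟩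
  · refine (measureReal_biUnion_finset_le _ _).trans ?_
    refine (Finset.sum_le_sum fun k _ => hbad _).trans ?_
    rw [Finset.sum_const, Finset.card_range, nsmul_eq_mul]
    push_cast
    exact le_rfl
  · intro ω hω n z
    simp only [Set.mem_iUnion, not_exists] at hω
    have hk : cnt (rep (cnt n)) = cnt n := Function.invFun_eq ⟨n, rfl⟩
    have h1 := hgood (rep (cnt n)) ω
      (hω (cnt n) (Finset.mem_range.2 (Nat.lt_succ_of_le (count_le hI r n)))) z
    rw [blockMap_eq_of_count_eq hk, ← blockSketchSq_sub] at h1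
    rw [sum_blockMap_sq] at h1
    push_cast at h1
    exact h1

/-- With probability at least `1 - δ` the sketches of all blocks are accurate at all times. -/
theorem exists_bad_set_stream (d : ℕ) {δ : ℝ} (hδ : 0 < δ) :
    ∃ C : ℕ, 6 * (d + 1) ≤ C ∧ ∀ I : Stream d, UniqueUpdates I → ∀ t : ℕ → ℕ,
      ∃ bad : Set Coins, coinMeasure bad ≤ ENNReal.ofReal δ ∧ ∀ ω ∉ bad, ∀ r n z,
        |blockSketchSq C (seedBits t ω) I n r z - blockNormSq I n r z| ≤
          3 * (d + 1) / (r + C) * blockNormSq I n r z := by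
  obtain ⟨C₀, hC₀⟩ := exists_pow_lt_of_lt_one
    (show 0 < δ / (2 * (d + 2) ^ 3) by positivity) (show (1 / 16 : ℝ) < 1 by norm_num)
  -- `C₀` makes the total failure probability small: block `r` fails with probability at most `(d +
  -- 2) ^ 3 * 16 ^ (-C) * 8 ^ (-r)`. The summand `6 * (d + 1)` brings all relative errors down to `1
  -- / 2`.
  refine ⟨C₀ + 6 * (d + 1), by omega, fun I hI t => ?_⟩
  set C := C₀ + 6 * (d + 1) with hC
  choose bad hbad hgood using exists_bad_set_block C (by omega) hI t
  refine ⟨⋃ r, bad r, ?_, fun ω hω r => hgood r ω fun h => hω (Set.mem_iUnion.2 ⟨r, h⟩)⟩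
  have hC1 : (1 / 16 : ℝ) ^ C ≤ δ / (2 * (d + 2) ^ 3) :=
    (pow_le_pow_of_le_one (by norm_num) (by norm_num) (by omega : C₀ ≤ C)).trans hC₀.le
  have hr : ∀ r, coinMeasure (bad r) ≤ ENNReal.ofReal (δ / 2 * (1 / 2) ^ r) := by
    intro r
    rw [← ofReal_measureReal]
    refine ENNReal.ofReal_le_ofReal ((hbad r).trans ?_)
    have h2 : (1 : ℝ) ≤ 2 ^ r := one_le_pow₀ (by norm_num)
    calc ((d + 1) * 2 ^ r + 1) * (((d : ℝ) + 1) ^ 2 * (1 / 16) ^ (r + C))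
        ≤ ((d + 2) * 2 ^ r) * (((d : ℝ) + 2) ^ 2 * (1 / 16) ^ (r + C)) := by
          gcongr
          · linarith
          · linarith
      _ = (d + 2) ^ 3 * (1 / 16) ^ C * ((2 : ℝ) ^ r * (1 / 16) ^ r) := by rw [pow_add]; ring
      _ ≤ (d + 2) ^ 3 * (δ / (2 * (d + 2) ^ 3)) * (1 / 2) ^ r := by
          rw [← mul_pow]
          gcongr
          norm_num
      _ = δ / 2 * (1 / 2) ^ r := by field_simp
  have hsum : HasSum (fun r : ℕ => δ / 2 * (1 / 2 : ℝ) ^ r) δ := by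
    have := hasSum_geometric_two.mul_left (δ / 2)
    rwa [div_mul_cancel₀ _ two_ne_zero] at this
  calc coinMeasure (⋃ r, bad r) ≤ ∑' r, coinMeasure (bad r) := measure_iUnion_le _
    _ ≤ ∑' r, ENNReal.ofReal (δ / 2 * (1 / 2) ^ r) := ENNReal.tsum_le_tsum hr
    _ = ENNReal.ofReal δ := by
        rw [← ENNReal.ofReal_tsum_of_nonneg (fun r => by positivity) hsum.summable, hsum.tsum_eq]

end Blocks

/-! ### Comparing the true and the sketched objective -/

theorem sqrt_sum_add_sq_le {α : Type*} (s : Finset α) (a b : α → ℝ) :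
    √(∑ i ∈ s, (a i + b i) ^ 2) ≤ √(∑ i ∈ s, a i ^ 2) + √(∑ i ∈ s, b i ^ 2) := by
  have hA : 0 ≤ ∑ i ∈ s, a i ^ 2 := Finset.sum_nonneg fun i _ => sq_nonneg _
  have hB : 0 ≤ ∑ i ∈ s, b i ^ 2 := Finset.sum_nonneg fun i _ => sq_nonneg _
  refine Real.sqrt_le_iff.2 ⟨by positivity, ?_⟩
  have h1 : ∑ i ∈ s, a i * b i ≤ √(∑ i ∈ s, a i ^ 2) * √(∑ i ∈ s, b i ^ 2) := by
    rw [← Real.sqrt_mul hA]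
    exact Real.le_sqrt_of_sq_le (Finset.sum_mul_sq_le_sq_mul_sq s a b)
  rw [add_sq, Real.sq_sqrt hA, Real.sq_sqrt hB]
  have h2 : ∑ i ∈ s, (a i + b i) ^ 2 =
      ∑ i ∈ s, a i ^ 2 + 2 * ∑ i ∈ s, a i * b i + ∑ i ∈ s, b i ^ 2 := by
    rw [Finset.mul_sum, ← Finset.sum_add_distrib, ← Finset.sum_add_distrib]
    exact Finset.sum_congr rfl fun i _ => by ring
  rw [h2]
  linarith

/-- A minimizer `x` of `G₁ + G₂`, compared with `y`: if `G₁` and `F₁` hardly differ between `x` and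
`y` and `G₂` is a good approximation of `F₂`, then `x` almost minimizes `F₁ + F₂`. -/
theorem almost_minimizer {F₁x F₂x F₁y F₂y G₁x G₂x G₁y G₂y ε τ : ℝ}
    (hF₁x : 0 ≤ F₁x) (hF₁y : 0 ≤ F₁y) (hF₂y : 0 ≤ F₂y)
    (hG₁x : 0 ≤ G₁x) (hG₂x : 0 ≤ G₂x) (hG₁y : 0 ≤ G₁y) (hε : 0 ≤ ε) (hτ : 0 ≤ τ) (hτ1 : τ ≤ 1)
    (hmin : G₁x + G₂x ≤ G₁y + G₂y)
    (hy : G₁y + G₂y ≤ 3 / 2 * (F₁y + F₂y)) (hx : F₁x + F₂x ≤ 3 * (F₁y + F₂y))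
    (hGx : F₂x - G₂x ≤ ε * F₂x) (hGy : G₂y - F₂y ≤ ε * F₂y)
    (hF : √F₁x ≤ √F₁y + τ * √(F₁y + F₂y)) (hG : √G₁y ≤ √G₁x + 2 * τ * √(F₁y + F₂y)) :
    F₁x + F₂x ≤ (1 + (13 * τ + 4 * ε)) * (F₁y + F₂y) := by
  set F := F₁y + F₂y with hFdef
  have hF0 : 0 ≤ F := add_nonneg hF₁y hF₂y
  have hs := Real.sq_sqrt hF0
  have hs0 := Real.sqrt_nonneg F
  set s := √F
  have h1 : F₁x ≤ F₁y + (2 * τ + τ ^ 2) * F := by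
    have e1 := Real.sq_sqrt hF₁x
    have e2 := Real.sq_sqrt hF₁y
    have e3 : √F₁y ≤ s := Real.sqrt_le_sqrt (by linarith)
    have e4 : √F₁x ^ 2 ≤ (√F₁y + τ * s) ^ 2 := pow_le_pow_left₀ (Real.sqrt_nonneg _) hF 2
    have e5 : τ * s * √F₁y ≤ τ * s * s := mul_le_mul_of_nonneg_left e3 (by positivity)
    nlinarith
  have h2 : G₁y ≤ G₁x + (6 * τ + 4 * τ ^ 2) * F := by
    have e1 := Real.sq_sqrt hG₁x
    have e2 := Real.sq_sqrt hG₁y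
    have e3 : √G₁x ≤ 3 / 2 * s := by
      refine Real.sqrt_le_iff.2 ⟨by positivity, ?_⟩
      nlinarith
    have e4 : √G₁y ^ 2 ≤ (√G₁x + 2 * τ * s) ^ 2 := pow_le_pow_left₀ (Real.sqrt_nonneg _) hG 2
    have e5 : τ * s * √G₁x ≤ τ * s * (3 / 2 * s) := mul_le_mul_of_nonneg_left e3 (by positivity)
    nlinarith
  have h3 : ε * F₂x ≤ ε * (3 * F) := mul_le_mul_of_nonneg_left (by linarith) hε
  have h4 : ε * F₂y ≤ ε * F := mul_le_mul_of_nonneg_left (by linarith) hε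
  have h5 : τ ^ 2 * F ≤ τ * F := mul_le_mul_of_nonneg_right (by nlinarith) hF0
  -- The losses are `3 * τ` from `h1` and `10 * τ` from `h2`, then `3 * ε` at `x` and `ε` at `y`
  -- from the late blocks.
  nlinarith

/-! ### The smallest singular value as a lower bound -/

section SingularValue

/-- Expand `w` in an eigenbasis of the adjoint of `T` composed with `T`; the square of the smallest
singular value is the least eigenvalue. -/
theorem smallestSingularValue_mul_norm_le {m d : ℕ} (hd : 0 < d) (A : Matrix (Fin m) (Fin d) ℝ)
    (w : EuclideanSpace ℝ (Fin d)) :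
    smallestSingularValue A * ‖w‖ ≤ ‖Matrix.toEuclideanLin A w‖ := by
  set T := Matrix.toEuclideanLin A with hT
  have hn : Module.finrank ℝ (EuclideanSpace ℝ (Fin d)) = d := by simp
  set hS := T.isSymmetric_adjoint_comp_self
  set b := hS.eigenvectorBasis hn
  have hσ0 : 0 ≤ smallestSingularValue A := T.singularValues_nonneg _
  have hev : ∀ i, smallestSingularValue A ^ 2 ≤ hS.eigenvalues hn i := by
    intro i
    rw [smallestSingularValue, T.sq_singularValues_of_lt hn (show d - 1 < d by omega)]
    exact hS.eigenvalues_antitone hn (Fin.le_def.2 (Nat.le_sub_one_of_lt i.2))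
  have hw : ‖w‖ ^ 2 = ∑ i, b.repr w i ^ 2 := by
    rw [← b.repr.norm_map w, EuclideanSpace.real_norm_sq_eq]
  have hTw : ‖T w‖ ^ 2 = ∑ i, hS.eigenvalues hn i * b.repr w i ^ 2 := by
    rw [← real_inner_self_eq_norm_sq, ← LinearMap.adjoint_inner_right, ← LinearMap.comp_apply,
      ← b.repr.inner_map_map, PiLp.inner_apply]
    refine Finset.sum_congr rfl fun i _ => ?_
    rw [hS.eigenvectorBasis_apply_self_apply hn w i]
    simp only [RCLike.inner_apply, conj_trivial, RCLike.ofReal_real_eq_id, id]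
    ring
  refine abs_le_of_sq_le_sq' ?_ (norm_nonneg _) |>.2
  rw [mul_pow, hw, hTw, Finset.mul_sum]
  exact Finset.sum_le_sum fun i _ => mul_le_mul_of_nonneg_right (hev i) (sq_nonneg _)

end SingularValue

/-! ### Deterministic analysis for good random bits -/

section Stream

variable {d : ℕ}

/-- The coefficients `(-1, x)` of the columns of `[b A]`. -/
def affineCoeff (x : EuclideanSpace ℝ (Fin d)) : Option (Fin d) → ℝ
  | none => -1
  | some j => x j

def linearCoeff (x : EuclideanSpace ℝ (Fin d)) : Option (Fin d) → ℝ
  | none => 0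
  | some j => x j

theorem affineCoeff_eq_add (x y : EuclideanSpace ℝ (Fin d)) :
    affineCoeff x = affineCoeff y + linearCoeff (x - y) := by
  funext c
  cases c <;> simp [affineCoeff, linearCoeff]

theorem rowValue_add (I : Stream d) (n : ℕ) (z w : Option (Fin d) → ℝ) (i : ℕ) :
    rowValue I n (z + w) i = rowValue I n z i + rowValue I n w i := by
  simp only [rowValue, Pi.add_apply, mul_add, Finset.sum_add_distrib]

theorem sketchValue_add (C : ℕ) (β : ℕ → Bool) (I : Stream d) (n r l : ℕ)
    (z w : Option (Fin d) → ℝ) :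
    sketchValue C β I n r l (z + w) = sketchValue C β I n r l z + sketchValue C β I n r l w := by
  simp only [sketchValue, rowValue_add, mul_add, Finset.sum_add_distrib, add_div]

theorem blockNormSq_nonneg (I : Stream d) (n r : ℕ) (z : Option (Fin d) → ℝ) :
    0 ≤ blockNormSq I n r z := Finset.sum_nonneg fun _ _ => sq_nonneg _

theorem blockSketchSq_nonneg (C : ℕ) (β : ℕ → Bool) (I : Stream d) (n r : ℕ)
    (z : Option (Fin d) → ℝ) : 0 ≤ blockSketchSq C β I n r z :=
  Finset.sum_nonneg fun _ _ => sq_nonneg _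

theorem sqrt_blockNormSq_add_le (I : Stream d) (n R : ℕ) (z w : Option (Fin d) → ℝ) :
    √(∑ r ∈ Finset.range R, blockNormSq I n r (z + w)) ≤
      √(∑ r ∈ Finset.range R, blockNormSq I n r z) +
        √(∑ r ∈ Finset.range R, blockNormSq I n r w) := by
  simp only [blockNormSq, Finset.sum_sigma', rowValue_add]
  exact sqrt_sum_add_sq_le _ _ _

theorem sqrt_blockSketchSq_add_le (C : ℕ) (β : ℕ → Bool) (I : Stream d) (n R : ℕ)
    (z w : Option (Fin d) → ℝ) :
    √(∑ r ∈ Finset.range R, blockSketchSq C β I n r (z + w)) ≤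
      √(∑ r ∈ Finset.range R, blockSketchSq C β I n r z) +
        √(∑ r ∈ Finset.range R, blockSketchSq C β I n r w) := by
  simp only [blockSketchSq, Finset.sum_sigma', sketchValue_add]
  exact sqrt_sum_add_sq_le _ _ _

theorem entry_eq_zero_of_rowCount_le (I : Stream d) (n : ℕ) {i : ℕ} (hi : rowCount I n ≤ i)
    (c : Option (Fin d)) : entry I n (i, c) = 0 := by
  refine Finset.sum_eq_zero fun t ht => if_neg fun h => ?_
  have h1 : (I t).row + 1 ≤ rowCount I n :=
    Finset.le_sup (f := fun t => (I t).row + 1) ht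
  have h2 : (I t).row = i := by simp [Update.row, h]
  omega

/-- An index has at most as many binary digits as its value, so the blocks below any `R ≥ rowCount I
n` contain all rows. -/
theorem sum_blockNormSq (I : Stream d) (n : ℕ) {R : ℕ} (hR : rowCount I n ≤ R)
    (z : Option (Fin d) → ℝ) :
    ∑ r ∈ Finset.range R, blockNormSq I n r z =
      ∑ i : Fin (rowCount I n), rowValue I n z i ^ 2 := by
  have hdisj : Set.PairwiseDisjoint (↑(Finset.range R)) block := by
    intro r _ r' _ hne
    refine Finset.disjoint_left.2 fun i hi hi' => hne ?_
    rw [← mem_block.1 hi, ← mem_block.1 hi']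
  simp only [blockNormSq]
  rw [← Finset.sum_biUnion hdisj, Fin.sum_univ_eq_sum_range (fun i => rowValue I n z i ^ 2)]
  refine (Finset.sum_subset (fun i hi => ?_) fun i _ hi => ?_).symm
  · rw [Finset.mem_range] at hi
    have : i.size ≤ i := Nat.size_le.2 Nat.lt_two_pow_self
    exact Finset.mem_biUnion.2 ⟨i.size, Finset.mem_range.2 (by omega), mem_block.2 rfl⟩
  · rw [Finset.mem_range, not_lt] at hi
    simp [rowValue, entry_eq_zero_of_rowCount_le I n hi, -Fintype.sum_option]

theorem residual_sq (I : Stream d) (n : ℕ) {R : ℕ} (hR : rowCount I n ≤ R)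
    (x : EuclideanSpace ℝ (Fin d)) :
    residual (dataMatrix I n) (target I n) x ^ 2 =
      ∑ r ∈ Finset.range R, blockNormSq I n r (affineCoeff x) := by
  rw [sum_blockNormSq I n hR, residual, EuclideanSpace.real_norm_sq_eq]
  refine Finset.sum_congr rfl fun i _ => ?_
  congr 1
  simp [rowValue, affineCoeff, dataMatrix, target, Matrix.toLpLin_apply, Matrix.mulVec,
    dotProduct]
  ring

/-- With unique updates an entry is zero until its only update and constant afterwards. -/
theorem exists_abs_entry_le {I : Stream d} (hI : UniqueUpdates I) (p : ℕ × Option (Fin d)) :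
    ∃ b : ℝ, ∀ n, |entry I n p| ≤ b := by
  by_cases h : ∃ t, (I t).1 = p
  · obtain ⟨t₀, ht₀⟩ := h
    refine ⟨|(I t₀).value|, fun n => ?_⟩
    have h1 : ∀ t, (if (I t).1 = p then (I t).value else 0) =
        if t = t₀ then (I t₀).value else 0 := by
      intro t
      by_cases ht : t = t₀
      · simp [ht, ht₀]
      · have : (I t).1 ≠ p := fun h => ht (hI (h.trans ht₀.symm))
        simp [ht, this]
    simp only [entry, h1, Finset.sum_ite_eq']
    split_ifs <;> simp
  · push Not at h
    exact ⟨0, fun n => by simp [entry, h]⟩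

/-- The rows of finitely many blocks are bounded, uniformly in time. -/
theorem exists_sum_blockNormSq_le {I : Stream d} (hI : UniqueUpdates I) (R : ℕ) :
    ∃ a : ℝ, 0 ≤ a ∧ ∀ n (w : EuclideanSpace ℝ (Fin d)),
      ∑ r ∈ Finset.range R, blockNormSq I n r (linearCoeff w) ≤ a ^ 2 * ‖w‖ ^ 2 := by
  choose b hb using exists_abs_entry_le hI
  set S := ∑ r ∈ Finset.range R, ∑ i ∈ block r, ∑ c, b (i, c) ^ 2 with hS
  have hS0 : 0 ≤ S := Finset.sum_nonneg fun r _ => Finset.sum_nonneg fun i _ =>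
    Finset.sum_nonneg fun c _ => sq_nonneg _
  refine ⟨√S, Real.sqrt_nonneg _, fun n w => ?_⟩
  rw [Real.sq_sqrt hS0, hS, Finset.sum_mul]
  refine Finset.sum_le_sum fun r _ => ?_
  rw [blockNormSq, Finset.sum_mul]
  refine Finset.sum_le_sum fun i _ => ?_
  refine (Finset.sum_mul_sq_le_sq_mul_sq _ _ _).trans ?_
  have h1 : ∑ c, linearCoeff w c ^ 2 = ‖w‖ ^ 2 := by
    rw [EuclideanSpace.real_norm_sq_eq]
    simp [linearCoeff]
  rw [h1]
  refine mul_le_mul_of_nonneg_right (Finset.sum_le_sum fun c _ => ?_) (sq_nonneg _)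
  rw [← sq_abs (entry I n (i, c))]
  exact pow_le_pow_left₀ (abs_nonneg _) (hb _ n) 2

/-- The random bits `β` are good for the stream `I`: all sketches are accurate at all times. -/
def GoodSeed (C : ℕ) (β : ℕ → Bool) (I : Stream d) : Prop :=
  ∀ r n z, |blockSketchSq C β I n r z - blockNormSq I n r z| ≤
    3 * (d + 1) / (r + C) * blockNormSq I n r z

/-- The freedom in `R` allows the sum to be extended beyond `r₀` later on; blocks from `rowCount I
n` on contribute nothing. -/
def IsSketchMinimizer (C : ℕ) (β : ℕ → Bool) (I : Stream d) (n : ℕ)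
    (x : EuclideanSpace ℝ (Fin d)) : Prop :=
  ∀ (R : ℕ), rowCount I n ≤ R → ∀ y : EuclideanSpace ℝ (Fin d),
    ∑ r ∈ Finset.range R, blockSketchSq C β I n r (affineCoeff x) ≤
      ∑ r ∈ Finset.range R, blockSketchSq C β I n r (affineCoeff y)

variable {C : ℕ} {β : ℕ → Bool} {I : Stream d}

theorem GoodSeed.abs_sub_le (h : GoodSeed C β I) (hC : 6 * (d + 1) ≤ C) (r₀ : ℕ) (S : Finset ℕ)
    (hS : ∀ r ∈ S, r₀ ≤ r) (n : ℕ) (z : Option (Fin d) → ℝ) :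
    |∑ r ∈ S, blockSketchSq C β I n r z - ∑ r ∈ S, blockNormSq I n r z| ≤
      3 * (d + 1) / (r₀ + C) * ∑ r ∈ S, blockNormSq I n r z := by
  have hC0 : (0 : ℝ) < C := by
    have : 0 < C := by omega
    exact_mod_cast this
  rw [← Finset.sum_sub_distrib, Finset.mul_sum]
  refine (Finset.abs_sum_le_sum_abs _ _).trans (Finset.sum_le_sum fun r hr => (h r n z).trans ?_)
  refine mul_le_mul_of_nonneg_right ?_ (blockNormSq_nonneg _ _ _ _)
  have : (r₀ : ℝ) ≤ r := by exact_mod_cast hS r hr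
  gcongr

theorem half_bound (hC : 6 * (d + 1) ≤ C) (r₀ : ℕ) : 3 * ((d : ℝ) + 1) / (r₀ + C) ≤ 1 / 2 := by
  have h1 : 6 * ((d : ℝ) + 1) ≤ C := by exact_mod_cast hC
  have h2 : (0 : ℝ) ≤ r₀ := Nat.cast_nonneg _
  have h3 : (0 : ℝ) ≤ d := Nat.cast_nonneg _
  rw [div_le_iff₀ (by linarith)]
  linarith

/-- Both sketched objectives are within a factor `1 ± 1 / 2` of the true ones, and `(3 / 2) / (1 /
2) = 3`. -/
theorem GoodSeed.residual_sq_le (h : GoodSeed C β I) (hC : 6 * (d + 1) ≤ C) {n : ℕ}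
    {x : EuclideanSpace ℝ (Fin d)} (hx : IsSketchMinimizer C β I n x)
    (y : EuclideanSpace ℝ (Fin d)) :
    residual (dataMatrix I n) (target I n) x ^ 2 ≤
      3 * residual (dataMatrix I n) (target I n) y ^ 2 := by
  rw [residual_sq I n le_rfl, residual_sq I n le_rfl]
  have h0 := hx _ le_rfl y
  have h1 := h.abs_sub_le hC 0 (Finset.range (rowCount I n)) (fun r _ => Nat.zero_le r) n
    (affineCoeff x)
  have h2 := h.abs_sub_le hC 0 (Finset.range (rowCount I n)) (fun r _ => Nat.zero_le r) n
    (affineCoeff y)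
  have h3 := half_bound hC 0
  have hx0 : 0 ≤ ∑ r ∈ Finset.range (rowCount I n), blockNormSq I n r (affineCoeff x) :=
    Finset.sum_nonneg fun r _ => blockNormSq_nonneg _ _ _ _
  have hy0 : 0 ≤ ∑ r ∈ Finset.range (rowCount I n), blockNormSq I n r (affineCoeff y) :=
    Finset.sum_nonneg fun r _ => blockNormSq_nonneg _ _ _ _
  have h4 := (abs_le.1 h1).1
  have h5 := (abs_le.1 h2).2
  nlinarith

theorem residual_nonneg {m : ℕ} (A : Matrix (Fin m) (Fin d) ℝ) (b : EuclideanSpace ℝ (Fin m))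
    (x : EuclideanSpace ℝ (Fin d)) : 0 ≤ residual A b x := norm_nonneg _

theorem GoodSeed.isApproxSolution_one (h : GoodSeed C β I) (hC : 6 * (d + 1) ≤ C) {n : ℕ}
    {x : EuclideanSpace ℝ (Fin d)} (hx : IsSketchMinimizer C β I n x) :
    IsApproxSolution (dataMatrix I n) (target I n) 1 x := by
  intro y
  have h1 := h.residual_sq_le hC hx y
  have h2 := residual_nonneg (dataMatrix I n) (target I n) y
  refine abs_le_of_sq_le_sq' ?_ (by positivity) |>.2
  nlinarith

theorem residual_sub_le {m : ℕ} (A : Matrix (Fin m) (Fin d) ℝ) (b : EuclideanSpace ℝ (Fin m))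
    (x y : EuclideanSpace ℝ (Fin d)) :
    ‖Matrix.toEuclideanLin A (x - y)‖ ≤ residual A b x + residual A b y := by
  have : Matrix.toEuclideanLin A (x - y) =
      (Matrix.toEuclideanLin A x - b) - (Matrix.toEuclideanLin A y - b) := by
    rw [map_sub]; abel
  rw [this]
  exact norm_sub_le _ _

/-- The blocks are split at `r₀`. Closeness of `x` and `y`, forced by the singular value, controls
the blocks below `r₀`, where the sketch is only accurate up to a constant factor. Accuracy of the
sketch controls the others. -/
theorem GoodSeed.isApproxSolution (h : GoodSeed C β I) (hC : 6 * (d + 1) ≤ C) (hd : 0 < d)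
    {n r₀ : ℕ} {x : EuclideanSpace ℝ (Fin d)} (hx : IsSketchMinimizer C β I n x) {a τ : ℝ}
    (ha : ∀ w : EuclideanSpace ℝ (Fin d),
      ∑ r ∈ Finset.range r₀, blockNormSq I n r (linearCoeff w) ≤ a ^ 2 * ‖w‖ ^ 2)
    (ha0 : 0 ≤ a) (hσ : 0 < smallestSingularValue (dataMatrix I n))
    (hτ : 3 * a / smallestSingularValue (dataMatrix I n) ≤ τ) (hτ1 : τ ≤ 1) :
    IsApproxSolution (dataMatrix I n) (target I n)
      (13 * τ + 4 * (3 * (d + 1) / (r₀ + C))) x := by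
  intro y
  set σ := smallestSingularValue (dataMatrix I n) with hσdef
  set R := max r₀ (rowCount I n) with hR
  have hτ0 : 0 ≤ τ := le_trans (by positivity) hτ
  set ε : ℝ := 3 * (d + 1) / (r₀ + C) with hε
  have hε0 : 0 ≤ ε := by positivity
  have hsplit : ∀ f : ℕ → ℝ, ∑ r ∈ Finset.range R, f r =
      ∑ r ∈ Finset.range r₀, f r + ∑ r ∈ Finset.Ico r₀ R, f r := fun f =>
    (Finset.sum_range_add_sum_Ico f (le_max_left _ _)).symm
  have hRle : rowCount I n ≤ R := le_max_right _ _
  have h3 := h.residual_sq_le hC hx y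
  have hresx := residual_sq I n hRle x
  have hresy := residual_sq I n hRle y
  have hρx := residual_nonneg (dataMatrix I n) (target I n) x
  have hρy := residual_nonneg (dataMatrix I n) (target I n) y
  set ρx := residual (dataMatrix I n) (target I n) x with hρxd
  set ρy := residual (dataMatrix I n) (target I n) y with hρyd
  have hsqrt : √(ρy ^ 2) = ρy := Real.sqrt_sq hρy
  have hρ2 : ρx ≤ 2 * ρy := by
    refine abs_le_of_sq_le_sq' ?_ (by positivity) |>.2
    nlinarith
  -- the distance between `x` and `y`
  have hw : a * ‖x - y‖ ≤ τ * ρy := by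
    have h4 := (smallestSingularValue_mul_norm_le hd (dataMatrix I n) (x - y)).trans
      (residual_sub_le (dataMatrix I n) (target I n) x y)
    rw [← hσdef] at h4
    have h5 : ‖x - y‖ ≤ 3 * ρy / σ := by
      rw [le_div_iff₀ hσ]
      linarith
    calc a * ‖x - y‖ ≤ a * (3 * ρy / σ) := by gcongr
      _ = 3 * a / σ * ρy := by ring
      _ ≤ τ * ρy := by gcongr
  have hnn : ∀ (S : Finset ℕ) z, 0 ≤ ∑ r ∈ S, blockNormSq I n r z := fun S z =>
    Finset.sum_nonneg fun r _ => blockNormSq_nonneg _ _ _ _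
  have hnn' : ∀ (S : Finset ℕ) z, 0 ≤ ∑ r ∈ S, blockSketchSq C β I n r z := fun S z =>
    Finset.sum_nonneg fun r _ => blockSketchSq_nonneg _ _ _ _ _ _
  have hF : √(∑ r ∈ Finset.range r₀, blockNormSq I n r (affineCoeff x)) ≤
      √(∑ r ∈ Finset.range r₀, blockNormSq I n r (affineCoeff y)) + τ * ρy := by
    rw [affineCoeff_eq_add x y]
    refine (sqrt_blockNormSq_add_le I n r₀ _ _).trans (add_le_add_right ?_ _)
    refine Real.sqrt_le_iff.2 ⟨by positivity, (ha (x - y)).trans ?_⟩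
    rw [← mul_pow]
    exact pow_le_pow_left₀ (by positivity) hw 2
  have hG : √(∑ r ∈ Finset.range r₀, blockSketchSq C β I n r (affineCoeff y)) ≤
      √(∑ r ∈ Finset.range r₀, blockSketchSq C β I n r (affineCoeff x)) + 2 * τ * ρy := by
    rw [affineCoeff_eq_add y x]
    refine (sqrt_blockSketchSq_add_le C β I n r₀ _ _).trans (add_le_add_right ?_ _)
    refine Real.sqrt_le_iff.2 ⟨by positivity, ?_⟩
    -- The sketch of the difference exceeds its true squared norm by at most the factor `3 / 2`,
    -- hence `2 * τ` after the square root.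
    have h6 := h.abs_sub_le hC 0 (Finset.range r₀) (fun r _ => Nat.zero_le r) n
      (linearCoeff (y - x))
    have h7 := half_bound hC 0
    have h8 := ha (y - x)
    rw [norm_sub_rev, ← mul_pow] at h8
    have h9 : (a * ‖x - y‖) ^ 2 ≤ (τ * ρy) ^ 2 := pow_le_pow_left₀ (by positivity) hw 2
    have h10 := (abs_le.1 h6).2
    have h11 := hnn (Finset.range r₀) (linearCoeff (y - x))
    nlinarith
  have hmin := hx R hRle y
  have hyy : ∑ r ∈ Finset.range R, blockSketchSq C β I n r (affineCoeff y) ≤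
      3 / 2 * ∑ r ∈ Finset.range R, blockNormSq I n r (affineCoeff y) := by
    have h6 := h.abs_sub_le hC 0 (Finset.range R) (fun r _ => Nat.zero_le r) n (affineCoeff y)
    have h7 := half_bound hC 0
    have h10 := (abs_le.1 h6).2
    have h11 := hnn (Finset.range R) (affineCoeff y)
    nlinarith
  have h2x := h.abs_sub_le hC r₀ (Finset.Ico r₀ R) (fun r hr => (Finset.mem_Ico.1 hr).1) n
    (affineCoeff x)
  have h2y := h.abs_sub_le hC r₀ (Finset.Ico r₀ R) (fun r hr => (Finset.mem_Ico.1 hr).1) n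
    (affineCoeff y)
  have hFxy : ρx ^ 2 ≤ 3 * ρy ^ 2 := h3
  rw [hresx, hresy] at hFxy
  rw [hsplit, hsplit] at hmin hyy hFxy
  rw [hsplit] at hresx hresy
  have key := almost_minimizer (hnn _ _) (hnn _ _) (hnn _ _) (hnn' _ _) (hnn' _ _)
    (hnn' _ _) hε0 hτ0 hτ1 hmin hyy hFxy (by linarith [(abs_le.1 h2x).1])
    (by linarith [(abs_le.1 h2y).2]) (by rw [← hresy, hsqrt]; exact hF)
    (by rw [← hresy, hsqrt]; exact hG)
  rw [← hresx, ← hresy] at key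
  refine abs_le_of_sq_le_sq' ?_ (by positivity) |>.2
  rw [mul_pow]
  refine key.trans (mul_le_mul_of_nonneg_right ?_ (sq_nonneg _))
  -- The bound for the squares has the factor `1 + e` with `e ≥ 0`, which is at most `(1 + e) ^ 2`.
  nlinarith

/-- First `r₀` is chosen for the late blocks, then `n` large for the early ones. Neither choice
depends on the random bits, so the threshold for `n` is uniform in `β`. -/
theorem eventually_isApproxSolution (hI : UniqueUpdates I) (hd : 0 < d) (hC : 6 * (d + 1) ≤ C)
    (hσ : Tendsto (fun n => smallestSingularValue (dataMatrix I n)) atTop atTop)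
    {η : ℝ} (hη : 0 < η) :
    ∀ᶠ n in atTop, ∀ β, GoodSeed C β I → ∀ x, IsSketchMinimizer C β I n x →
      IsApproxSolution (dataMatrix I n) (target I n) η x := by
  obtain ⟨r₀, hr₀⟩ := exists_nat_gt (24 * (d + 1) / η)
  obtain ⟨a, ha0, ha⟩ := exists_sum_blockNormSq_le hI r₀
  set τ := min 1 (η / 26) with hτ
  have hτ0 : 0 < τ := by positivity
  filter_upwards [hσ.eventually_ge_atTop (3 * a / τ), hσ.eventually_gt_atTop 0]
    with n hn hn0 β hβ x hx y
  have h1 := hβ.isApproxSolution hC hd hx (ha n) ha0 hn0 (τ := τ) (by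
    rw [div_le_iff₀ hn0]
    rw [div_le_iff₀ hτ0] at hn
    linarith) (min_le_left _ _) y
  refine h1.trans (mul_le_mul_of_nonneg_right ?_ (residual_nonneg _ _ _))
  have h2 : τ ≤ η / 26 := min_le_right _ _
  have h3 : (3 * ((d : ℝ) + 1) / (r₀ + C)) ≤ η / 8 := by
    have hd0 : (0 : ℝ) ≤ d := Nat.cast_nonneg _
    have hC0 : (0 : ℝ) ≤ C := Nat.cast_nonneg _
    have hr₀' : (0 : ℝ) < r₀ := lt_of_le_of_lt (by positivity) hr₀
    rw [div_lt_iff₀ hη] at hr₀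
    rw [div_le_iff₀ (by positivity)]
    nlinarith
  linarith

end Stream

/-! ### Exact solution of the sketched problem -/

section Output

variable {d : ℕ}

/-- The transpose of `A` and its product with `A` have the same rank over the rationals, hence the
same range. No assumption on the rank of `A` is needed. -/
theorem exists_rat_normalEq {m : Type*} [Fintype m] (A : Matrix m (Fin d) ℚ)
    (b : m → ℚ) : ∃ v : Fin d → ℚ, Matrix.mulVec A.transpose (Matrix.mulVec A v) =
      Matrix.mulVec A.transpose b := by
  have hle : LinearMap.range (A.transpose * A).mulVecLin ≤
      LinearMap.range A.transpose.mulVecLin := by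
    rw [Matrix.mulVecLin_mul]
    exact LinearMap.range_comp_le_range _ _
  have heq := Submodule.eq_of_le_of_finrank_eq hle (by
    have h1 := Matrix.rank_transpose_mul_self A
    have h2 := Matrix.rank_transpose A
    unfold Matrix.rank at h1 h2
    rw [h1, ← h2])
  have hb : Matrix.mulVec A.transpose b ∈ LinearMap.range (A.transpose * A).mulVecLin := by
    rw [heq]
    exact ⟨b, rfl⟩
  obtain ⟨v, hv⟩ := hb
  refine ⟨v, ?_⟩
  rw [Matrix.mulVec_mulVec]
  exact hv

theorem coeff_zero (x : (Fin d → ℤ) × ℕ) : coeff x 0 = -(x.2 : ℤ) := rfl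

theorem coeff_succ (x : (Fin d → ℤ) × ℕ) (j : Fin d) : coeff x (j + 1) = x.1 j := by
  simp [coeff]

theorem sum_sketchEntry_coeff (T : List ℤ) (x : (Fin d → ℤ) × ℕ) (ρ : ℕ) :
    ∑ c ∈ Finset.range (d + 1), sketchEntry T ρ c * coeff x c =
      ∑ j : Fin d, sketchEntry T ρ (j + 1) * x.1 j - sketchEntry T ρ 0 * x.2 := by
  rw [Finset.sum_range_succ', coeff_zero, ← Fin.sum_univ_eq_sum_range (fun c =>
    sketchEntry T ρ (c + 1) * coeff x (c + 1))]
  simp only [coeff_succ]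
  ring

theorem exists_isSketchSolution (T : List ℤ) : ∃ x : (Fin d → ℤ) × ℕ, IsSketchSolution T x := by
  obtain ⟨v, hv⟩ := exists_rat_normalEq
    (Matrix.of fun (ρ : Fin T.length) (j : Fin d) => (sketchEntry T ρ (j + 1) : ℚ))
    (fun ρ => (sketchEntry T ρ 0 : ℚ))
  -- A common denominator of the coordinates.
  set q : ℕ := ∏ j, (v j).den with hq
  have hq0 : 0 < q := Finset.prod_pos fun j _ => (v j).den_pos
  have hp : ∀ j, ∃ p : ℤ, (p : ℚ) = v j * q := by
    intro j
    obtain ⟨k, hk⟩ := Finset.dvd_prod_of_mem (fun j => (v j).den) (Finset.mem_univ j)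
    refine ⟨(v j).num * k, ?_⟩
    rw [hq, hk]
    push_cast
    rw [← mul_assoc, Rat.mul_den_eq_num]
  choose p hp using hp
  refine ⟨(p, q), hq0, fun j hj => ?_⟩
  have h1 := congrFun hv ⟨j, hj⟩
  simp only [Matrix.mulVec, dotProduct, Matrix.transpose_apply, Matrix.of_apply] at h1
  have h2 : (normalEq T (p, q) j : ℚ) = q * (∑ ρ : Fin T.length, (sketchEntry T ρ (j + 1) : ℚ) *
      ∑ i : Fin d, (sketchEntry T ρ (i + 1) : ℚ) * v i -
        ∑ ρ : Fin T.length, (sketchEntry T ρ (j + 1) : ℚ) * sketchEntry T ρ 0) := by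
    simp only [normalEq, sum_sketchEntry_coeff]
    rw [← Fin.sum_univ_eq_sum_range (fun ρ => sketchEntry T ρ (j + 1) *
      (∑ i : Fin d, sketchEntry T ρ (i + 1) * p i - sketchEntry T ρ 0 * q))]
    push_cast
    rw [← Finset.sum_sub_distrib, Finset.mul_sum]
    refine Finset.sum_congr rfl fun ρ _ => ?_
    simp only [hp]
    rw [← mul_sub, mul_left_comm, mul_sub (q : ℚ), Finset.mul_sum]
    congr 2
    · exact Finset.sum_congr rfl fun i _ => by ring
    · ring
  rw [h1, sub_self, mul_zero] at h2
  exact_mod_cast h2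

theorem exists_codesSolution (d : ℕ) (T : List ℤ) : ∃ n, codesSolution d T n = true := by
  obtain ⟨x, hx⟩ := exists_isSketchSolution (d := d) T
  refine ⟨@Encodable.encode _ Primcodable.toEncodable x, ?_⟩
  simp [codesSolution, hx]

/-- The first solution of the sketched regression problem. -/
def sketchSolution (d : ℕ) (T : List ℤ) : (Fin d → ℤ) × ℕ :=
  (@Encodable.decode ((Fin d → ℤ) × ℕ) Primcodable.toEncodable
    (Nat.find (exists_codesSolution d T))).getD (0, 0)

theorem computable_sketchSolution (d : ℕ) : Computable (sketchSolution d) :=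
  Computable.option_getD (Computable.decode.comp
    (computable_find (primrec_codesSolution d) (exists_codesSolution d))) (Computable.const _)

theorem isSketchSolution_sketchSolution (d : ℕ) (T : List ℤ) :
    IsSketchSolution T (sketchSolution d T) := by
  have h := Nat.find_spec (exists_codesSolution d T)
  unfold sketchSolution
  generalize Nat.find (exists_codesSolution d T) = n at h ⊢
  unfold codesSolution at h
  cases hx : @Encodable.decode ((Fin d → ℤ) × ℕ) Primcodable.toEncodable n with
  | none =>
    rw [hx] at h
    exact absurd h Bool.false_ne_true
  | some x =>
    rw [hx] at h
    exact of_decide_eq_true h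

/-- The value of the row `ρ` of the sketch at the coefficients `z`, multiplied by
`2 ^ T.length`. -/
noncomputable def scaledValue (T : List ℤ) (ρ : ℕ) (z : Option (Fin d) → ℝ) : ℝ :=
  ∑ c, (sketchEntry T ρ (Encodable.encode c) : ℝ) * z c

theorem scaledValue_affineCoeff (T : List ℤ) (ρ : ℕ) (x : EuclideanSpace ℝ (Fin d)) :
    scaledValue T ρ (affineCoeff x) =
      ∑ j : Fin d, (sketchEntry T ρ (j + 1) : ℝ) * x j - sketchEntry T ρ 0 := by
  have h : ∀ j : Fin d, Encodable.encode (some j) = (j : ℕ) + 1 := fun j => rfl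
  simp only [scaledValue, Fintype.sum_option, affineCoeff, h, Encodable.encode_none]
  ring

/-- By the normal equations the residual `res` is orthogonal to the change `dif` of the fitted
values, so the claim is Pythagoras. -/
theorem IsSketchSolution.sum_sq_le {T : List ℤ} {x : (Fin d → ℤ) × ℕ} (hx : IsSketchSolution T x)
    (y : EuclideanSpace ℝ (Fin d)) :
    ∑ ρ ∈ Finset.range T.length, scaledValue T ρ (affineCoeff (ratVec x)) ^ 2 ≤
      ∑ ρ ∈ Finset.range T.length, scaledValue T ρ (affineCoeff y) ^ 2 := by
  obtain ⟨hq, hn⟩ := hx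
  have hq' : (0 : ℝ) < x.2 := by exact_mod_cast hq
  set res : ℕ → ℝ := fun ρ => scaledValue T ρ (affineCoeff (ratVec x)) with hres
  have h1 : ∀ j : Fin d, ∑ ρ ∈ Finset.range T.length, (sketchEntry T ρ (j + 1) : ℝ) * res ρ = 0 := by
    intro j
    have h2 : (normalEq T x j : ℝ) = x.2 *
        ∑ ρ ∈ Finset.range T.length, (sketchEntry T ρ (j + 1) : ℝ) * res ρ := by
      simp only [normalEq, sum_sketchEntry_coeff]
      push_cast
      rw [Finset.mul_sum]
      refine Finset.sum_congr rfl fun ρ _ => ?_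
      simp only [hres, scaledValue_affineCoeff, ratVec]
      rw [mul_left_comm, mul_sub (x.2 : ℝ), Finset.mul_sum]
      congr 2
      · refine Finset.sum_congr rfl fun i _ => ?_
        field_simp
      · ring
    rw [hn j j.2] at h2
    have h3 : (x.2 : ℝ) * ∑ ρ ∈ Finset.range T.length, (sketchEntry T ρ (j + 1) : ℝ) * res ρ = 0 := by
      rw [← h2]; simp
    exact (mul_eq_zero.1 h3).resolve_left hq'.ne'
  set dif : ℕ → ℝ := fun ρ => ∑ j : Fin d, (sketchEntry T ρ (j + 1) : ℝ) * (y j - ratVec x j) with hdif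
  have h2 : ∀ ρ, scaledValue T ρ (affineCoeff y) = res ρ + dif ρ := by
    intro ρ
    simp only [hres, hdif, scaledValue_affineCoeff, mul_sub, Finset.sum_sub_distrib]
    ring
  have h3 : ∑ ρ ∈ Finset.range T.length, res ρ * dif ρ = 0 := by
    simp only [hdif, Finset.mul_sum]
    rw [Finset.sum_comm]
    refine Finset.sum_eq_zero fun j _ => ?_
    have : ∀ ρ, res ρ * ((sketchEntry T ρ (j + 1) : ℝ) * (y j - ratVec x j)) =
        (sketchEntry T ρ (j + 1) : ℝ) * res ρ * (y j - ratVec x j) := fun ρ => by ring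
    simp only [this]
    rw [← Finset.sum_mul, h1, zero_mul]
  calc ∑ ρ ∈ Finset.range T.length, res ρ ^ 2
      ≤ ∑ ρ ∈ Finset.range T.length, res ρ ^ 2 +
          2 * ∑ ρ ∈ Finset.range T.length, res ρ * dif ρ +
          ∑ ρ ∈ Finset.range T.length, dif ρ ^ 2 := by
        rw [h3]
        have : 0 ≤ ∑ ρ ∈ Finset.range T.length, dif ρ ^ 2 :=
          Finset.sum_nonneg fun ρ _ => sq_nonneg _
        linarith
    _ = ∑ ρ ∈ Finset.range T.length, scaledValue T ρ (affineCoeff y) ^ 2 := by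
        rw [Finset.mul_sum, ← Finset.sum_add_distrib, ← Finset.sum_add_distrib]
        exact Finset.sum_congr rfl fun ρ _ => by rw [h2]; ring

end Output

/-! ### The memory content is the sketch -/

section Algorithm

/-- The streaming algorithm with accuracy parameter `C`. -/
def sketchAlg (d C : ℕ) : StreamAlg d where
  State := Memory
  code := memoryCode
  code_injective := memoryCode_injective
  code_computable := primrec_memoryCode.to_comp
  init := ([], [])
  coins _ u := seedLength C u.row.size
  coins_computable :=
    ((primrec_seedLength C).comp ((primrec_rowSize d).comp Primrec.snd)).to_comp
  step := sketchStep C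
  step_computable := (primrec_sketchStep d C).to_comp
  output s := sketchSolution d s.2
  output_computable := (computable_sketchSolution d).comp Computable.snd

variable {d : ℕ} (C : ℕ) (I : Stream d) (ω : Coins)

/-- The memory content after the first `n` updates. -/
def memoryAt (n : ℕ) : Memory := (sketchAlg d C).run I ω n

/-- The coins that the algorithm tosses at update `n`. -/
def tossed (n : ℕ) : List Bool :=
  (List.range (seedLength C (I n).row.size)).map fun j => ω (n, j)

theorem memoryAt_zero : memoryAt C I ω 0 = ([], []) := rfl

theorem memoryAt_succ (n : ℕ) :
    memoryAt C I ω (n + 1) = sketchStep C (memoryAt C I ω n) (I n, tossed C I ω n) := rfl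

theorem newSeed_length (s b : List Bool) : (newSeed s b).length = max s.length b.length := by
  simp [newSeed]
  omega

theorem newSeed_getD (s b : List Bool) (k : ℕ) :
    (newSeed s b).getD k false = if k < s.length then s.getD k false else b.getD k false := by
  unfold newSeed
  split_ifs with h
  · rw [List.getD_append _ _ _ _ h]
  · rw [List.getD_append_right _ _ _ _ (by omega)]
    simp only [List.getD_eq_getElem?_getD, List.getElem?_drop]
    congr 2
    omega

open Classical in
/-- The time at which the random bit `b` is tossed. -/
noncomputable def tossTime (b : ℕ) : ℕ :=
  if h : ∃ t, b < seedLength C (I t).row.size then Nat.find h else 0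

theorem lt_seed_length_iff (n b : ℕ) :
    b < (memoryAt C I ω n).1.length ↔ ∃ t < n, b < seedLength C (I t).row.size := by
  induction n with
  | zero => simp [memoryAt_zero]
  | succ n ih =>
    rw [memoryAt_succ]
    simp only [sketchStep, newSeed_length, lt_max_iff, ih, tossed, List.length_map,
      List.length_range, Nat.lt_succ_iff_lt_or_eq, or_and_right, exists_or, exists_eq_left]

/-- Since `tossTime` depends on the stream and not on the coins, the stored bits are coins at fixed
distinct positions, to which the probabilistic analysis applies. -/
theorem seed_getD (n b : ℕ) (hb : b < (memoryAt C I ω n).1.length) :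
    (memoryAt C I ω n).1.getD b false = seedBits (tossTime C I) ω b := by
  induction n with
  | zero => simp [memoryAt_zero] at hb
  | succ n ih =>
    by_cases h : b < (memoryAt C I ω n).1.length
    · rw [memoryAt_succ]
      simp only [sketchStep, newSeed_getD, h, if_true]
      exact ih h
    · have hb' := (lt_seed_length_iff C I ω (n + 1) b).1 hb
      have h' := mt (lt_seed_length_iff C I ω n b).2 h
      push Not at h'
      obtain ⟨t, ht, hbt⟩ := hb'
      have htn : t = n := by
        by_contra hne
        have := h' t (by omega)
        omega
      subst htn
      have hT : tossTime C I b = t := by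
        have hex : ∃ t, b < seedLength C (I t).row.size := ⟨t, hbt⟩
        rw [tossTime, dif_pos hex]
        refine (Nat.find_eq_iff hex).2 ⟨hbt, fun m hm => ?_⟩
        have := h' m hm
        omega
      rw [memoryAt_succ]
      simp only [sketchStep, newSeed_getD, h, if_false, seedBits, hT]
      simp [tossed, hbt]

theorem bitIndex_lt {r l k i : ℕ} (hl : l < sketchRows C r) (hk : k < modBound C r) :
    bitIndex l (k + 1) (i % (k + 1)) < seedLength C r := by
  have h1 : Nat.pair (k + 1) (i % (k + 1)) < (modBound C r + 1) ^ 2 := by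
    refine (Nat.pair_lt_max_add_one_sq _ _).trans_le (Nat.pow_le_pow_left ?_ 2)
    have : i % (k + 1) < k + 1 := Nat.mod_lt i (Nat.succ_pos k)
    rw [max_eq_left (by omega)]
    omega
  refine (Nat.pair_lt_max_add_one_sq _ _).trans_le (Nat.pow_le_pow_left ?_ 2)
  have := max_le_add_of_nonneg (Nat.zero_le l) (Nat.zero_le (Nat.pair (k + 1) (i % (k + 1))))
  omega

theorem increment_congr {β β' : ℕ → Bool} (κ : ℕ) (u : Update d)
    (h : ∀ b < seedLength C u.row.size, β b = β' b) :
    increment C β κ u = increment C β' κ u := by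
  unfold increment
  split_ifs with hc
  · congr 1
    unfold hashSign hashCount
    have : ∀ k ∈ Finset.range (modBound C u.row.size),
        (β (bitIndex κ.unpair.1.unpair.2 (k + 1) (u.row % (k + 1)))).toNat =
        (β' (bitIndex κ.unpair.1.unpair.2 (k + 1) (u.row % (k + 1)))).toNat := by
      intro k hk
      rw [h _ (bitIndex_lt C hc.1.2 (Finset.mem_range.1 hk))]
    rw [Finset.sum_congr rfl this]
  · rfl

theorem encode_le (c : Option (Fin d)) : Encodable.encode c ≤ d := by
  cases c with
  | none => exact Nat.zero_le _
  | some j => exact j.2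

theorem lt_keyBound {κ : ℕ} {u : Update d}
    (h : (κ.unpair.1.unpair.1 = u.row.size ∧ κ.unpair.1.unpair.2 < sketchRows C u.row.size) ∧
      κ.unpair.2 = Nat.pair (Encodable.encode u.1.2) (u.2.2 + scaleExp C u.row.size)) :
    κ < keyBound C u := by
  have h1 : κ.unpair.1 < (u.row.size + sketchRows C u.row.size + 1) ^ 2 := by
    rw [← Nat.pair_unpair κ.unpair.1]
    refine (Nat.pair_lt_max_add_one_sq _ _).trans_le (Nat.pow_le_pow_left ?_ 2)
    have := h.1.1
    have := h.1.2
    omega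
  have h2 : κ.unpair.2 < (d + (u.2.2 + scaleExp C u.row.size) + 2) ^ 2 := by
    rw [h.2]
    refine (Nat.pair_lt_max_add_one_sq _ _).trans_le (Nat.pow_le_pow_left ?_ 2)
    have := encode_le u.1.2
    omega
  rw [← Nat.pair_unpair κ]
  refine (Nat.pair_lt_max_add_one_sq _ _).trans_le (Nat.pow_le_pow_left ?_ 2)
  omega

theorem newTable_getD (seed : List Bool) (T : List ℤ) (u : Update d) (κ : ℕ) :
    (newTable C seed T u).getD κ 0 =
      T.getD κ 0 + increment C (fun b => seed.getD b false) κ u := by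
  by_cases h : κ < max T.length (keyBound C u)
  · simp [newTable, h]
  · rw [not_lt, max_le_iff] at h
    rw [List.getD_eq_default _ _ (by simpa [newTable] using h), List.getD_eq_default _ _ h.1,
      increment, if_neg, add_zero]
    intro hc
    have := lt_keyBound C hc
    omega

/-- The table after the first `n` updates. -/
theorem table_getD (n κ : ℕ) :
    (memoryAt C I ω n).2.getD κ 0 =
      ∑ t ∈ Finset.range n, increment C (seedBits (tossTime C I) ω) κ (I t) := by
  induction n with
  | zero => simp [memoryAt_zero]
  | succ n ih =>
    rw [Finset.sum_range_succ, ← ih]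
    have h : (memoryAt C I ω (n + 1)).2 =
      newTable C (memoryAt C I ω (n + 1)).1 (memoryAt C I ω n).2 (I n) := rfl
    rw [h, newTable_getD]
    congr 1
    refine increment_congr C κ (I n) fun b hb => seed_getD C I ω (n + 1) b ?_
    exact (lt_seed_length_iff C I ω (n + 1) b).2 ⟨n, Nat.lt_succ_self n, hb⟩

theorem table_length_succ (n : ℕ) :
    (memoryAt C I ω (n + 1)).2.length =
      max (memoryAt C I ω n).2.length (keyBound C (I n)) := by
  rw [memoryAt_succ]
  simp [sketchStep, newTable]

theorem keyBound_le_length (n : ℕ) {t : ℕ} (ht : t < n) :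
    keyBound C (I t) ≤ (memoryAt C I ω n).2.length := by
  induction n with
  | zero => omega
  | succ n ih =>
    rw [table_length_succ]
    rcases Nat.lt_succ_iff_lt_or_eq.1 ht with h1 | rfl
    · exact (ih h1).trans (le_max_left _ _)
    · exact le_max_right _ _

/-- For a given sketch row and column an update touches at most one key, the one that also records
the exponent of its denominator. Numbers with different denominators are stored separately, as
integers. -/
theorem sum_increment {n t : ℕ} (ht : t < n) (β : ℕ → Bool) (r l : ℕ) (c : Option (Fin d)) :
    ∑ κ ∈ Finset.range (memoryAt C I ω n).2.length,
      (if κ.unpair.1 = Nat.pair r l ∧ κ.unpair.2.unpair.1 = Encodable.encode c then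
        (increment C β κ (I t) : ℝ) / 2 ^ κ.unpair.2.unpair.2 else 0) =
      if ((I t).row.size = r ∧ (I t).1.2 = c) ∧ l < sketchRows C r then
        (hashSign β (modBound C r) l (I t).row : ℝ) * (I t).value / 2 ^ scaleExp C r else 0 := by
  set u := I t with hu
  by_cases hc : (u.row.size = r ∧ u.1.2 = c) ∧ l < sketchRows C r
  · obtain ⟨⟨rfl, rfl⟩, hl⟩ := hc
    set κ₀ := Nat.pair (Nat.pair u.row.size l)
      (Nat.pair (Encodable.encode u.1.2) (u.2.2 + scaleExp C u.row.size)) with hκ₀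
    have hcond : (κ₀.unpair.1.unpair.1 = u.row.size ∧
        κ₀.unpair.1.unpair.2 < sketchRows C u.row.size) ∧
        κ₀.unpair.2 = Nat.pair (Encodable.encode u.1.2) (u.2.2 + scaleExp C u.row.size) := by
      simp [hκ₀, hl]
    have hmem : κ₀ < (memoryAt C I ω n).2.length :=
      (lt_keyBound C hcond).trans_le (keyBound_le_length C I ω n ht)
    rw [Finset.sum_eq_single κ₀]
    · rw [increment, if_pos hcond]
      simp only [hκ₀, Nat.unpair_pair, and_self, if_true, hl]
      push_cast
      rw [Update.value, pow_add]
      field_simp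
    · intro κ _ hne
      split_ifs with h1
      · rw [increment, if_neg, Int.cast_zero, zero_div]
        rintro ⟨-, h2⟩
        refine hne ?_
        rw [hκ₀, ← Nat.pair_unpair κ, h1.1, h2]
      · rfl
    · intro h
      exact absurd (Finset.mem_range.2 hmem) h
  · rw [if_neg hc]
    refine Finset.sum_eq_zero fun κ _ => ?_
    split_ifs with h1
    · rw [increment, if_neg, Int.cast_zero, zero_div]
      rintro ⟨⟨h2, h3⟩, h4⟩
      refine hc ?_
      rw [h1.1, Nat.unpair_pair] at h2 h3
      rw [h4, Nat.unpair_pair] at h1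
      simp only at h2 h3
      subst h2
      exact ⟨⟨rfl, Encodable.encode_injective h1.2⟩, h3⟩
    · rfl

theorem sketchEntry_eq (n r l : ℕ) (c : Option (Fin d)) :
    (sketchEntry (memoryAt C I ω n).2 (Nat.pair r l) (Encodable.encode c) : ℝ) =
      2 ^ (memoryAt C I ω n).2.length * if l < sketchRows C r then
        (∑ i ∈ block r, (hashSign (seedBits (tossTime C I) ω) (modBound C r) l i : ℝ) *
          entry I n (i, c)) / 2 ^ scaleExp C r else 0 := by
  set T := (memoryAt C I ω n).2 with hT
  set β := seedBits (tossTime C I) ω with hβ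
  have h1 : (sketchEntry T (Nat.pair r l) (Encodable.encode c) : ℝ) = 2 ^ T.length *
      ∑ t ∈ Finset.range n, ∑ κ ∈ Finset.range T.length,
      (if κ.unpair.1 = Nat.pair r l ∧ κ.unpair.2.unpair.1 = Encodable.encode c then
        (increment C β κ (I t) : ℝ) / 2 ^ κ.unpair.2.unpair.2 else 0) := by
    rw [Finset.sum_comm, Finset.mul_sum, sketchEntry]
    push_cast
    refine Finset.sum_congr rfl fun κ hκ => ?_
    split_ifs with h
    -- The exponent of the denominator is at most the key itself, so the subtraction in
    -- `sketchEntry` is not truncated and `2 ^ T.length` clears every denominator.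
    · have hle : κ.unpair.2.unpair.2 ≤ T.length :=
        ((Nat.unpair_right_le _).trans (Nat.unpair_right_le κ)).trans (Finset.mem_range.1 hκ).le
      rw [hT, table_getD C I ω n κ, ← hT, ← hβ, ← Finset.sum_div, ← Nat.sub_add_cancel hle, pow_add,
        Nat.add_sub_cancel]
      push_cast
      field_simp
    · simp
  rw [h1, Finset.sum_congr rfl fun t ht => sum_increment C I ω (Finset.mem_range.1 ht) β r l c]
  congr 1
  split_ifs with hl
  · simp only [hl, and_true]
    simp only [entry, Finset.mul_sum]
    rw [Finset.sum_comm, Finset.sum_div]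
    refine Finset.sum_congr rfl fun t _ => ?_
    by_cases hc : (I t).row.size = r ∧ (I t).1.2 = c
    · rw [if_pos hc, Finset.sum_eq_single (I t).row]
      · rw [if_pos]
        rw [← hc.2]
        rfl
      · intro i _ hne
        rw [if_neg, mul_zero]
        intro h
        exact hne (by simp [Update.row, h])
      · intro h
        exact absurd (mem_block.2 hc.1) h
    · rw [if_neg hc, Finset.sum_eq_zero, zero_div]
      intro i hi
      rw [if_neg, mul_zero]
      intro h
      refine hc ⟨?_, by rw [h]⟩
      rw [Update.row, h]
      exact mem_block.1 hi
  · simp [hl]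

theorem scaledValue_eq (n r l : ℕ) (z : Option (Fin d) → ℝ) :
    scaledValue (memoryAt C I ω n).2 (Nat.pair r l) z =
      2 ^ (memoryAt C I ω n).2.length * if l < sketchRows C r then
        sketchValue C (seedBits (tossTime C I) ω) I n r l z else 0 := by
  simp only [scaledValue, sketchEntry_eq]
  split_ifs with hl
  · simp only [sketchValue, rowValue, Finset.mul_sum, Finset.sum_div, Finset.sum_mul]
    rw [Finset.sum_comm]
    refine Finset.sum_congr rfl fun i _ => Finset.sum_congr rfl fun c _ => ?_
    ring
  · simp [-Fintype.sum_option]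

theorem sum_scaledValue_sq (n : ℕ) {R : ℕ} (hR : rowCount I n ≤ R) (z : Option (Fin d) → ℝ) :
    ∑ ρ ∈ Finset.range (memoryAt C I ω n).2.length, scaledValue (memoryAt C I ω n).2 ρ z ^ 2 =
      (2 ^ (memoryAt C I ω n).2.length) ^ 2 *
        ∑ r ∈ Finset.range R, blockSketchSq C (seedBits (tossTime C I) ω) I n r z := by
  set T := (memoryAt C I ω n).2 with hT
  set S := (Finset.range R).sigma (fun r => Finset.range (sketchRows C r)) with hS
  set P := S.image fun p => Nat.pair p.1 p.2 with hP
  have h0 : ∀ ρ, T.length ≤ ρ → scaledValue T ρ z = 0 := by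
    intro ρ hρ
    refine Finset.sum_eq_zero fun c _ => ?_
    rw [sketchEntry, Finset.sum_eq_zero, Int.cast_zero, zero_mul]
    intro κ hκ
    rw [if_neg]
    rintro ⟨h, -⟩
    have := Nat.unpair_left_le κ
    have := Finset.mem_range.1 hκ
    omega
  have h1 : ∀ ρ ∉ P, scaledValue T ρ z = 0 := by
    intro ρ hρ
    rw [← Nat.pair_unpair ρ, hT, scaledValue_eq]
    split_ifs with hl
    · have hr : R ≤ ρ.unpair.1 := by
        by_contra! hlt
        refine hρ (Finset.mem_image.2 ⟨⟨ρ.unpair.1, ρ.unpair.2⟩, ?_, Nat.pair_unpair ρ⟩)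
        exact Finset.mem_sigma.2 ⟨Finset.mem_range.2 hlt, Finset.mem_range.2 hl⟩
      rw [sketchValue, Finset.sum_eq_zero, zero_div, mul_zero]
      intro i hi
      have h2 : ρ.unpair.1 ≤ i := by
        rw [← mem_block.1 hi]
        exact Nat.size_le.2 Nat.lt_two_pow_self
      rw [rowValue, Finset.sum_eq_zero, mul_zero]
      intro c _
      rw [entry_eq_zero_of_rowCount_le I n (by omega), zero_mul]
    · rw [mul_zero]
  have h2 : ∑ ρ ∈ Finset.range T.length, scaledValue T ρ z ^ 2 =
      ∑ ρ ∈ P, scaledValue T ρ z ^ 2 := by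
    -- Keys beyond the table and pairs outside `P` both have value zero, so both sums agree with the
    -- sum over the union.
    rw [Finset.sum_subset (Finset.subset_union_left (s₂ := P)) fun ρ _ hρ => ?_,
      ← Finset.sum_subset (Finset.subset_union_right (s₁ := Finset.range T.length)) fun ρ _ hρ => ?_]
    · rw [h1 ρ hρ]; simp
    · rw [h0 ρ (by simpa using hρ)]; simp
  rw [h2, hP, Finset.sum_image, hS, Finset.sum_sigma, Finset.mul_sum]
  · refine Finset.sum_congr rfl fun r _ => ?_
    rw [blockSketchSq, Finset.mul_sum]
    refine Finset.sum_congr rfl fun l hl => ?_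
    rw [hT, scaledValue_eq, if_pos (Finset.mem_range.1 hl), mul_pow]
  · rintro ⟨r, l⟩ _ ⟨r', l'⟩ _ h
    obtain ⟨rfl, rfl⟩ := Nat.pair_eq_pair.1 h
    rfl

/-- The algorithm minimizes the sketched objective. -/
theorem isSketchMinimizer_solution (n : ℕ) :
    IsSketchMinimizer C (seedBits (tossTime C I) ω) I n ((sketchAlg d C).solution I ω n) := by
  intro R hR y
  have h := (isSketchSolution_sketchSolution d (memoryAt C I ω n).2).sum_sq_le y
  rw [sum_scaledValue_sq C I ω n hR, sum_scaledValue_sq C I ω n hR] at h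
  exact le_of_mul_le_mul_left h (by positivity)

end Algorithm

/-! ### Polylogarithmic memory -/

section MemoryBound

variable {d : ℕ} (C : ℕ) (I : Stream d) (ω : Coins)

theorem seed_length_le {n S : ℕ} (h : ∀ t < n, seedLength C (I t).row.size ≤ S) :
    (memoryAt C I ω n).1.length ≤ S := by
  by_contra! hS
  obtain ⟨t, ht, hlt⟩ := (lt_seed_length_iff C I ω n S).1 hS
  exact absurd (h t ht) (not_le.2 hlt)

theorem table_length_le {n S : ℕ} (h : ∀ t < n, keyBound C (I t) ≤ S) :
    (memoryAt C I ω n).2.length ≤ S := by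
  induction n with
  | zero => simp [memoryAt_zero]
  | succ n ih =>
    rw [table_length_succ]
    exact max_le (ih fun t ht => h t (by omega)) (h n (Nat.lt_succ_self n))

theorem natAbs_increment_le (β : ℕ → Bool) (κ : ℕ) (u : Update d) :
    (increment C β κ u).natAbs ≤ u.2.1.natAbs := by
  unfold increment hashSign
  split_ifs <;> simp

theorem natAbs_table_le {n M : ℕ} (h : ∀ t < n, (I t).2.1.natAbs ≤ M) {x : ℤ}
    (hx : x ∈ (memoryAt C I ω n).2) : x.natAbs ≤ n * M := by
  obtain ⟨κ, hκ, rfl⟩ := List.mem_iff_getElem.1 hx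
  rw [← List.getD_eq_getElem _ 0 hκ, table_getD]
  refine (Int.natAbs_sum_le _ _).trans ?_
  refine (Finset.sum_le_card_nsmul _ _ M fun t ht => ?_).trans (by simp)
  exact (natAbs_increment_le C _ κ (I t)).trans (h t (Finset.mem_range.1 ht))

theorem encode_int_le (x : ℤ) : Encodable.encode x ≤ 2 * x.natAbs := by
  rcases x with n | n
  · exact le_refl (2 * n)
  · show 2 * n + 1 ≤ 2 * (n + 1)
    omega

theorem two_pow_size_le (m : ℕ) : 2 ^ m.size ≤ 2 * m + 1 := by
  rcases h : m.size with _ | k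
  · simp
  · have := Nat.lt_size.1 (h ▸ Nat.lt_succ_self k : k < m.size)
    rw [pow_succ]
    omega

theorem size_le_self (m : ℕ) : m.size ≤ m := Nat.size_le.2 Nat.lt_two_pow_self

theorem sketchRows_le {r Y : ℕ} (h : r + C + 1 ≤ Y) : sketchRows C r ≤ 2 ^ 24 * Y ^ 8 := by
  have h1 : 2 ^ (r + C).size ≤ 2 * Y := (two_pow_size_le _).trans (by omega)
  calc sketchRows C r = 2 ^ 16 * (2 ^ (r + C).size) ^ 8 := by
        rw [sketchRows, scaleExp, pow_add, ← pow_mul, show (4 : ℕ) = 2 ^ 2 from rfl, ← pow_mul,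
          ← pow_mul]
        congr 2
        ring
    _ ≤ 2 ^ 16 * (2 * Y) ^ 8 := by gcongr
    _ = 2 ^ 24 * Y ^ 8 := by ring

theorem seedLength_le {r Y : ℕ} (h : r + C + 1 ≤ Y) : seedLength C r ≤ 2 ^ 50 * Y ^ 16 := by
  have hY : 1 ≤ Y := by omega
  have h1 := sketchRows_le C h
  have h2 : modBound C r + 1 ≤ 17 * Y ^ 2 := by
    have h3 : (r + C) ^ 2 ≤ Y ^ 2 := Nat.pow_le_pow_left (by omega) 2
    have h4 : 1 ≤ Y ^ 2 := Nat.one_le_pow _ _ hY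
    unfold modBound
    omega
  have h3 : (modBound C r + 1) ^ 2 ≤ 289 * Y ^ 8 :=
    calc (modBound C r + 1) ^ 2 ≤ (17 * Y ^ 2) ^ 2 := Nat.pow_le_pow_left h2 2
      _ = 289 * Y ^ 4 := by ring
      _ ≤ 289 * Y ^ 8 := Nat.mul_le_mul_left _ (Nat.pow_le_pow_right hY (by norm_num))
  have h4 : 1 ≤ Y ^ 8 := Nat.one_le_pow _ _ hY
  calc seedLength C r ≤ (2 ^ 25 * Y ^ 8) ^ 2 := Nat.pow_le_pow_left (by omega) 2
    _ = 2 ^ 50 * Y ^ 16 := by ring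

theorem keyBound_le {u : Update d} {B Y : ℕ} (hr : u.row.size ≤ B) (hs : u.2.2 ≤ B)
    (h : B + C + d + 1 ≤ Y) : keyBound C u ≤ 2 ^ 102 * Y ^ 32 := by
  have hY : 1 ≤ Y := by omega
  have h1 := sketchRows_le C (show u.row.size + C + 1 ≤ Y by omega)
  have h2 : scaleExp C u.row.size ≤ 12 * Y := by
    have := size_le_self (u.row.size + C)
    unfold scaleExp
    omega
  have h3 : Y ≤ Y ^ 8 := Nat.le_self_pow (by norm_num) Y
  have h4 : (u.row.size + sketchRows C u.row.size + 1) ^ 2 ≤ 2 ^ 50 * Y ^ 16 :=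
    calc (u.row.size + sketchRows C u.row.size + 1) ^ 2 ≤ (2 ^ 25 * Y ^ 8) ^ 2 :=
          Nat.pow_le_pow_left (by omega) 2
      _ = 2 ^ 50 * Y ^ 16 := by ring
  have h5 : (d + (u.2.2 + scaleExp C u.row.size) + 2) ^ 2 ≤ 256 * Y ^ 16 :=
    calc (d + (u.2.2 + scaleExp C u.row.size) + 2) ^ 2 ≤ (16 * Y) ^ 2 :=
          Nat.pow_le_pow_left (by omega) 2
      _ = 256 * Y ^ 2 := by ring
      _ ≤ 256 * Y ^ 16 := Nat.mul_le_mul_left _ (Nat.pow_le_pow_right hY (by norm_num))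
  have h6 : 1 ≤ Y ^ 16 := Nat.one_le_pow _ _ hY
  calc keyBound C u ≤ (2 ^ 51 * Y ^ 16) ^ 2 := Nat.pow_le_pow_left (by omega) 2
    _ = 2 ^ 102 * Y ^ 32 := by ring

/-- The table dominates: order `Y ^ 32` entries of at most `Y` symbols each, which gives the
exponent `33`. -/
theorem memory_le {n B Y : ℕ} (hr : ∀ t < n, (I t).row.size ≤ B) (hs : ∀ t < n, (I t).2.2 ≤ B)
    (hx : ∀ x ∈ (memoryAt C I ω n).2, (Encodable.encode x).size ≤ B)
    (h : B + C + d + 1 ≤ Y) : (sketchAlg d C).memory I ω n ≤ 2 ^ 104 * Y ^ 33 := by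
  have hY : 1 ≤ Y := by omega
  have h1 : (memoryAt C I ω n).1.length ≤ 2 ^ 50 * Y ^ 16 :=
    seed_length_le C I ω fun t ht => seedLength_le C (by have := hr t ht; omega)
  have h2 : (memoryAt C I ω n).2.length ≤ 2 ^ 102 * Y ^ 32 :=
    table_length_le C I ω fun t ht => keyBound_le C (hr t ht) (hs t ht) h
  have h3 : ((memoryAt C I ω n).2.map fun x => 1 + (Encodable.encode x).size).sum ≤
      2 ^ 102 * Y ^ 33 :=
    calc ((memoryAt C I ω n).2.map fun x => 1 + (Encodable.encode x).size).sum
        ≤ (memoryAt C I ω n).2.length * Y := by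
          refine (List.sum_le_card_nsmul _ Y fun y hy => ?_).trans (by simp)
          obtain ⟨x, hxm, rfl⟩ := List.mem_map.1 hy
          have := hx x hxm
          omega
      _ ≤ 2 ^ 102 * Y ^ 32 * Y := Nat.mul_le_mul_right _ h2
      _ = 2 ^ 102 * Y ^ 33 := by ring
  have h4 : Y ^ 16 ≤ Y ^ 33 := Nat.pow_le_pow_right hY (by norm_num)
  show (memoryCode (memoryAt C I ω n)).length ≤ _
  rw [memoryCode_length]
  omega

/-- Both `(size - 1) * log 2` and `log 2` are at most `log (n + 2)`, and `log 2 > 1 / 2`. -/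
theorem size_add_two_le_log (n : ℕ) : ((n + 2).size : ℝ) ≤ 4 * Real.log ((n : ℝ) + 2) := by
  have h1 : 2 ^ ((n + 2).size - 1) ≤ n + 2 :=
    Nat.lt_size.1 (Nat.sub_lt (Nat.size_pos.2 (Nat.succ_pos (n + 1))) one_pos)
  have h2 : (2 : ℝ) ^ ((n + 2).size - 1) ≤ (n : ℝ) + 2 := by exact_mod_cast h1
  have h3 := Real.log_le_log (by positivity) h2
  rw [Real.log_pow] at h3
  have h4 : Real.log 2 ≤ Real.log ((n : ℝ) + 2) :=
    Real.log_le_log (by norm_num) (by have := n.cast_nonneg (α := ℝ); linarith)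
  have h5 := Real.log_two_gt_d9
  have h6 : ((n + 2).size : ℝ) ≤ (((n + 2).size - 1 : ℕ) : ℝ) + 1 := by
    exact_mod_cast (by omega : (n + 2).size ≤ (n + 2).size - 1 + 1)
  nlinarith [(((n + 2).size - 1).cast_nonneg (α := ℝ))]

theorem cast_mul_pow_le (a L : ℕ) {p q : ℕ} {ℓ : ℝ} (h : (L : ℝ) ≤ 4 * ℓ) :
    ((2 ^ p * (a * L) ^ q : ℕ) : ℝ) ≤ 2 ^ p * (4 * (a : ℝ)) ^ q * ℓ ^ q := by
  rw [mul_assoc, ← mul_pow, Nat.cast_mul, Nat.cast_pow, Nat.cast_pow, Nat.cast_mul, Nat.cast_ofNat]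
  refine mul_le_mul_of_nonneg_left (pow_le_pow_left₀ (by positivity) ?_ q) (by positivity)
  calc (a : ℝ) * L ≤ a * (4 * ℓ) := by gcongr
    _ = 4 * a * ℓ := by ring

/-- The memory of the algorithm is polylogarithmic in the number of updates. -/
theorem memory_le_log {c Δ : ℕ} (hI : LogBits c Δ I) (n : ℕ) :
    ((sketchAlg d C).memory I ω n : ℝ) ≤
      2 ^ 104 * (4 * (c + Δ + C + d + 3 : ℕ)) ^ 33 * Real.log ((n : ℝ) + 2) ^ 33 := by
  set L := (n + 2).size with hL
  have hL1 : 1 ≤ L := Nat.size_pos.2 (Nat.succ_pos (n + 1))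
  have hn : n + 2 < 2 ^ L := Nat.lt_size_self _
  set M := c * (n + 2) ^ Δ with hM
  have hMle : M < 2 ^ (c + Δ * L) := by
    have h1 : (n + 2) ^ Δ ≤ 2 ^ (Δ * L) := by
      rw [mul_comm Δ, pow_mul]
      exact Nat.pow_le_pow_left hn.le Δ
    calc M < 2 ^ c * (n + 2) ^ Δ :=
          Nat.mul_lt_mul_of_pos_right Nat.lt_two_pow_self (Nat.pow_pos (Nat.succ_pos _))
      _ ≤ 2 ^ c * 2 ^ (Δ * L) := Nat.mul_le_mul_left _ h1
      _ = 2 ^ (c + Δ * L) := (pow_add _ _ _).symm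
  have hc : c ≤ c * L := Nat.le_mul_of_pos_right c hL1
  have hB : (c + Δ + 2) * L = c * L + Δ * L + 2 * L := by ring
  have htM : ∀ t < n, c * (t + 1) ^ Δ ≤ M := fun t ht =>
    Nat.mul_le_mul_left _ (Nat.pow_le_pow_left (by omega) Δ)
  have hr : ∀ t < n, (I t).row.size ≤ (c + Δ + 2) * L := fun t ht =>
    (Nat.size_le.2 (((hI t).1.trans (htM t ht)).trans_lt hMle)).trans (by omega)
  have hs : ∀ t < n, (I t).2.2 ≤ (c + Δ + 2) * L := fun t ht => by
    have := (Nat.pow_lt_pow_iff_right (by norm_num)).1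
      (((hI t).2.2.trans (htM t ht)).trans_lt hMle)
    omega
  have hx : ∀ x ∈ (memoryAt C I ω n).2, (Encodable.encode x).size ≤ (c + Δ + 2) * L := by
    intro x hx
    have h1 := natAbs_table_le C I ω (fun t ht => (hI t).2.1.trans (htM t ht)) hx
    have h2 : Encodable.encode x < 2 ^ (1 + (L + (c + Δ * L))) :=
      calc Encodable.encode x ≤ 2 * (n * M) :=
            (encode_int_le x).trans (Nat.mul_le_mul_left _ h1)
        _ ≤ 2 * (2 ^ L * M) := by gcongr; omega
        _ < 2 * (2 ^ L * 2 ^ (c + Δ * L)) := by gcongr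
        _ = 2 ^ (1 + (L + (c + Δ * L))) := by rw [pow_add 2 1, pow_add 2 L, pow_one]
    exact (Nat.size_le.2 h2).trans (by omega)
  have hY : (c + Δ + 2) * L + C + d + 1 ≤ (c + Δ + C + d + 3) * L := by
    have h1 : C + d + 1 ≤ (C + d + 1) * L := Nat.le_mul_of_pos_right _ hL1
    have h2 : (c + Δ + C + d + 3) * L = (c + Δ + 2) * L + (C + d + 1) * L := by ring
    omega
  have h := memory_le C I ω hr hs hx hY
  exact (Nat.cast_le.2 h).trans (cast_mul_pow_le _ _ (size_add_two_le_log n))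

end MemoryBound

/-! ### A null sequence of accuracies, and the conclusion -/

theorem IsApproxSolution.mono {m d : ℕ} {A : Matrix (Fin m) (Fin d) ℝ}
    {b : EuclideanSpace ℝ (Fin m)} {η η' : ℝ} {x : EuclideanSpace ℝ (Fin d)}
    (h : IsApproxSolution A b η x) (hη : η ≤ η') : IsApproxSolution A b η' x := fun y =>
  (h y).trans (mul_le_mul_of_nonneg_right (by linarith) (residual_nonneg A b y))

/-- Take the infimum of the admissible accuracies; as it need not be attained, `1 / (n + 1)` is
added. -/
theorem exists_tendsto_zero {P : ℕ → ℝ → Prop} (hmono : ∀ n η η', η ≤ η' → P n η → P n η')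
    (h1 : ∀ n, P n 1) (hev : ∀ η, 0 < η → ∀ᶠ n in atTop, P n η) :
    ∃ ε : ℕ → ℝ, Tendsto ε atTop (𝓝 0) ∧ ∀ n, P n (ε n) := by
  have hbdd : ∀ n, BddBelow {η | 0 < η ∧ P n η} := fun n => ⟨0, fun η hη => hη.1.le⟩
  refine ⟨fun n => sInf {η | 0 < η ∧ P n η} + 1 / ((n : ℝ) + 1), ?_, fun n => ?_⟩
  · suffices h : Tendsto (fun n => sInf {η | 0 < η ∧ P n η}) atTop (𝓝 0) by
      simpa using h.add tendsto_one_div_add_atTop_nhds_zero_nat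
    refine tendsto_order.2 ⟨fun a ha => Eventually.of_forall fun n => ?_, fun a ha => ?_⟩
    · exact ha.trans_le (Real.sInf_nonneg fun η hη => hη.1.le)
    · filter_upwards [hev (a / 2) (half_pos ha)] with n hn
      exact (csInf_le (hbdd n) ⟨half_pos ha, hn⟩).trans_lt (half_lt_self ha)
  · obtain ⟨η, hη, hlt⟩ := exists_lt_of_csInf_lt (s := {η | 0 < η ∧ P n η})
      ⟨1, one_pos, h1 n⟩ (lt_add_of_pos_right (sInf {η | 0 < η ∧ P n η})
        (by positivity : 0 < 1 / ((n : ℝ) + 1)))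
    exact hmono n _ _ hlt.le hη.2

end StreamRegression

theorem mainTheorem10 :
    ∃ k : ℕ, ∀ (d : ℕ) (δ : ℝ), 0 < d → 0 < δ → δ < 1 →
      ∃ alg : StreamRegression.StreamAlg d,
        ∀ c Δ : ℕ, ∃ K : ℝ, ∀ I : StreamRegression.Stream d,
          StreamRegression.LogBits c Δ I →
          StreamRegression.UniqueUpdates I →
          Tendsto (fun n => StreamRegression.smallestSingularValue
            (StreamRegression.dataMatrix I n)) atTop atTop →
          (∀ (ω : StreamRegression.Coins) (n : ℕ),
            (alg.memory I ω n : ℝ) ≤ K * Real.log ((n : ℝ) + 2) ^ k) ∧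
          ∃ ε : ℕ → ℝ, Tendsto ε atTop (𝓝 0) ∧
            ENNReal.ofReal (1 - δ) ≤ StreamRegression.coinMeasure
              {ω | ∀ n : ℕ, StreamRegression.IsApproxSolution
                (StreamRegression.dataMatrix I n) (StreamRegression.target I n) (ε n)
                (alg.solution I ω n)} := by
  refine ⟨33, fun d δ hd hδ _ => ?_⟩
  obtain ⟨C, hC, hbad⟩ := StreamRegression.exists_bad_set_stream d hδ
  refine ⟨StreamRegression.sketchAlg d C, fun c Δ =>
    ⟨2 ^ 104 * (4 * (c + Δ + C + d + 3 : ℕ)) ^ 33, fun I hLog hI hσ =>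
      ⟨fun ω n => StreamRegression.memory_le_log C I ω hLog n, ?_⟩⟩⟩
  obtain ⟨bad, hμ, hgood⟩ := hbad I hI (StreamRegression.tossTime C I)
  -- The property is required for all outcomes outside `bad` at once, so that the sequence does not
  -- depend on the coins.
  obtain ⟨ε, hε, hP⟩ := StreamRegression.exists_tendsto_zero
    (P := fun n η => ∀ ω ∉ bad, StreamRegression.IsApproxSolution
      (StreamRegression.dataMatrix I n) (StreamRegression.target I n) η
      ((StreamRegression.sketchAlg d C).solution I ω n))
    (fun n η η' hη h ω hω => (h ω hω).mono hη)
    (fun n ω hω => StreamRegression.GoodSeed.isApproxSolution_one (hgood ω hω) hC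
      (StreamRegression.isSketchMinimizer_solution C I ω n))
    (fun η hη => (StreamRegression.eventually_isApproxSolution hI hd hC hσ hη).mono
      fun n h ω hω => h _ (hgood ω hω) _ (StreamRegression.isSketchMinimizer_solution C I ω n))
  refine ⟨ε, hε, le_trans ?_ (measure_mono fun ω (hω : ω ∈ badᶜ) n => hP n ω hω)⟩
  -- Subadditivity is used because `bad` is not known to be measurable.
  have h1 : 1 ≤ StreamRegression.coinMeasure bad + StreamRegression.coinMeasure badᶜ := by
    rw [← measure_univ (μ := StreamRegression.coinMeasure), ← Set.union_compl_self bad]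
    exact measure_union_le _ _
  rw [ENNReal.ofReal_sub _ hδ.le, ENNReal.ofReal_one]
  refine tsub_le_iff_left.2 (h1.trans ?_)
  gcongr
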